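/- **Equivalence of the Kustaanheimo–Stiefel and Cayley regularizations.** Let $n\ge 1$, let $E$ be the $n\times n$ unit matrix and $H(n)$ the hermitian $n\times n$ matrices; $(\cdot)^+$ is the conjugate transpose. For a submanifold $M$ of a real vector space with a one-form $\theta$, let $M/_\sim$ be the set of leaves of the degeneracy distribution of $d\theta|_M$ (points are equivalent when joined by finitely many smooth curves in $M$ tangent to the kernel of $d\theta|_M$). Consider * $\tilde{\mathcal T}=\{(\upsilon,\zeta)\in\mathbb C^n\oplus\mathbb C^n : (\upsilon,\zeta)\neq0,\ \zeta^+\upsilon=\upsilon^+\zeta\}$ with $\tilde\gamma_{+-}=\upsilon^+d\zeta-\zeta^+d\upsilon$, Hamiltonian $\tilde I_{++}=\upsilon^+\upsilon+\zeta^+\zeta$, and $\tilde J_{+-}(\upsilon,\zeta)=\begin{pmatrix}\upsilon\zeta^+&-\upsilon\upsilon^+\\ \zeta\zeta^+&-\zeta\upsilon^+\end{pmatrix}$; * $\mathcal T=\{(\eta,\xi)\neq 0 : \eta^+\eta=\xi^+\xi\}$ with $\gamma_{+-}=i(\eta^+d\eta-\xi^+d\xi)$, Hamiltonian $I_{++}=\eta^+\eta+\xi^+\xi$,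 and $J_{+-}(\eta,\xi)=i\begin{pmatrix}-\eta\eta^+&\eta\xi^+\\-\xi\eta^+&\xi\xi^+\end{pmatrix}$; * $\tilde{\mathcal O}=\{(Y,X)\in H(n)\times H(n): X\ge0,\ \operatorname{rank}X=1\}$ with $\tilde\gamma_0=-\operatorname{Tr}(X\,dY)$, Hamiltonian $\tilde I_0=\operatorname{Tr}(X(E+Y^2))$, and $\tilde J_0(Y,X)=\begin{pmatrix}YX&-YXY\\X&-XY\end{pmatrix}$; * $\mathcal O\subset U(n)\times iH(n)\cong T^*U(n)$, the orbit of $(E,\rho_{10})$, $\rho_{10}=i\,\mathrm{diag}(1,0,\dots,0)$, under $U(n,n)=\{g: g^+\phi g=\phi\}$, $\phi=\mathrm{diag}(E,-E)$, acting by $\Lambda_g(Z,\rho)=((AZ+B)(CZ+D)^{-1},(CZ+D)\rho(CZ+D)^+)$ for $g=\begin{pmatrix}A&B\\C&D\end{pmatrix}$, with $\gamma_0=\operatorname{Tr}(\rho Z^+dZ)$ and $J_0(Z,\rho)=\begin{pmatrix}-Z\rho Z^+&Z\rho\\(Z\rho)^+&\rho\end{pmatrix}$. Let $\mathcal C=\frac1{\sqrt2}\begin{pmatrix}E&-iE\\-iE&E\end{pmatrix}$,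 let $\mathcal N=\{gJ_0(E,\rho_{10})g^{-1}: g\in U(n,n)\}$ and $\tilde{\mathcal N}=\mathcal C^{+}\mathcal N\mathcal C$, and let $T^*_{\mathcal C}(Y,X)=\big((Y-iE)(-iY+E)^{-1},\tfrac i2(-iY+E)X(-iY+E)^+\big)$. (a) All these maps descend to the spaces of leaves: $\tilde J_0/_\sim:\tilde{\mathcal O}/_\sim\to\tilde{\mathcal N}$, $T^*_{\mathcal C}/_\sim:\tilde{\mathcal O}/_\sim\to\mathcal O/_\sim$, and bijections $\tilde J_{+-}/_\sim:\tilde{\mathcal T}/_\sim\to\tilde{\mathcal N}$, $J_0/_\sim:\mathcal O/_\sim\to\mathcal N$, $J_{+-}/_\sim:\mathcal T/_\sim\to\mathcal N$, $\mathcal C/_\sim:\tilde{\mathcal T}/_\sim\to\mathcal T/_\sim$. Put $$\mathcal K_{reg}=(\tilde J_{+-}/_\sim)^{-1}\circ(\tilde J_0/_\sim),\qquad \mathcal C_{reg}=(J_{+-}/_\sim)^{-1}\circ(J_0/_\sim)\circ(T^*_{\mathcal C}/_\sim).$$ Then $\mathcal C_{reg}=(\mathcal C/_\sim)\circ\mathcal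 K_{reg}$. (b) The two regularizations are equivalent: $\mathcal K_{reg}$ and $\mathcal C_{reg}$ are injective smooth symplectic maps of the reduced spaces that take $\tilde I_0/_\sim$ to $\tilde I_{++}/_\sim$ and to $I_{++}/_\sim$, respectively, and $\mathcal C/_\sim$ is an isomorphism of the Hamiltonian systems $(\tilde{\mathcal T}/_\sim,\tilde I_{++}/_\sim)$ and $(\mathcal T/_\sim,I_{++}/_\sim)$ (smooth and symplectic in both directions). (c) $\mathcal K_{reg}[(Y,\zeta\zeta^+)]=[(Y\zeta,\zeta)]$ for $Y\in H(n)$, $\zeta\ne0$; the image of $\mathcal K_{reg}$ is $\{[(\upsilon,\zeta)]:\zeta\neq0\}$; and the generalized Kustaanheimo–Stiefel transformation $\mathcal S(\upsilon,\zeta)=\Big(\frac1{\zeta^+\zeta}\big[\zeta\upsilon^++\upsilon\zeta^+-\tfrac12(\upsilon^+\zeta+\zeta^+\upsilon)E\big],\ \zeta\zeta^+\Big)$ satisfies $\mathcal S(\upsilon,\zeta)\in\tilde{\mathcal O}$ and $\mathcal K_{reg}[\mathcal S(\upsilon,\zeta)]=[(\upsilon,\zeta)]$ for $(\upsilon,\zeta)\in\tilde{\mathcal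 T}$, $\zeta\neq0$. (d) Let $n=2$ and $\sigma_1=\begin{pmatrix}0&1\\1&0\end{pmatrix}$, $\sigma_2=\begin{pmatrix}0&i\\-i&0\end{pmatrix}$, $\sigma_3=\begin{pmatrix}1&0\\0&-1\end{pmatrix}$. The Kustaanheimo–Stiefel transformation $$\vec y=\frac1{\zeta^+\zeta}\,\frac12\,(\upsilon^+\vec\sigma\zeta+\zeta^+\vec\sigma\upsilon),\qquad \vec x=\zeta^+\vec\sigma\zeta$$ is smooth on $\{\zeta\ne0\}$ and induces a bijection of $\{[(\upsilon,\zeta)]:\zeta\neq0\}\subset\tilde{\mathcal T}/_\sim$ onto $\{(\vec y,\vec x)\in\mathbb R^3\times\mathbb R^3:\vec x\neq0\}$. On $\{(\upsilon,\zeta)\in\tilde{\mathcal T}:\zeta\ne0\}$ the pull-back of $\sum_k dy_k\wedge dx_k$ is $d\tilde\gamma_{+-}$, one has $\tilde I_{++}=\|\vec x\|(1+\vec y^{\,2})$, the Kepler Hamiltonian (in fictitious time), and $\mathcal S(\upsilon,\zeta)=\big(\vec y\cdot\vec\sigma,\ \tfrac12(\|\vec x\|E+\vec x\cdot\vec\sigma)\big)$.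 Conversely, for all $\vec y$ and all $\vec x\neq0$, the pair $(Y,X)=\big(\vec y\cdot\vec\sigma,\tfrac12(\|\vec x\|E+\vec x\cdot\vec\sigma)\big)$ lies in $\tilde{\mathcal O}$, the Kustaanheimo–Stiefel transformation sends $\mathcal K_{reg}[(Y,X)]$ to $(\vec y,\vec x)$, and $\tilde I_0(Y,X)=\|\vec x\|(1+\vec y^{\,2})$. -/

import Mathlib

open Matrix Set
open scoped ContDiff ComplexOrder

attribute [local instance] Matrix.normedAddCommGroup Matrix.normedSpace

noncomputable section

namespace KSCayley

/-! ## Submanifolds of a vector space, degeneracy leaves, reduction -/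

section Reduction

variable {V W : Type*} [NormedAddCommGroup V] [NormedSpace ℝ V]
  [NormedAddCommGroup W] [NormedSpace ℝ W]

/-- The exterior derivative `(dθ)_p(u, w)` of a (complex valued) one-form `θ` on a vector space,
evaluated on the constant vector fields `u`, `w`: `u(θ(w)) - w(θ(u))`. -/
def extD (θ : V → V → ℂ) (p u w : V) : ℂ :=
  lineDeriv ℝ (fun q => θ q w) p u - lineDeriv ℝ (fun q => θ q u) p w

/-- Tangent vectors at `p` of a subset `M`: velocities of smooth curves `]-ε, ε[ → M` through
`p`. -/
def tangentVecs (M : Set V) (p : V) : Set V :=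
  {u | ∃ ε : ℝ, 0 < ε ∧ ∃ c : ℝ → V, ContDiffOn ℝ ∞ c (Ioo (-ε) ε) ∧
    (∀ t ∈ Ioo (-ε) ε, c t ∈ M) ∧ c 0 = p ∧ deriv c 0 = u}

/-- The degeneracy (characteristic) directions at `p` of the restriction of `dθ` to `M`. -/
def degenerateVecs (θ : V → V → ℂ) (M : Set V) (p : V) : Set V :=
  {u ∈ tangentVecs M p | ∀ w ∈ tangentVecs M p, extD θ p u w = 0}

/-- `p` and `q` are joined by a smooth curve in `M` that is everywhere tangent to the
degeneracy directions of `dθ` restricted to `M`. -/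
def LeafStep (θ : V → V → ℂ) (M : Set V) (p q : M) : Prop :=
  ∃ c : ℝ → V, ContDiff ℝ ∞ c ∧ c 0 = p ∧ c 1 = q ∧
    ∀ t, c t ∈ M ∧ deriv c t ∈ degenerateVecs θ M (c t)

/-- The equivalence relation whose classes are the degeneracy leaves of `dθ` restricted to `M`:
being joined by finitely many successive curves as in `LeafStep`. -/
def leafSetoid (θ : V → V → ℂ) (M : Set V) : Setoid M :=
  Relation.EqvGen.setoid (LeafStep θ M)

/-- The reduced space `M/∼`. -/
def Reduced (θ : V → V → ℂ) (M : Set V) : Type _ := Quotient (leafSetoid θ M)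

/-- The class (degeneracy leaf) of a point of `M`. -/
def cls (θ : V → V → ℂ) (M : Set V) (p : V) (hp : p ∈ M) : Reduced θ M :=
  Quotient.mk (leafSetoid θ M) ⟨p, hp⟩

/-- A map between reduced spaces is smooth and symplectic for the reduced forms: near each point
it is covered by a smooth map `f` of the unreduced spaces with `f^* (dθ'|_{M'}) = dθ|_M`. -/
def IsSymplecticMap (θ : V → V → ℂ) (M : Set V) (θ' : W → W → ℂ) (M' : Set W)
    (F : Reduced θ M → Reduced θ' M') : Prop :=
  ∀ p ∈ M, ∃ U : Set V, IsOpen U ∧ p ∈ U ∧ ∃ f : V → W, ContDiffOn ℝ ∞ f U ∧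
    (∀ q ∈ U, ∀ hq : q ∈ M, ∃ hf : f q ∈ M', F (cls θ M q hq) = cls θ' M' (f q) hf) ∧
    (∀ q ∈ U, q ∈ M → ∀ u ∈ tangentVecs M q, ∀ w ∈ tangentVecs M q,
      extD θ' (f q) (fderiv ℝ f q u) (fderiv ℝ f q w) = extD θ q u w)

/-- `F` takes the reduced Hamiltonian `H/∼` to the reduced Hamiltonian `H'/∼`. -/
def IntertwinesHamiltonians (θ : V → V → ℂ) (M : Set V) (H : V → ℂ)
    (θ' : W → W → ℂ) (M' : Set W) (H' : W → ℂ) (F : Reduced θ M → Reduced θ' M') : Prop :=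
  ∀ p (hp : p ∈ M) q (hq : q ∈ M'), F (cls θ M p hp) = cls θ' M' q hq → H' q = H p

/-- Morphisms `(M/∼, H/∼) → (M'/∼, H'/∼)` of reduced Hamiltonian systems. -/
def IsHamiltonianMap (θ : V → V → ℂ) (M : Set V) (H : V → ℂ)
    (θ' : W → W → ℂ) (M' : Set W) (H' : W → ℂ) (F : Reduced θ M → Reduced θ' M') : Prop :=
  IsSymplecticMap θ M θ' M' F ∧ IntertwinesHamiltonians θ M H θ' M' H' F

end Reduction

/-! ## Twistor spaces -/

/-- Complex `n × n` matrices. -/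
abbrev Mat (n : ℕ) := Matrix (Fin n) (Fin n) ℂ

/-- Complex `2n × 2n` matrices, in `n × n` blocks. -/
abbrev Mat2 (n : ℕ) := Matrix (Fin n ⊕ Fin n) (Fin n ⊕ Fin n) ℂ

/-- `ℂ^{2n} = ℂ^n ⊕ ℂ^n`. -/
abbrev Twistor (n : ℕ) := Fin n ⊕ Fin n → ℂ

variable {n : ℕ}

/-- First component (`η`, resp. `υ`) of a vector of `ℂ^n ⊕ ℂ^n`. -/
def fstC (v : Twistor n) : Fin n → ℂ := fun i => v (Sum.inl i)

/-- Second component (`ξ`, resp. `ζ`) of a vector of `ℂ^n ⊕ ℂ^n`. -/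
def sndC (v : Twistor n) : Fin n → ℂ := fun i => v (Sum.inr i)

/-- `a b^+` for column vectors `a`, `b`. -/
def outer (a b : Fin n → ℂ) : Mat n := vecMulVec a (star b)

/-- The diagonal twistor form `φ_d`. -/
def phiD (n : ℕ) : Mat2 n := fromBlocks 1 0 0 (-1)

/-- `γ_{+-} = i (η^+ dη - ξ^+ dξ)`. -/
def gammaPM (v dv : Twistor n) : ℂ :=
  Complex.I * (star (fstC v) ⬝ᵥ fstC dv - star (sndC v) ⬝ᵥ sndC dv)

/-- The nonzero null twistors in the diagonal realization, `η^+ η - ξ^+ ξ = 0`. -/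
def T0 (n : ℕ) : Set (Twistor n) :=
  {v | v ≠ 0 ∧ star (fstC v) ⬝ᵥ fstC v - star (sndC v) ⬝ᵥ sndC v = 0}

/-- The momentum map `J_{+-}`. -/
def JPM (v : Twistor n) : Mat2 n :=
  Complex.I • fromBlocks (-outer (fstC v) (fstC v)) (outer (fstC v) (sndC v))
    (-outer (sndC v) (fstC v)) (outer (sndC v) (sndC v))

/-- The Hamiltonian `η^+ η + ξ^+ ξ`; the same formula `υ^+ υ + ζ^+ ζ` in the anti-diagonal
realization. -/
def IPP (v : Twistor n) : ℂ := star (fstC v) ⬝ᵥ fstC v + star (sndC v) ⬝ᵥ sndC v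

/-- `γ̃_{+-} = υ^+ dζ - ζ^+ dυ`. -/
def gammaPMt (w dw : Twistor n) : ℂ :=
  star (fstC w) ⬝ᵥ sndC dw - star (sndC w) ⬝ᵥ fstC dw

/-- The nonzero null twistors in the anti-diagonal realization, `i (ζ^+ υ - υ^+ ζ) = 0`. -/
def T0t (n : ℕ) : Set (Twistor n) :=
  {w | w ≠ 0 ∧ Complex.I * (star (sndC w) ⬝ᵥ fstC w - star (fstC w) ⬝ᵥ sndC w) = 0}

/-- The momentum map `J̃_{+-}`. -/
def JPMt (w : Twistor n) : Mat2 n :=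
  fromBlocks (outer (fstC w) (sndC w)) (-outer (fstC w) (fstC w))
    (outer (sndC w) (sndC w)) (-outer (sndC w) (fstC w))

/-- The unitary change of twistor realizations `𝒞`. -/
def cMat (n : ℕ) : Mat2 n :=
  ((Real.sqrt 2 : ℝ) : ℂ)⁻¹ • fromBlocks 1 (-Complex.I • 1) (-Complex.I • 1) 1

/-! ## `T^*U(n) ≅ U(n) × iH(n)` and nilpotent orbits -/

/-- The group `U(n,n)` of the form `φ_d`. -/
def Unn (n : ℕ) : Set (Mat2 n) := {g | gᴴ * phiD n * g = phiD n}

/-- The action `Λ_g` of `U(n,n)` on `U(n) × iH(n)`. -/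
def Lam (g : Mat2 n) (p : Mat n × Mat n) : Mat n × Mat n :=
  ((g.toBlocks₁₁ * p.1 + g.toBlocks₁₂) * (g.toBlocks₂₁ * p.1 + g.toBlocks₂₂)⁻¹,
    (g.toBlocks₂₁ * p.1 + g.toBlocks₂₂) * p.2 * (g.toBlocks₂₁ * p.1 + g.toBlocks₂₂)ᴴ)

/-- `ρ_{1,0} = i diag(1, 0, …, 0)`. -/
def rho10 (n : ℕ) : Mat n := Matrix.diagonal fun j => if (j : ℕ) = 0 then Complex.I else 0

/-- The orbit `𝒪_{10}` of `(E, ρ_{1,0})` in `T^*U(n) ≅ U(n) × iH(n)`. -/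
def O10 (n : ℕ) : Set (Mat n × Mat n) := {p | ∃ g ∈ Unn n, p = Lam g (1, rho10 n)}

/-- The canonical one-form `Tr (ρ Z^+ dZ)` of `T^*U(n) ≅ U(n) × iH(n)`. -/
def gamma0 (p dp : Mat n × Mat n) : ℂ := (p.2 * p.1ᴴ * dp.1).trace

/-- The momentum map `J_0`. -/
def J0 (p : Mat n × Mat n) : Mat2 n :=
  fromBlocks (-(p.1 * p.2 * p.1ᴴ)) (p.1 * p.2) (p.1 * p.2)ᴴ p.2

/-- The nilpotent adjoint orbit `𝒩_{10}`. -/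
def N10 (n : ℕ) : Set (Mat2 n) := {A | ∃ g ∈ Unn n, A = g * J0 (1, rho10 n) * g⁻¹}

/-- The nilpotent orbit `𝒩̃_{10}` in the anti-diagonal realization, corresponding to `𝒩_{10}`
under `Ad_𝒞`. -/
def N10t (n : ℕ) : Set (Mat2 n) := {A | cMat n * A * (cMat n)ᴴ ∈ N10 n}

/-! ## The phase space `H(n) × H(n)` -/

/-- The pairs `(Y, X)` of hermitian matrices with `X ≥ 0` of rank one. -/
def O10t (n : ℕ) : Set (Mat n × Mat n) :=
  {p | p.1.IsHermitian ∧ p.2.PosSemidef ∧ p.2.rank = 1}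

/-- `γ̃_0 = -Tr (X dY)` in the coordinates `(Y, X)`. -/
def gamma0t (p dp : Mat n × Mat n) : ℂ := -(p.2 * dp.1).trace

/-- The momentum map `J̃_0`. -/
def J0t (p : Mat n × Mat n) : Mat2 n :=
  fromBlocks (p.1 * p.2) (-(p.1 * p.2 * p.1)) p.2 (-(p.2 * p.1))

/-- The Hamiltonian `Ĩ_0 = Tr (X (E + Y²))`. -/
def I0t (p : Mat n × Mat n) : ℂ := (p.2 * (1 + p.1 * p.1)).trace

/-- The cotangent lift `T^*_𝒞` of the Cayley transform. -/
def TC (p : Mat n × Mat n) : Mat n × Mat n :=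
  ((p.1 - Complex.I • 1) * (-Complex.I • p.1 + 1)⁻¹,
    (Complex.I / 2) • ((-Complex.I • p.1 + 1) * p.2 * (-Complex.I • p.1 + 1)ᴴ))

/-! ## Reduced maps and regularizations -/

/-- `𝒪̃_{10}/∼`. -/
abbrev RedO10t (n : ℕ) := Reduced (gamma0t (n := n)) (O10t n)

/-- `𝒪_{10}/∼`. -/
abbrev RedO10 (n : ℕ) := Reduced (gamma0 (n := n)) (O10 n)

/-- `𝒯̃^0_{+-}/∼`. -/
abbrev RedT0t (n : ℕ) := Reduced (gammaPMt (n := n)) (T0t n)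

/-- `𝒯^0_{+-}/∼`. -/
abbrev RedT0 (n : ℕ) := Reduced (gammaPM (n := n)) (T0 n)

/-- The maps of reduced spaces induced by the momentum maps, by the Cayley transform and by `𝒞`.
Each field is uniquely determined by the equation which says that it is the induced map; that
such a family exists means that every one of these maps passes to the quotients by degeneracy
leaves, and that those typed as equivalences are bijective onto the indicated target. -/
structure ReducedMaps (n : ℕ) where
  /-- `J̃_0/∼` -/
  j0t : RedO10t n → N10t n
  /-- `J̃_{+-}/∼` -/
  jPMt : RedT0t n ≃ N10t n
  /-- `J_0/∼` -/
  j0 : RedO10 n ≃ N10 n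
  /-- `J_{+-}/∼` -/
  jPM : RedT0 n ≃ N10 n
  /-- `T^*_𝒞/∼` -/
  tC : RedO10t n → RedO10 n
  /-- `𝒞/∼` -/
  c : RedT0t n ≃ RedT0 n
  j0t_cls : ∀ p (hp : p ∈ O10t n), (j0t (cls _ _ p hp) : Mat2 n) = J0t p
  jPMt_cls : ∀ w (hw : w ∈ T0t n), (jPMt (cls _ _ w hw) : Mat2 n) = JPMt w
  j0_cls : ∀ p (hp : p ∈ O10 n), (j0 (cls _ _ p hp) : Mat2 n) = J0 p
  jPM_cls : ∀ v (hv : v ∈ T0 n), (jPM (cls _ _ v hv) : Mat2 n) = JPM v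
  tC_cls : ∀ p (hp : p ∈ O10t n), ∃ h : TC p ∈ O10 n, tC (cls _ _ p hp) = cls _ _ (TC p) h
  c_cls : ∀ w (hw : w ∈ T0t n),
    ∃ h : cMat n *ᵥ w ∈ T0 n, c (cls _ _ w hw) = cls _ _ (cMat n *ᵥ w) h

/-- The generalized Kustaanheimo–Stiefel regularization `(J̃_{+-}/∼)^{-1} ∘ (J̃_0/∼)`. -/
def ReducedMaps.kReg (D : ReducedMaps n) : RedO10t n → RedT0t n := D.jPMt.symm ∘ D.j0t

/-- The Cayley regularization `(J_{+-}/∼)^{-1} ∘ (J_0/∼) ∘ (T^*_𝒞/∼)`. -/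
def ReducedMaps.cReg (D : ReducedMaps n) : RedO10t n → RedT0 n := D.jPM.symm ∘ D.j0 ∘ D.tC

/-- The subset of `𝒯̃^0_{+-}/∼` of the classes of `(υ, ζ)` with `ζ ≠ 0`. -/
def dotRedT0t (n : ℕ) : Set (RedT0t n) :=
  {q | ∃ (w : Twistor n) (hw : w ∈ T0t n), sndC w ≠ 0 ∧ q = cls _ _ w hw}

/-- The generalized Kustaanheimo–Stiefel transformation `𝒮(υ, ζ) = (Y(υ, ζ), ζ ζ^+)`,
`Y(υ, ζ) = (ζ^+ ζ)^{-1} (ζ υ^+ + υ ζ^+ - (1/2) (υ^+ ζ + ζ^+ υ) E)`. -/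
def ksSection (w : Twistor n) : Mat n × Mat n :=
  ((star (sndC w) ⬝ᵥ sndC w)⁻¹ • (outer (sndC w) (fstC w) + outer (fstC w) (sndC w)
      - ((1 / 2 : ℂ) * (star (fstC w) ⬝ᵥ sndC w + star (sndC w) ⬝ᵥ fstC w)) • (1 : Mat n)),
    outer (sndC w) (sndC w))

/-! ## The classical Kustaanheimo–Stiefel transformation (`n = 2`) -/

/-- `ℝ³`. -/
abbrev E3 := EuclideanSpace ℝ (Fin 3)

/-- The Pauli matrices `σ₁, σ₂, σ₃`. -/
def pauli : Fin 3 → Mat 2 :=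
  ![!![0, 1; 1, 0], !![0, Complex.I; -Complex.I, 0], !![1, 0; 0, -1]]

/-- `y · σ`. -/
def pauliVec (y : E3) : Mat 2 := ∑ k, (y k : ℂ) • pauli k

/-- `(y, x) ↦ (Y, X) = (y · σ, (1/2) (‖x‖ E + x · σ))`. -/
def pauliPair (yx : E3 × E3) : Mat 2 × Mat 2 :=
  (pauliVec yx.1, (1 / 2 : ℂ) • ((‖yx.2‖ : ℂ) • (1 : Mat 2) + pauliVec yx.2))

/-- The Kustaanheimo–Stiefel transformation `(υ, ζ) ↦ (y, x)`,
`y = (ζ^+ ζ)^{-1} (1/2) (υ^+ σ ζ + ζ^+ σ υ)`, `x = ζ^+ σ ζ`.  The real parts are taken of numbers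
that are real. -/
def ksMap (w : Twistor 2) : E3 × E3 :=
  (WithLp.toLp 2 fun k => ((star (sndC w) ⬝ᵥ sndC w)⁻¹ * (1 / 2 : ℂ) *
      (star (fstC w) ⬝ᵥ (pauli k *ᵥ sndC w) + star (sndC w) ⬝ᵥ (pauli k *ᵥ fstC w))).re,
    WithLp.toLp 2 fun k => (star (sndC w) ⬝ᵥ (pauli k *ᵥ sndC w)).re)

/-- The canonical one-form `∑ y_k dx_k` on `ℝ³ × ℝ³`, so that its exterior derivative is
`∑ dy_k ∧ dx_k`. -/
def gammaCan (p dp : E3 × E3) : ℂ := ((∑ k, p.1 k * dp.2 k : ℝ) : ℂ)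

/-- The Kepler Hamiltonian `‖x‖ (1 + y²)` (in fictitious time). -/
def keplerH (yx : E3 × E3) : ℝ := ‖yx.2‖ * (1 + ‖yx.1‖ ^ 2)

end KSCayley

end

namespace KSCayley

open Filter Topology

/-! ## Tangent vectors, leaves and reduced maps -/

section Reduction

variable {V W X : Type*} [NormedAddCommGroup V] [NormedSpace ℝ V]
  [NormedAddCommGroup W] [NormedSpace ℝ W] [NormedAddCommGroup X] [NormedSpace ℝ X]

/-! Each reduced space is recognised through a matrix-valued momentum map that is constant on leaves
and separates them. Once this is known, an equality between reduced points is an equality of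
matrices, and the assertions about the reduced maps become algebra.

On twistors the momentum map is `v v^+` times an invertible constant matrix (`JPM_eq`, `JPMt_eq`),
so its fibres are phase circles. They are also the leaves: `dγ` is a multiple of the imaginary part
of a nondegenerate hermitian form, and its kernel along the null cone is spanned over ℝ by `i v`
(`exists_eq_smul_of_mem_degenerateVecs`, `cls_eq_iff_JPM`). The antidiagonal realization follows by
transport along the unitary `𝒞` (`cls_eq_iff_JPMt`). On pairs `(Y, ζ ζ^+)` the momentum map
remembers `ζ ζ^+` and `Y ζ` up to the common phase, and two points of a fibre are joined by a
segment (`cls_eq_iff_J0t`). On `U(n) × iH(n)` it remembers `ρ = i z z^+` and `Z z`; two unitaries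
agreeing on `z` are joined by a Cayley curve after a change of phase on the complement of `z`
(`cls_eq_iff_J0`).

The spaces are linked by `J̃_0(Y, ζ ζ^+) = J̃_{+-}(Yζ, ζ)` and `J_0(Z, i z z^+) = J_{+-}(Zz, z)`
(`J0t_eq_JPMt`, `J0_eq_JPM`). Under these substitutions the Cayley lift is multiplication by `𝒞`
(`TC_eq`), so both `J_0 ∘ T^*_𝒞` and `J_{+-} ∘ 𝒞` are conjugates by `𝒞` of their tilde versions.
This gives the factorization of the Cayley regularization, and its properties are inherited from
those of the Kustaanheimo–Stiefel one and of `𝒞/∼`.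

For symplecticity one fixes the phase of `ζ` smoothly (`kLift`) and differentiates the relations `υ
= Yζ`, `X = ζ ζ^+` (`gammaPMt_sub_eq_trace`). The Hamiltonians agree because both are traces of
blocks of the momentum matrix. For `n = 2`, `𝒮` is the Kustaanheimo–Stiefel map written in the Pauli
basis (`ksSection_eq_pauliPair`), and the same differentiated relations show that it is symplectic.
-/

/-- Only the germ of the curve at 0 matters. In this form, constraints valid near 0 can be
differentiated by uniqueness of derivatives, and locally defined maps can be composed with the
curve. -/
theorem mem_tangentVecs_iff {M : Set V} {p u : V} :
    u ∈ tangentVecs M p ↔ ∃ c : ℝ → V, c 0 = p ∧ HasDerivAt c u 0 ∧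
      (∀ᶠ t in 𝓝 (0 : ℝ), c t ∈ M) ∧ ∀ᶠ t in 𝓝 (0 : ℝ), ContDiffAt ℝ ∞ c t := by
  constructor
  · rintro ⟨ε, hε, c, hc, hM, h0, hd⟩
    have hmem : Ioo (-ε) ε ∈ 𝓝 (0 : ℝ) := Ioo_mem_nhds (by linarith) hε
    have hcd : ∀ᶠ t in 𝓝 (0 : ℝ), ContDiffAt ℝ ∞ c t := by
      filter_upwards [hmem] with t ht
      exact hc.contDiffAt (Ioo_mem_nhds ht.1 ht.2)
    refine ⟨c, h0, ?_, ?_, hcd⟩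
    · rw [← hd]
      exact (hcd.self_of_nhds.differentiableAt (by simp)).hasDerivAt
    · filter_upwards [hmem] with t ht using hM t ht
  · rintro ⟨c, h0, hd, hM, hcd⟩
    obtain ⟨ε, hε, h⟩ := Metric.eventually_nhds_iff.1 (hM.and hcd)
    have h' : ∀ t ∈ Ioo (-ε) ε, dist t 0 < ε := fun t ht => by
      simpa [Real.dist_eq, abs_lt] using ht
    exact ⟨ε, hε, c, fun t ht => (h (h' t ht)).2.contDiffWithinAt,
      fun t ht => (h (h' t ht)).1, h0, hd.deriv⟩

theorem mem_tangentVecs_of_contDiff {M : Set V} {c : ℝ → V} (hc : ContDiff ℝ ∞ c)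
    (hM : ∀ᶠ t in 𝓝 (0 : ℝ), c t ∈ M) {u : V} (hu : HasDerivAt c u 0) :
    u ∈ tangentVecs M (c 0) :=
  mem_tangentVecs_iff.2 ⟨c, rfl, hu, hM, .of_forall fun _ => hc.contDiffAt⟩

theorem deriv_mem_tangentVecs {M : Set V} {c : ℝ → V} (hc : ContDiff ℝ ∞ c)
    (hM : ∀ t, c t ∈ M) (t : ℝ) : deriv c t ∈ tangentVecs M (c t) := by
  have h1 : HasDerivAt (fun s => c (t + s)) (deriv c t) 0 := by
    have : HasDerivAt c (deriv c t) (t + 0) := by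
      simpa using (hc.differentiable (by simp) t).hasDerivAt
    exact this.comp_const_add t 0
  have h2 := mem_tangentVecs_of_contDiff (M := M) (c := fun s => c (t + s))
    (hc.comp (contDiff_const.add contDiff_id)) (.of_forall fun s => hM _) h1
  simpa using h2

/-- A smooth map carries tangent vectors of `M` to tangent vectors of `M'`. -/
theorem fderiv_mem_tangentVecs {M : Set V} {M' : Set W} {U : Set V} (hU : IsOpen U)
    {f : V → W} (hf : ContDiffOn ℝ ∞ f U) (hM : ∀ q ∈ U, q ∈ M → f q ∈ M') {p u : V}
    (hp : p ∈ U) (hu : u ∈ tangentVecs M p) : fderiv ℝ f p u ∈ tangentVecs M' (f p) := by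
  obtain ⟨c, rfl, hd, hcM, hcd⟩ := mem_tangentVecs_iff.1 hu
  have hcU : ∀ᶠ t in 𝓝 (0 : ℝ), c t ∈ U := hd.continuousAt (hU.mem_nhds hp)
  refine mem_tangentVecs_iff.2 ⟨f ∘ c, rfl, ?_, ?_, ?_⟩
  · exact ((hf.contDiffAt (hU.mem_nhds hp)).differentiableAt
      (by simp)).hasFDerivAt.comp_hasDerivAt 0 hd
  · filter_upwards [hcM, hcU] with t h1 h2 using hM _ h2 h1
  · filter_upwards [hcd, hcU] with t h1 h2
    exact (hf.contDiffAt (hU.mem_nhds h2)).comp t h1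

theorem cls_induction {θ : V → V → ℂ} {M : Set V} {P : Reduced θ M → Prop}
    (h : ∀ p hp, P (cls θ M p hp)) (q : Reduced θ M) : P q :=
  Quotient.inductionOn q fun p => h p.1 p.2

theorem exists_cls {θ : V → V → ℂ} {M : Set V} (x : Reduced θ M) :
    ∃ p, ∃ hp : p ∈ M, x = cls θ M p hp :=
  Quotient.inductionOn x fun p => ⟨p.1, p.2, rfl⟩

theorem cls_eq_of_leafStep {θ : V → V → ℂ} {M : Set V} {p q : V} (hp : p ∈ M) (hq : q ∈ M)
    (h : LeafStep θ M ⟨p, hp⟩ ⟨q, hq⟩) : cls θ M p hp = cls θ M q hq :=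
  Quotient.sound (Relation.EqvGen.rel _ _ h)

/-- A map whose derivative kills the degeneracy directions is constant on leaves. -/
theorem apply_eq_of_leafRel {θ : V → V → ℂ} {M : Set V} {J : V → W}
    (hJ : ∀ (c : ℝ → V) (u : V) (t : ℝ), HasDerivAt c u t → (∀ t, c t ∈ M) →
      u ∈ degenerateVecs θ M (c t) → HasDerivAt (fun s => J (c s)) 0 t)
    {p q : M} (h : leafSetoid θ M p q) : J p = J q := by
  induction h with
  | rel p q h =>
    obtain ⟨c, hc, h0, h1, h⟩ := h
    have hd : ∀ t, HasDerivAt (fun s => J (c s)) 0 t := fun t =>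
      hJ c _ t (hc.differentiable (by simp) t).hasDerivAt (fun t => (h t).1) (h t).2
    have := is_const_of_deriv_eq_zero (fun t => (hd t).differentiableAt)
      (fun t => (hd t).deriv) 0 1
    simpa [h0, h1] using this
  | refl => rfl
  | symm _ _ _ ih => exact ih.symm
  | trans _ _ _ _ _ ih1 ih2 => exact ih1.trans ih2

theorem apply_eq_of_cls_eq {θ : V → V → ℂ} {M : Set V} {J : V → W}
    (hJ : ∀ (c : ℝ → V) (u : V) (t : ℝ), HasDerivAt c u t → (∀ t, c t ∈ M) →
      u ∈ degenerateVecs θ M (c t) → HasDerivAt (fun s => J (c s)) 0 t)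
    {p q : V} {hp : p ∈ M} {hq : q ∈ M} (h : cls θ M p hp = cls θ M q hq) : J p = J q :=
  apply_eq_of_leafRel hJ (Quotient.exact h)

theorem extD_eq_of_hasDerivAt {θ : V → V → ℂ} {p u w : V} {a b : ℂ}
    (ha : HasDerivAt (fun t : ℝ => θ (p + t • u) w) a 0)
    (hb : HasDerivAt (fun t : ℝ => θ (p + t • w) u) b 0) : extD θ p u w = a - b := by
  rw [extD, lineDeriv, lineDeriv, ha.deriv, hb.deriv]

/-- When the coefficients of `θ` are affine in the base point, the directional derivatives do not
depend on `p`. -/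
theorem extD_of_bilinear {θ : V → V → ℂ}
    (h : ∀ p u w (t : ℝ), θ (p + t • u) w = θ p w + t * θ u w) (p u w : V) :
    extD θ p u w = θ u w - θ w u := by
  have key : ∀ u w, HasDerivAt (fun t : ℝ => θ (p + t • u) w) (θ u w) 0 := fun u w => by
    simp only [h]
    simpa using ((Complex.ofRealCLM.hasDerivAt (x := (0 : ℝ))).mul_const (θ u w)).const_add
      (θ p w)
  exact extD_eq_of_hasDerivAt (key u w) (key w u)

/-! ### Composition of morphisms of reduced systems -/

theorem IsSymplecticMap.comp {θ : V → V → ℂ} {M : Set V} {θ' : W → W → ℂ} {M' : Set W}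
    {θ'' : X → X → ℂ} {M'' : Set X} {F : Reduced θ M → Reduced θ' M'}
    {G : Reduced θ' M' → Reduced θ'' M''} (hG : IsSymplecticMap θ' M' θ'' M'' G)
    (hF : IsSymplecticMap θ M θ' M' F) : IsSymplecticMap θ M θ'' M'' (G ∘ F) := by
  intro p hp
  obtain ⟨U, hU, hpU, f, hf, hfF, hfs⟩ := hF p hp
  obtain ⟨hfp, -⟩ := hfF p hpU hp
  obtain ⟨U', hU', hpU', g, hg, hgG, hgs⟩ := hG (f p) hfp
  refine ⟨U ∩ f ⁻¹' U', hf.continuousOn.isOpen_inter_preimage hU hU', ⟨hpU, hpU'⟩, g ∘ f,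
    hg.comp (hf.mono inter_subset_left) inter_subset_right, ?_, ?_⟩
  · rintro q ⟨hqU, hqU'⟩ hq
    obtain ⟨h1, h2⟩ := hfF q hqU hq
    obtain ⟨h3, h4⟩ := hgG (f q) hqU' h1
    exact ⟨h3, by rw [Function.comp_apply, h2, h4]; rfl⟩
  · rintro q ⟨hqU, hqU'⟩ hq u hu w hw
    have hmaps : ∀ q ∈ U, q ∈ M → f q ∈ M' := fun q h h' => (hfF q h h').1
    have hfd := ((hf.contDiffAt (hU.mem_nhds hqU)).differentiableAt (by simp))
    have hgd := ((hg.contDiffAt (hU'.mem_nhds hqU')).differentiableAt (by simp))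
    rw [fderiv_comp q hgd hfd]
    simp only [ContinuousLinearMap.comp_apply, Function.comp_apply]
    -- The identity for `g` is available only on tangent vectors of `M'`, so the derivative of `f`
    -- must be known to carry tangent vectors to tangent vectors.
    rw [hgs _ hqU' (hmaps q hqU hq) _ (fderiv_mem_tangentVecs hU hf hmaps hqU hu) _
      (fderiv_mem_tangentVecs hU hf hmaps hqU hw), hfs q hqU hq u hu w hw]

theorem IntertwinesHamiltonians.comp {θ : V → V → ℂ} {M : Set V} {H : V → ℂ} {θ' : W → W → ℂ}
    {M' : Set W} {H' : W → ℂ} {θ'' : X → X → ℂ} {M'' : Set X} {H'' : X → ℂ}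
    {F : Reduced θ M → Reduced θ' M'} {G : Reduced θ' M' → Reduced θ'' M''}
    (hG : IntertwinesHamiltonians θ' M' H' θ'' M'' H'' G)
    (hF : IntertwinesHamiltonians θ M H θ' M' H' F) :
    IntertwinesHamiltonians θ M H θ'' M'' H'' (G ∘ F) := by
  intro p hp q hq h
  obtain ⟨r, hr, hFr⟩ := exists_cls (F (cls θ M p hp))
  rw [Function.comp_apply, hFr] at h
  rw [hG r hr q hq h, hF p hp r hr hFr]

theorem IsHamiltonianMap.comp {θ : V → V → ℂ} {M : Set V} {H : V → ℂ} {θ' : W → W → ℂ}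
    {M' : Set W} {H' : W → ℂ} {θ'' : X → X → ℂ} {M'' : Set X} {H'' : X → ℂ}
    {F : Reduced θ M → Reduced θ' M'} {G : Reduced θ' M' → Reduced θ'' M''}
    (hG : IsHamiltonianMap θ' M' H' θ'' M'' H'' G) (hF : IsHamiltonianMap θ M H θ' M' H' F) :
    IsHamiltonianMap θ M H θ'' M'' H'' (G ∘ F) :=
  ⟨hG.1.comp hF.1, hG.2.comp hF.2⟩

end Reduction

/-! ## Calculus for curves of vectors and matrices -/

section Calculus

/-- The norm in force is the entrywise sup norm, under which matrices form a finite product of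
copies of ℂ. Product rules and smoothness are therefore checked entry by entry. -/
theorem hasDerivAt_matrix {m k : Type*} [Fintype m] [Fintype k] {c : ℝ → Matrix m k ℂ}
    {c' : Matrix m k ℂ} {t : ℝ} :
    HasDerivAt c c' t ↔ ∀ i j, HasDerivAt (fun s => c s i j) (c' i j) t := by
  have h1 : HasDerivAt c c' t ↔ ∀ i, HasDerivAt (fun s => c s i) (c' i) t :=
    hasDerivAt_pi (φ := fun s => (c s : m → k → ℂ))
  rw [h1]
  exact forall_congr' fun i => hasDerivAt_pi

variable {l m k : Type*} [Fintype l] [Fintype m] [Fintype k]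

theorem contDiffAt_matrix {V : Type*} [NormedAddCommGroup V] [NormedSpace ℝ V]
    {c : V → Matrix m k ℂ} {t : V} :
    ContDiffAt ℝ ∞ c t ↔ ∀ i j, ContDiffAt ℝ ∞ (fun s => c s i j) t := by
  have h1 : ContDiffAt ℝ ∞ c t ↔ ∀ i, ContDiffAt ℝ ∞ (fun s => c s i) t :=
    contDiffAt_pi (Φ := fun s => (c s : m → k → ℂ))
  rw [h1]
  exact forall_congr' fun i => contDiffAt_pi

theorem contDiff_matrix {V : Type*} [NormedAddCommGroup V] [NormedSpace ℝ V]
    {c : V → Matrix m k ℂ} :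
    ContDiff ℝ ∞ c ↔ ∀ i j, ContDiff ℝ ∞ (fun s => c s i j) := by
  simp only [contDiff_iff_contDiffAt, contDiffAt_matrix]
  exact ⟨fun h i j t => h t i j, fun h t i j => h i j t⟩

theorem contDiff_star : ContDiff ℝ ∞ (fun z : ℂ => star z) :=
  Complex.conjCLE.contDiff

theorem contDiff_ofReal : ContDiff ℝ ∞ (fun t : ℝ => (t : ℂ)) :=
  Complex.ofRealCLM.contDiff

theorem contDiff_re : ContDiff ℝ ∞ (fun z : ℂ => z.re) :=
  Complex.reCLM.contDiff

theorem hasDerivAt_fst {V W : Type*} [NormedAddCommGroup V] [NormedSpace ℝ V]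
    [NormedAddCommGroup W] [NormedSpace ℝ W] {c : ℝ → V × W} {u : V × W} {t : ℝ}
    (h : HasDerivAt c u t) : HasDerivAt (fun s => (c s).1) u.1 t :=
  (hasFDerivAt_fst (𝕜 := ℝ) (p := c t)).comp_hasDerivAt t h

theorem hasDerivAt_snd {V W : Type*} [NormedAddCommGroup V] [NormedSpace ℝ V]
    [NormedAddCommGroup W] [NormedSpace ℝ W] {c : ℝ → V × W} {u : V × W} {t : ℝ}
    (h : HasDerivAt c u t) : HasDerivAt (fun s => (c s).2) u.2 t :=
  (hasFDerivAt_snd (𝕜 := ℝ) (p := c t)).comp_hasDerivAt t h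

variable {A : ℝ → Matrix l m ℂ} {A' : Matrix l m ℂ} {B : ℝ → Matrix m k ℂ} {B' : Matrix m k ℂ}
  {x y : ℝ → m → ℂ} {x' y' : m → ℂ} {t : ℝ}

theorem hasDerivAt_mul (hA : HasDerivAt A A' t) (hB : HasDerivAt B B' t) :
    HasDerivAt (fun s => A s * B s) (A' * B t + A t * B') t := by
  rw [hasDerivAt_matrix] at *
  intro i j
  simp only [Matrix.mul_apply, Matrix.add_apply, ← Finset.sum_add_distrib]
  exact HasDerivAt.fun_sum fun q _ => (hA i q).mul (hB q j)

theorem hasDerivAt_mulVec (hA : HasDerivAt A A' t) (hx : HasDerivAt x x' t) :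
    HasDerivAt (fun s => A s *ᵥ x s) (A' *ᵥ x t + A t *ᵥ x') t := by
  rw [hasDerivAt_matrix] at hA
  rw [hasDerivAt_pi] at *
  intro i
  simp only [Matrix.mulVec, dotProduct, Pi.add_apply, ← Finset.sum_add_distrib]
  exact HasDerivAt.fun_sum fun q _ => (hA i q).mul (hx q)

theorem hasDerivAt_conjTranspose (hA : HasDerivAt A A' t) :
    HasDerivAt (fun s => (A s)ᴴ) A'ᴴ t := by
  rw [hasDerivAt_matrix] at *
  exact fun i j => (hA j i).star

theorem hasDerivAt_dotProduct (hx : HasDerivAt x x' t) (hy : HasDerivAt y y' t) :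
    HasDerivAt (fun s => x s ⬝ᵥ y s) (x' ⬝ᵥ y t + x t ⬝ᵥ y') t := by
  rw [hasDerivAt_pi] at hx hy
  simp only [dotProduct, ← Finset.sum_add_distrib]
  exact HasDerivAt.fun_sum fun q _ => (hx q).mul (hy q)

theorem hasDerivAt_star (hx : HasDerivAt x x' t) :
    HasDerivAt (fun s => star (x s)) (star x') t := hx.star

theorem hasDerivAt_vecMulVec (hx : HasDerivAt x x' t) (hy : HasDerivAt y y' t) :
    HasDerivAt (fun s => vecMulVec (x s) (y s)) (vecMulVec x' (y t) + vecMulVec (x t) y') t := by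
  rw [hasDerivAt_matrix]
  rw [hasDerivAt_pi] at hx hy
  exact fun i j => (hx i).mul (hy j)

theorem hasDerivAt_trace {A : ℝ → Matrix m m ℂ} {A' : Matrix m m ℂ}
    (hA : HasDerivAt A A' t) : HasDerivAt (fun s => (A s).trace) A'.trace t := by
  rw [hasDerivAt_matrix] at hA
  exact HasDerivAt.fun_sum fun q _ => hA q q

theorem hasDerivAt_line {V : Type*} [NormedAddCommGroup V] [NormedSpace ℝ V] (p u : V) (t : ℝ) :
    HasDerivAt (fun s : ℝ => p + s • u) u t := by
  simpa using ((hasDerivAt_id t).smul_const u).const_add p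

theorem contDiff_line {V : Type*} [NormedAddCommGroup V] [NormedSpace ℝ V] (p u : V) :
    ContDiff ℝ ∞ (fun s : ℝ => p + s • u) :=
  contDiff_const.add (contDiff_id.smul contDiff_const)

theorem hasDerivAt_fromBlocks {a b c d : ℝ → Matrix m m ℂ} {a' b' c' d' : Matrix m m ℂ}
    (ha : HasDerivAt a a' t) (hb : HasDerivAt b b' t) (hc : HasDerivAt c c' t)
    (hd : HasDerivAt d d' t) :
    HasDerivAt (fun s => fromBlocks (a s) (b s) (c s) (d s)) (fromBlocks a' b' c' d') t := by
  rw [hasDerivAt_matrix] at *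
  rintro (i | i) (j | j)
  exacts [ha i j, hb i j, hc i j, hd i j]

theorem contDiffAt_det [DecidableEq m] {V : Type*} [NormedAddCommGroup V] [NormedSpace ℝ V]
    {A : V → Matrix m m ℂ} {p : V} (hA : ContDiffAt ℝ ∞ A p) :
    ContDiffAt ℝ ∞ (fun s => (A s).det) p := by
  rw [contDiffAt_matrix] at hA
  simp only [Matrix.det_apply]
  exact ContDiffAt.sum fun σ _ => (contDiffAt_prod fun i _ => hA _ _).const_smul _

/-- By Cramer's rule the entries of the inverse are cofactors divided by the determinant. -/
theorem contDiffAt_inv [DecidableEq m] {V : Type*} [NormedAddCommGroup V] [NormedSpace ℝ V]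
    {A : V → Matrix m m ℂ} {p : V} (hA : ContDiffAt ℝ ∞ A p) (h : (A p).det ≠ 0) :
    ContDiffAt ℝ ∞ (fun s => (A s)⁻¹) p := by
  rw [contDiffAt_matrix]
  intro i j
  simp only [Matrix.inv_def, Matrix.smul_apply, Matrix.adjugate_apply, Ring.inverse_eq_inv',
    smul_eq_mul]
  refine ((contDiffAt_det hA).inv h).mul (contDiffAt_det ?_)
  rw [contDiffAt_matrix] at hA ⊢
  intro a b
  simp only [Matrix.updateRow_apply]
  split_ifs
  · exact contDiffAt_const
  · exact hA a b

theorem contDiff_mul {V : Type*} [NormedAddCommGroup V] [NormedSpace ℝ V]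
    {A : V → Matrix l m ℂ} {B : V → Matrix m k ℂ} (hA : ContDiff ℝ ∞ A) (hB : ContDiff ℝ ∞ B) :
    ContDiff ℝ ∞ (fun s => A s * B s) := by
  rw [contDiff_matrix] at *
  intro i j
  simp only [Matrix.mul_apply]
  exact ContDiff.sum fun q _ => (hA i q).mul (hB q j)

theorem contDiff_vecMulVec {V : Type*} [NormedAddCommGroup V] [NormedSpace ℝ V]
    {x : V → l → ℂ} {y : V → m → ℂ} (hx : ContDiff ℝ ∞ x) (hy : ContDiff ℝ ∞ y) :
    ContDiff ℝ ∞ (fun s => vecMulVec (x s) (y s)) := by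
  rw [contDiff_pi] at hx hy
  exact contDiff_matrix.2 fun i j => (hx i).mul (hy j)

end Calculus

variable {n : ℕ}

/-! ## Vectors and matrices of rank one -/

theorem star_dot_comm (a b : Fin n → ℂ) : star (star a ⬝ᵥ b) = star b ⬝ᵥ a :=
  (Matrix.star_dotProduct b a).symm

theorem star_dot_mulVec (A : Mat n) (a b : Fin n → ℂ) :
    star a ⬝ᵥ (A *ᵥ b) = star (Aᴴ *ᵥ a) ⬝ᵥ b := by
  rw [Matrix.star_mulVec, Matrix.conjTranspose_conjTranspose, Matrix.dotProduct_mulVec]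

theorem star_dot_self_ne_zero {a : Fin n → ℂ} (h : a ≠ 0) : star a ⬝ᵥ a ≠ 0 :=
  fun h' => h (dotProduct_star_self_eq_zero.1 h')

theorem star_dot_self_pos {a : Fin n → ℂ} (h : a ≠ 0) : 0 < star a ⬝ᵥ a := by
  exact Matrix.dotProduct_star_self_pos_iff.2 h

theorem outer_conjTranspose (a b : Fin n → ℂ) : (outer a b)ᴴ = outer b a := by
  simp [outer, Matrix.conjTranspose_vecMulVec]

theorem mul_outer (A : Mat n) (a b : Fin n → ℂ) : A * outer a b = outer (A *ᵥ a) b :=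
  Matrix.mul_vecMulVec _ _ _

theorem outer_mul (A : Mat n) (a b : Fin n → ℂ) : outer a b * A = outer a (Aᴴ *ᵥ b) := by
  rw [outer, outer, Matrix.vecMulVec_mul, Matrix.star_mulVec, Matrix.conjTranspose_conjTranspose]

theorem outer_mulVec (a b c : Fin n → ℂ) : outer a b *ᵥ c = (star b ⬝ᵥ c) • a := by
  rw [outer, Matrix.vecMulVec_mulVec]
  ext i; simp [mul_comm]

theorem outer_smul_left (c : ℂ) (a b : Fin n → ℂ) : outer (c • a) b = c • outer a b :=
  Matrix.smul_vecMulVec _ _ _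

theorem outer_smul_right (c : ℂ) (a b : Fin n → ℂ) : outer a (c • b) = star c • outer a b := by
  rw [outer, star_smul, Matrix.vecMulVec_smul]; rfl

theorem outer_smul_smul (c : ℂ) (a b : Fin n → ℂ) :
    outer (c • a) (c • b) = (c * star c) • outer a b := by
  rw [outer_smul_left, outer_smul_right, smul_smul]

theorem trace_outer (a b : Fin n → ℂ) : (outer a b).trace = star b ⬝ᵥ a := by
  rw [outer, Matrix.trace_vecMulVec, dotProduct_comm]

theorem outer_eq_zero {a : Fin n → ℂ} : outer a a = 0 ↔ a = 0 := by
  simp [outer]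

/-- Applying both matrices to `b` gives `(a^+ b) a = (b^+ b) b`, so `a` is a multiple of `b`.
Comparing a diagonal entry where `b` does not vanish shows that the factor has modulus one. -/
theorem eq_smul_of_outer_eq {m : Type*} [Fintype m] {a b : m → ℂ}
    (h : vecMulVec a (star a) = vecMulVec b (star b)) :
    ∃ c : ℂ, c * star c = 1 ∧ a = c • b := by
  by_cases hb : b = 0
  · subst hb
    exact ⟨1, by simp, by simpa using h⟩
  · have hbb : star b ⬝ᵥ b ≠ 0 := fun h' =>
      hb (dotProduct_star_self_eq_zero.1 h')
    have h1 := congrArg (fun A => A *ᵥ b) h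
    simp only [Matrix.vecMulVec_mulVec] at h1
    have h2 : ∀ i, a i * (star a ⬝ᵥ b) = b i * (star b ⬝ᵥ b) := fun i => by
      simpa using congrFun h1 i
    have hab : star a ⬝ᵥ b ≠ 0 := by
      intro h0
      apply hb
      ext i
      simpa [h0, hbb] using (h2 i).symm
    have ha : a = ((star b ⬝ᵥ b) / (star a ⬝ᵥ b)) • b := by
      ext i
      rw [Pi.smul_apply, smul_eq_mul, div_mul_eq_mul_div, eq_div_iff hab, h2 i, mul_comm]
    refine ⟨_, ?_, ha⟩
    obtain ⟨i, hi⟩ := Function.ne_iff.1 hb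
    have hi : b i ≠ 0 := hi
    generalize (star b ⬝ᵥ b) / (star a ⬝ᵥ b) = c at ha
    have h3 := congrFun (congrFun h i) i
    rw [ha] at h3
    simp only [Matrix.vecMulVec_apply, Pi.smul_apply, smul_eq_mul, Pi.star_apply, star_mul'] at h3
    have h4 : b i * star (b i) ≠ 0 := mul_ne_zero hi (star_ne_zero.2 hi)
    exact mul_right_cancel₀ h4 (by linear_combination h3)

/-- If `v` spans the range, every column is a multiple of `v`, so `X = v c^T`. Hermiticity makes
`star c` proportional to `v`, positivity makes the factor nonnegative, and its square root is
absorbed into the vector. -/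
theorem posSemidef_rank_one_iff {X : Mat n} :
    X.PosSemidef ∧ X.rank = 1 ↔ ∃ z : Fin n → ℂ, z ≠ 0 ∧ X = outer z z := by
  constructor
  · rintro ⟨hX, hr⟩
    rw [Matrix.rank, finrank_eq_one_iff'] at hr
    obtain ⟨⟨v, hvr⟩, hv', hv⟩ := hr
    have hv0 : v ≠ 0 := fun h => hv' (Subtype.ext h)
    have hc : ∀ j, ∃ c : ℂ, c • v = X *ᵥ Pi.single j 1 := fun j => by
      obtain ⟨c, hc⟩ := hv ⟨X *ᵥ Pi.single j 1, ⟨_, rfl⟩⟩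
      exact ⟨c, congrArg Subtype.val hc⟩
    choose c hc using hc
    have hXc : X = vecMulVec v c := by
      ext i j
      have := congrFun (hc j) i
      rw [Matrix.mulVec_single_one] at this
      rw [Matrix.vecMulVec_apply, mul_comm]
      exact this.symm
    have hvv := star_dot_self_ne_zero hv0
    have h1 : star c = ((c ⬝ᵥ v) / (star v ⬝ᵥ v)) • v := by
      have hXv : X *ᵥ v = (c ⬝ᵥ v) • v := by
        rw [hXc, Matrix.vecMulVec_mulVec]; ext; simp [mul_comm]
      have h2 : Xᴴ *ᵥ v = (star v ⬝ᵥ v) • star c := by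
        rw [hXc, Matrix.conjTranspose_vecMulVec, Matrix.vecMulVec_mulVec]; ext; simp [mul_comm]
      rw [hX.1.eq, hXv] at h2
      rw [div_eq_inv_mul, mul_smul, h2, smul_smul, inv_mul_cancel₀ hvv, one_smul]
    set d := (c ⬝ᵥ v) / (star v ⬝ᵥ v) with hd
    have hX' : X = star d • outer v v := by
      rw [hXc, ← star_star c, h1, ← outer, outer_smul_right]
    have hpos : 0 ≤ star d := by
      have h3 := hX.dotProduct_mulVec_nonneg v
      rw [hX', Matrix.smul_mulVec, outer_mulVec, dotProduct_smul, dotProduct_smul, smul_eq_mul,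
        smul_eq_mul] at h3
      have h4 := star_dot_self_pos hv0
      rw [← mul_assoc, mul_assoc] at h3
      have h5 := mul_nonneg h3 (inv_nonneg.2 (mul_pos h4 h4).le)
      rwa [mul_assoc, mul_inv_cancel₀ (mul_pos h4 h4).ne', mul_one] at h5
    obtain ⟨r, hr, hrd⟩ : ∃ r : ℝ, 0 ≤ r ∧ star d = r :=
      ⟨(star d).re, (Complex.nonneg_iff.1 hpos).1,
        Complex.ext rfl (by simpa using (Complex.nonneg_iff.1 hpos).2.symm)⟩
    refine ⟨((Real.sqrt r : ℝ) : ℂ) • v, ?_, ?_⟩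
    · intro h0
      have hX0 : X = 0 := by
        rcases smul_eq_zero.1 h0 with h | h
        · have : r = 0 := by
            rwa [Complex.ofReal_eq_zero, Real.sqrt_eq_zero hr] at h
          rw [hX', hrd, this]; simp
        · exact absurd h hv0
      obtain ⟨y, hy⟩ := hvr
      exact hv0 (by simpa [hX0] using hy.symm)
    · rw [outer_smul_smul, hX', hrd]
      congr 1
      rw [Complex.star_def, Complex.conj_ofReal, ← Complex.ofReal_mul, Real.mul_self_sqrt hr]
  · rintro ⟨z, hz, rfl⟩
    refine ⟨Matrix.posSemidef_vecMulVec_self_star z,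
      le_antisymm (Matrix.rank_vecMulVec_le _ _) (Nat.one_le_iff_ne_zero.2 fun h => ?_)⟩
    rw [Matrix.rank, Submodule.finrank_eq_zero, LinearMap.range_eq_bot] at h
    have h1 : outer z z *ᵥ z = 0 := LinearMap.congr_fun h z
    rw [outer_mulVec] at h1
    exact (smul_eq_zero.1 h1).elim (star_dot_self_ne_zero hz) hz

theorem mem_O10t_iff {p : Mat n × Mat n} :
    p ∈ O10t n ↔ p.1.IsHermitian ∧ ∃ z : Fin n → ℂ, z ≠ 0 ∧ p.2 = outer z z := by
  rw [← posSemidef_rank_one_iff]; rfl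

/-! ## Unitary matrices with prescribed values -/

/-- A complex Householder reflection `1 - c⁻¹ u u^+` with `u = a - b` and `c = u^+ a`. It is unitary
exactly because `c + star c = u^+ u`, which is where equality of the norms enters. -/
theorem exists_unitary_mulVec_eq {a b : Fin n → ℂ} (h : star a ⬝ᵥ a = star b ⬝ᵥ b) :
    ∃ Z : Mat n, Zᴴ * Z = 1 ∧ Z *ᵥ a = b := by
  by_cases hab : a - b = 0
  · exact ⟨1, by simp, by simpa using sub_eq_zero.1 hab⟩
  set u := a - b with hu
  set c := star u ⬝ᵥ a with hc
  have huu : c + star c = star u ⬝ᵥ u := by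
    rw [hc, star_dot_comm, hu]
    simp only [star_sub, sub_dotProduct, dotProduct_sub]
    linear_combination h
  have hc0 : c ≠ 0 := by
    intro h0
    rw [h0] at huu
    exact star_dot_self_ne_zero hab (by rw [← huu]; simp)
  have hc0' : star c ≠ 0 := star_ne_zero.2 hc0
  refine ⟨1 - c⁻¹ • outer u u, ?_, ?_⟩
  · rw [Matrix.conjTranspose_sub, Matrix.conjTranspose_one, Matrix.conjTranspose_smul,
      outer_conjTranspose]
    have h1 : outer u u * outer u u = (c + star c) • outer u u := by
      rw [mul_outer, outer_mulVec, outer_smul_left, huu]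
    rw [sub_mul, one_mul, mul_sub, mul_one, smul_mul_smul_comm, h1, smul_smul, sub_sub,
      ← add_sub_assoc, ← add_smul, ← sub_smul, sub_eq_self]
    convert zero_smul ℂ (outer u u)
    rw [star_inv₀]
    field_simp
    ring
  · rw [Matrix.sub_mulVec, Matrix.one_mulVec, Matrix.smul_mulVec, outer_mulVec, ← hc, smul_smul,
      inv_mul_cancel₀ hc0, one_smul, hu, sub_sub_cancel]

/-! ## The twistor forms and the momentum maps -/

/-- The antidiagonal skew form `(υ^+, ζ^+) ↦ (ζ^+, -υ^+)`. -/
def psiA (n : ℕ) : Mat2 n := fromBlocks 0 (-1) 1 0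

/-- `v v^+` for `v ∈ ℂ^n ⊕ ℂ^n`. -/
def outer2 (v w : Twistor n) : Mat2 n := vecMulVec v (star w)

theorem sumElim_fstC_sndC (v : Twistor n) : Sum.elim (fstC v) (sndC v) = v := by
  ext (i | i) <;> rfl

@[simp] theorem fstC_sumElim (a b : Fin n → ℂ) : fstC (Sum.elim a b) = a := rfl

@[simp] theorem sndC_sumElim (a b : Fin n → ℂ) : sndC (Sum.elim a b) = b := rfl

theorem star_dot_sum (v w : Twistor n) :
    star v ⬝ᵥ w = star (fstC v) ⬝ᵥ fstC w + star (sndC v) ⬝ᵥ sndC w := by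
  simp [dotProduct, Fintype.sum_sum_type, fstC, sndC]

theorem fromBlocks_mulVec_eq (A B C D : Mat n) (v : Twistor n) :
    fromBlocks A B C D *ᵥ v =
      Sum.elim (A *ᵥ fstC v + B *ᵥ sndC v) (C *ᵥ fstC v + D *ᵥ sndC v) :=
  Matrix.fromBlocks_mulVec _ _ _ _ _

theorem phiD_mulVec (v : Twistor n) : phiD n *ᵥ v = Sum.elim (fstC v) (-sndC v) := by
  rw [phiD, fromBlocks_mulVec_eq]; simp [Matrix.neg_mulVec]

theorem psiA_mulVec (v : Twistor n) : psiA n *ᵥ v = Sum.elim (-sndC v) (fstC v) := by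
  rw [psiA, fromBlocks_mulVec_eq]; simp [Matrix.neg_mulVec]

theorem phiD_conjTranspose : (phiD n)ᴴ = phiD n := by
  simp [phiD, Matrix.fromBlocks_conjTranspose]

theorem phiD_mul_self : phiD n * phiD n = 1 := by
  simp [phiD, Matrix.fromBlocks_multiply]

theorem psiA_mul_self : psiA n * psiA n = -1 := by
  simp [psiA, Matrix.fromBlocks_multiply, ← Matrix.fromBlocks_one, Matrix.fromBlocks_neg]

theorem gammaPM_eq (v w : Twistor n) :
    gammaPM v w = Complex.I * (star v ⬝ᵥ (phiD n *ᵥ w)) := by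
  rw [phiD_mulVec, star_dot_sum]; simp [gammaPM, sub_eq_add_neg]

theorem gammaPMt_eq (v w : Twistor n) : gammaPMt v w = -(star v ⬝ᵥ (psiA n *ᵥ w)) := by
  rw [psiA_mulVec, star_dot_sum]; simp [gammaPMt, sub_eq_add_neg, add_comm]

theorem mem_T0_iff {v : Twistor n} : v ∈ T0 n ↔ v ≠ 0 ∧ star v ⬝ᵥ (phiD n *ᵥ v) = 0 := by
  rw [phiD_mulVec, star_dot_sum]; simp [T0, sub_eq_add_neg]

theorem mem_T0t_iff {w : Twistor n} : w ∈ T0t n ↔ w ≠ 0 ∧ star w ⬝ᵥ (psiA n *ᵥ w) = 0 := by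
  rw [psiA_mulVec, star_dot_sum]
  simp only [T0t, Set.mem_ofPred_eq, mul_eq_zero, Complex.I_ne_zero, false_or, fstC_sumElim,
    sndC_sumElim, dotProduct_neg]
  rw [neg_add_eq_sub]

/-- Since `φ` is invertible, `J_{+-}` carries the same information as `v v^+`, that is, `v` up to a
phase. -/
theorem JPM_eq (v : Twistor n) : JPM v = -Complex.I • (outer2 v v * phiD n) := by
  ext (i | i) (j | j) <;>
    simp [JPM, outer2, outer, phiD, Matrix.mul_apply, Fintype.sum_sum_type, Matrix.vecMulVec_apply,
      fstC, sndC, Matrix.one_apply]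

theorem JPMt_eq (w : Twistor n) : JPMt w = outer2 w w * psiA n := by
  ext (i | i) (j | j) <;>
    simp [JPMt, outer2, outer, psiA, Matrix.mul_apply, Fintype.sum_sum_type,
      Matrix.vecMulVec_apply, fstC, sndC, Matrix.one_apply]

theorem mul_outer2_mul (A : Mat2 n) (v w : Twistor n) :
    A * outer2 v w * Aᴴ = outer2 (A *ᵥ v) (A *ᵥ w) := by
  rw [outer2, outer2, Matrix.mul_vecMulVec, Matrix.vecMulVec_mul, Matrix.star_mulVec]

theorem outer2_eq_of_JPM_eq {v w : Twistor n} (h : JPM v = JPM w) : outer2 v v = outer2 w w := by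
  rw [JPM_eq, JPM_eq] at h
  have h1 := congrArg (fun A => A * phiD n)
    (smul_right_injective (Mat2 n) (neg_ne_zero.2 Complex.I_ne_zero) h)
  simpa only [Matrix.mul_assoc, phiD_mul_self, Matrix.mul_one] using h1

theorem outer2_eq_of_JPMt_eq {v w : Twistor n} (h : JPMt v = JPMt w) :
    outer2 v v = outer2 w w := by
  rw [JPMt_eq, JPMt_eq] at h
  have h1 := congrArg (fun A => A * psiA n) h
  simpa only [Matrix.mul_assoc, psiA_mul_self, Matrix.mul_neg, Matrix.mul_one, neg_inj] using h1

/-! ## The change of realization -/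

theorem inv_sqrt_two_mul_self :
    ((Real.sqrt 2 : ℝ) : ℂ)⁻¹ * ((Real.sqrt 2 : ℝ) : ℂ)⁻¹ = 1 / 2 := by
  rw [← mul_inv, ← Complex.ofReal_mul, Real.mul_self_sqrt (by norm_num)]; norm_num

theorem cMat_conjTranspose : (cMat n)ᴴ =
    ((Real.sqrt 2 : ℝ) : ℂ)⁻¹ • fromBlocks 1 (Complex.I • 1) (Complex.I • 1) 1 := by
  simp [cMat, Matrix.conjTranspose_smul, Matrix.fromBlocks_conjTranspose]

theorem cMat_mul_conjTranspose : cMat n * (cMat n)ᴴ = 1 := by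
  rw [cMat_conjTranspose, cMat, smul_mul_smul_comm, inv_sqrt_two_mul_self,
    Matrix.fromBlocks_multiply, Matrix.fromBlocks_smul, ← Matrix.fromBlocks_one]
  congr 1 <;> ext i j <;> by_cases h : i = j <;> simp [h, Matrix.one_apply] <;> norm_num

theorem cMat_conjTranspose_mul : (cMat n)ᴴ * cMat n = 1 :=
  mul_eq_one_comm.1 cMat_mul_conjTranspose

/-- This single identity, with unitarity of `𝒞`, transports the one-form, the null cone and the
momentum map from the antidiagonal to the diagonal realization. -/
theorem cMat_mul_psiA : cMat n * psiA n * (cMat n)ᴴ = -Complex.I • phiD n := by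
  rw [cMat_conjTranspose, cMat, smul_mul_assoc, smul_mul_smul_comm, inv_sqrt_two_mul_self,
    psiA, phiD, Matrix.fromBlocks_multiply, Matrix.fromBlocks_multiply, Matrix.fromBlocks_smul,
    Matrix.fromBlocks_smul]
  congr 1 <;> ext i j <;> by_cases h : i = j <;> simp [h] <;> ring

theorem cMat_form (v w : Twistor n) :
    star (cMat n *ᵥ v) ⬝ᵥ (phiD n *ᵥ (cMat n *ᵥ w)) = Complex.I * (star v ⬝ᵥ (psiA n *ᵥ w)) := by
  have h : phiD n = Complex.I • (cMat n * psiA n * (cMat n)ᴴ) := by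
    rw [cMat_mul_psiA, smul_smul]; simp
  rw [h, Matrix.star_mulVec, ← Matrix.dotProduct_mulVec, Matrix.smul_mulVec, Matrix.mulVec_smul,
    dotProduct_smul, smul_eq_mul]
  simp only [Matrix.mulVec_mulVec]
  rw [show (cMat n)ᴴ * (cMat n * psiA n * (cMat n)ᴴ * cMat n) =
    ((cMat n)ᴴ * cMat n) * psiA n * ((cMat n)ᴴ * cMat n) by simp only [Matrix.mul_assoc],
    cMat_conjTranspose_mul, Matrix.one_mul, Matrix.mul_one]

theorem gammaPM_cMat (v w : Twistor n) :
    gammaPM (cMat n *ᵥ v) (cMat n *ᵥ w) = gammaPMt v w := by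
  rw [gammaPM_eq, gammaPMt_eq, cMat_form, ← mul_assoc, Complex.I_mul_I, neg_one_mul]

theorem cMat_mulVec_conjTranspose (v : Twistor n) : cMat n *ᵥ ((cMat n)ᴴ *ᵥ v) = v := by
  rw [Matrix.mulVec_mulVec, cMat_mul_conjTranspose, Matrix.one_mulVec]

theorem cMat_conjTranspose_mulVec (v : Twistor n) : (cMat n)ᴴ *ᵥ (cMat n *ᵥ v) = v := by
  rw [Matrix.mulVec_mulVec, cMat_conjTranspose_mul, Matrix.one_mulVec]

theorem cMat_mem_T0_iff {w : Twistor n} : cMat n *ᵥ w ∈ T0 n ↔ w ∈ T0t n := by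
  rw [mem_T0_iff, mem_T0t_iff, cMat_form]
  refine and_congr (not_congr ⟨fun h => ?_, fun h => by rw [h, Matrix.mulVec_zero]⟩)
    (by simp [Complex.I_ne_zero])
  rw [← cMat_conjTranspose_mulVec w, h, Matrix.mulVec_zero]

theorem cMat_conjTranspose_mem_T0t_iff {v : Twistor n} : (cMat n)ᴴ *ᵥ v ∈ T0t n ↔ v ∈ T0 n := by
  rw [← cMat_mem_T0_iff, cMat_mulVec_conjTranspose]

theorem JPM_cMat (w : Twistor n) : JPM (cMat n *ᵥ w) = cMat n * JPMt w * (cMat n)ᴴ := by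
  rw [JPM_eq, JPMt_eq, ← Matrix.mul_smul, ← cMat_mul_psiA, ← mul_outer2_mul]
  rw [show cMat n * outer2 w w * (cMat n)ᴴ * (cMat n * psiA n * (cMat n)ᴴ) =
    cMat n * (outer2 w w * ((cMat n)ᴴ * cMat n) * psiA n) * (cMat n)ᴴ by
      simp only [Matrix.mul_assoc], cMat_conjTranspose_mul, Matrix.mul_one]

theorem cMat_conj_injective {A B : Mat2 n}
    (h : cMat n * A * (cMat n)ᴴ = cMat n * B * (cMat n)ᴴ) : A = B := by
  have h1 := congrArg (fun M => (cMat n)ᴴ * M * cMat n) h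
  simp only [Matrix.mul_assoc, cMat_conjTranspose_mul, Matrix.mul_one] at h1
  simpa only [← Matrix.mul_assoc, cMat_conjTranspose_mul, Matrix.one_mul] using h1

theorem IPP_eq (v : Twistor n) : IPP v = star v ⬝ᵥ v := (star_dot_sum v v).symm

theorem IPP_cMat (w : Twistor n) : IPP (cMat n *ᵥ w) = IPP w := by
  rw [IPP_eq, IPP_eq, Matrix.star_mulVec, ← Matrix.dotProduct_mulVec, cMat_conjTranspose_mulVec]

theorem IPP_eq_of_outer2_eq {v w : Twistor n} (h : outer2 v v = outer2 w w) : IPP v = IPP w := by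
  have := congrArg Matrix.trace h
  rw [outer2, outer2, Matrix.trace_vecMulVec, Matrix.trace_vecMulVec] at this
  rw [IPP_eq, IPP_eq, dotProduct_comm, this, dotProduct_comm]

/-! ## Orbits of `U(n,n)` -/

theorem Unn_inv {g : Mat2 n} (hg : g ∈ Unn n) : g⁻¹ = phiD n * gᴴ * phiD n := by
  have hg : gᴴ * phiD n * g = phiD n := hg
  refine Matrix.inv_eq_left_inv ?_
  rw [Matrix.mul_assoc, Matrix.mul_assoc, ← Matrix.mul_assoc gᴴ, hg, phiD_mul_self]

theorem Unn_inv_mul {g : Mat2 n} (hg : g ∈ Unn n) : g⁻¹ * g = 1 := by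
  have hg' : gᴴ * phiD n * g = phiD n := hg
  rw [Unn_inv hg, Matrix.mul_assoc, Matrix.mul_assoc, ← Matrix.mul_assoc gᴴ, hg', phiD_mul_self]

theorem Unn_mulVec_ne_zero {g : Mat2 n} (hg : g ∈ Unn n) {v : Twistor n} (hv : v ≠ 0) :
    g *ᵥ v ≠ 0 := fun h => hv <| by
  rw [← Matrix.one_mulVec v, ← Unn_inv_mul hg, ← Matrix.mulVec_mulVec, h, Matrix.mulVec_zero]

theorem Unn_mulVec_form {g : Mat2 n} (hg : g ∈ Unn n) (v w : Twistor n) :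
    star (g *ᵥ v) ⬝ᵥ (phiD n *ᵥ (g *ᵥ w)) = star v ⬝ᵥ (phiD n *ᵥ w) := by
  have hg : gᴴ * phiD n * g = phiD n := hg
  rw [Matrix.star_mulVec, ← Matrix.dotProduct_mulVec, Matrix.mulVec_mulVec, Matrix.mulVec_mulVec,
    hg]

theorem Unn_mulVec_mem_T0 {g : Mat2 n} (hg : g ∈ Unn n) {v : Twistor n} (hv : v ∈ T0 n) :
    g *ᵥ v ∈ T0 n := by
  rw [mem_T0_iff] at *
  exact ⟨Unn_mulVec_ne_zero hg hv.1, by rw [Unn_mulVec_form hg, hv.2]⟩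

theorem JPM_Unn {g : Mat2 n} (hg : g ∈ Unn n) (v : Twistor n) :
    JPM (g *ᵥ v) = g * JPM v * g⁻¹ := by
  rw [JPM_eq, JPM_eq, Unn_inv hg, ← mul_outer2_mul, Matrix.mul_smul, Matrix.smul_mul]
  congr 1
  rw [show g * (outer2 v v * phiD n) * (phiD n * gᴴ * phiD n) =
    g * outer2 v v * (phiD n * phiD n) * gᴴ * phiD n by simp only [Matrix.mul_assoc],
    phiD_mul_self, Matrix.mul_one]

/-- The group elements that move the base point to a prescribed point of the orbit. -/
theorem exists_mem_Unn {Z P : Mat n} (hZ : Zᴴ * Z = 1) (hP : IsUnit P.det) :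
    ∃ g ∈ Unn n, g.toBlocks₁₁ + g.toBlocks₁₂ = Z * P ∧ g.toBlocks₂₁ + g.toBlocks₂₂ = P := by
  -- The blocks below satisfy `A + B = P` and `A - B = Q`. The pseudo-unitarity conditions `A^+ A -
  -- B^+ B = 1` and `A^+ B = B^+ A` then reduce to `P^+ Q = Q^+ P = 1`; the unitary `Z` multiplies
  -- only the upper row and drops out.
  set Q := (P⁻¹)ᴴ with hQ
  have h1 : Pᴴ * Q = 1 := by
    rw [hQ, ← Matrix.conjTranspose_mul, Matrix.nonsing_inv_mul _ hP, Matrix.conjTranspose_one]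
  have h2 : Qᴴ * P = 1 := by
    rw [hQ, Matrix.conjTranspose_conjTranspose, Matrix.nonsing_inv_mul _ hP]
  set A := (1 / 2 : ℂ) • (P + Q) with hA
  set B := (1 / 2 : ℂ) • (P - Q) with hB
  have hs : star (1 / 2 : ℂ) = 1 / 2 := by simp
  have hAA : Aᴴ * A - Bᴴ * B = 1 := by
    rw [hA, hB]
    simp only [Matrix.conjTranspose_smul, hs, smul_mul_smul_comm, Matrix.conjTranspose_add,
      Matrix.conjTranspose_sub, add_mul, mul_add, sub_mul, mul_sub, h1, h2]
    module
  have hAB : Aᴴ * B - Bᴴ * A = 0 := by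
    rw [hA, hB]
    simp only [Matrix.conjTranspose_smul, hs, smul_mul_smul_comm, Matrix.conjTranspose_add,
      Matrix.conjTranspose_sub, add_mul, mul_add, sub_mul, mul_sub, h1, h2]
    module
  have hZ' : ∀ M N : Mat n, (Z * M)ᴴ * (Z * N) = Mᴴ * N := fun M N => by
    rw [Matrix.conjTranspose_mul, Matrix.mul_assoc, ← Matrix.mul_assoc Zᴴ, hZ, Matrix.one_mul]
  refine ⟨fromBlocks (Z * A) (Z * B) B A, ?_, ?_, ?_⟩
  · change _ = _
    rw [phiD, Matrix.fromBlocks_conjTranspose, Matrix.fromBlocks_multiply,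
      Matrix.fromBlocks_multiply]
    simp only [Matrix.mul_one, Matrix.mul_zero, add_zero, zero_add, Matrix.mul_neg,
      Matrix.neg_mul, hZ']
    simp only [← sub_eq_add_neg]
    rw [hAA, hAB, ← neg_sub (Aᴴ * B) (Bᴴ * A), ← neg_sub (Aᴴ * A), hAA, hAB, neg_zero]
  · simp only [Matrix.toBlocks_fromBlocks₁₁, Matrix.toBlocks_fromBlocks₁₂, ← Matrix.mul_add]
    congr 1
    rw [hA, hB]; module
  · simp only [Matrix.toBlocks_fromBlocks₂₁, Matrix.toBlocks_fromBlocks₂₂]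
    rw [hA, hB]; module

/-- The first basis vector. -/
def e1 (hn : 0 < n) : Fin n → ℂ := Pi.single ⟨0, hn⟩ 1

theorem e1_ne_zero (hn : 0 < n) : e1 hn ≠ 0 := by simp [e1]

theorem star_e1_dot (hn : 0 < n) : star (e1 hn) ⬝ᵥ e1 hn = 1 := by simp [e1]

theorem rho10_eq (hn : 0 < n) : rho10 n = Complex.I • outer (e1 hn) (e1 hn) := by
  ext i j
  have : ∀ k : Fin n, (e1 hn) k = if (k : ℕ) = 0 then 1 else 0 := fun k => by
    simp [e1, Pi.single_apply, Fin.ext_iff]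
  simp only [rho10, Matrix.diagonal_apply, Matrix.smul_apply, outer, Matrix.vecMulVec_apply,
    Pi.star_apply, this, Fin.ext_iff]
  split_ifs <;> simp_all

theorem exists_isUnit_mulVec_e1 (hn : 0 < n) {z : Fin n → ℂ} (hz : z ≠ 0) :
    ∃ P : Mat n, IsUnit P.det ∧ P *ᵥ e1 hn = z := by
  obtain ⟨r, hr, hrz⟩ : ∃ r : ℝ, 0 < r ∧ star z ⬝ᵥ z = r := by
    have h := Complex.pos_iff.1 (star_dot_self_pos hz)
    exact ⟨(star z ⬝ᵥ z).re, h.1, Complex.ext rfl (by simpa using h.2.symm)⟩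
  have hs : (((Real.sqrt r : ℝ) : ℂ)) ≠ 0 := by
    simpa using (Real.sqrt_pos.2 hr).ne'
  have hss : ((Real.sqrt r : ℝ) : ℂ) * (Real.sqrt r : ℝ) = r := by
    rw [← Complex.ofReal_mul, Real.mul_self_sqrt hr.le]
  obtain ⟨Z, hZ, hZe⟩ := exists_unitary_mulVec_eq (a := e1 hn)
    (b := ((Real.sqrt r : ℝ) : ℂ)⁻¹ • z) (by
      rw [star_e1_dot, star_smul, smul_dotProduct, dotProduct_smul, hrz, ← hss]
      simp only [smul_eq_mul, star_inv₀, Complex.star_def, Complex.conj_ofReal]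
      field_simp)
  refine ⟨((Real.sqrt r : ℝ) : ℂ) • Z, ?_, ?_⟩
  · rw [Matrix.det_smul]
    have : IsUnit Z.det := by
      have h := congrArg Matrix.det hZ
      rw [Matrix.det_mul, Matrix.det_one] at h
      exact IsUnit.of_mul_eq_one_right _ h
    exact (IsUnit.mk0 _ hs).pow _ |>.mul this
  · rw [Matrix.smul_mulVec, hZe, smul_smul, mul_inv_cancel₀ hs, one_smul]

/-- The substitution `η = Zz`, `ξ = z` carries the cotangent momentum map to the twistor one;
questions about `J_0` are answered on null twistors through it. -/
theorem J0_eq_JPM (Z : Mat n) (z : Fin n → ℂ) :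
    J0 (Z, Complex.I • outer z z) = JPM (Sum.elim (Z *ᵥ z) z) := by
  simp only [J0, JPM, fstC_sumElim, sndC_sumElim, Matrix.mul_smul, mul_outer, Matrix.smul_mul,
    outer_mul, Matrix.conjTranspose_conjTranspose, Matrix.conjTranspose_smul, outer_conjTranspose,
    Matrix.fromBlocks_smul, smul_neg]
  simp

theorem sumElim_mem_T0 {Z : Mat n} (hZ : Zᴴ * Z = 1) {z : Fin n → ℂ} (hz : z ≠ 0) :
    Sum.elim (Z *ᵥ z) z ∈ T0 n := by
  refine ⟨fun h => hz (congrArg sndC h), ?_⟩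
  rw [fstC_sumElim, sndC_sumElim, Matrix.star_mulVec, ← Matrix.dotProduct_mulVec,
    Matrix.mulVec_mulVec, hZ, Matrix.one_mulVec, sub_self]

/-- Nullity says that both components have the same norm, so a unitary carries the second to the
first. If the second were zero, so would be the first. -/
theorem exists_unitary_of_mem_T0 {v : Twistor n} (hv : v ∈ T0 n) :
    sndC v ≠ 0 ∧ ∃ Z : Mat n, Zᴴ * Z = 1 ∧ v = Sum.elim (Z *ᵥ sndC v) (sndC v) := by
  obtain ⟨hv0, hv⟩ := hv
  obtain ⟨Z, hZ, hZv⟩ := exists_unitary_mulVec_eq (sub_eq_zero.1 hv).symm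
  refine ⟨fun h => hv0 ?_, Z, hZ, by rw [hZv, sumElim_fstC_sndC]⟩
  rw [← sumElim_fstC_sndC v, ← hZv, h, Matrix.mulVec_zero]
  ext (i | i) <;> rfl

theorem Unn_mulVec_sumElim (g : Mat2 n) (z : Fin n → ℂ) :
    g *ᵥ Sum.elim z z = Sum.elim ((g.toBlocks₁₁ + g.toBlocks₁₂) *ᵥ z)
      ((g.toBlocks₂₁ + g.toBlocks₂₂) *ᵥ z) := by
  conv_lhs => rw [← Matrix.fromBlocks_toBlocks g]
  rw [fromBlocks_mulVec_eq, fstC_sumElim, sndC_sumElim, Matrix.add_mulVec, Matrix.add_mulVec]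

/-- For `g` in `U(n,n)` the vectors `g (z, z) = (R z, S z)` are null and nonzero for `z ≠ 0`. This
makes `S` injective, and `R^+ R = S^+ S` makes `R S⁻¹` unitary. Conversely, an invertible `P` with
`P e₁ = z` can be completed to a group element by `exists_mem_Unn`. -/
theorem mem_O10_iff (hn : 0 < n) {p : Mat n × Mat n} :
    p ∈ O10 n ↔ p.1ᴴ * p.1 = 1 ∧ ∃ z : Fin n → ℂ, z ≠ 0 ∧ p.2 = Complex.I • outer z z := by
  constructor
  · rintro ⟨g, hg, rfl⟩
    set R := g.toBlocks₁₁ + g.toBlocks₁₂ with hR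
    set S := g.toBlocks₂₁ + g.toBlocks₂₂ with hS
    have hgv : ∀ z : Fin n → ℂ, g *ᵥ Sum.elim z z = Sum.elim (R *ᵥ z) (S *ᵥ z) :=
      Unn_mulVec_sumElim g
    have hmem : ∀ z : Fin n → ℂ, z ≠ 0 → Sum.elim (R *ᵥ z) (S *ᵥ z) ∈ T0 n := fun z hz => by
      rw [← hgv]
      have := sumElim_mem_T0 (Z := 1) (by simp) hz
      rw [Matrix.one_mulVec] at this
      exact Unn_mulVec_mem_T0 hg this
    have hSinj : Function.Injective S.mulVec := by
      intro x y hxy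
      by_contra hne
      apply (exists_unitary_of_mem_T0 (hmem _ (sub_ne_zero.2 hne))).1
      rw [sndC_sumElim, Matrix.mulVec_sub, sub_eq_zero]
      exact hxy
    have hSu : IsUnit S.det :=
      (Matrix.isUnit_iff_isUnit_det S).1 (Matrix.mulVec_injective_iff_isUnit.1 hSinj)
    have hRS : Rᴴ * R = Sᴴ * S := by
      have hg' : gᴴ * phiD n * g = phiD n := hg
      rw [← Matrix.fromBlocks_toBlocks g, phiD, Matrix.fromBlocks_conjTranspose,
        Matrix.fromBlocks_multiply, Matrix.fromBlocks_multiply] at hg'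
      obtain ⟨h1, h2, h3, h4⟩ := Matrix.fromBlocks_inj.1 hg'
      simp only [Matrix.mul_one, Matrix.mul_zero, add_zero, zero_add, Matrix.mul_neg,
        Matrix.neg_mul] at h1 h2 h3 h4
      rw [← sub_eq_zero, hR, hS]
      simp only [Matrix.conjTranspose_add, add_mul, mul_add]
      -- The sum of the four block equations of `g^+ φ g = φ` is the relation for the row sums `R`
      -- and `S`; the right-hand sides `1` and `-1` cancel.
      have := congrArg₂ (· + ·) (congrArg₂ (· + ·) h1 h2) (congrArg₂ (· + ·) h3 h4)
      simp only [add_zero, zero_add, add_neg_cancel] at this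
      rw [← this]
      abel
    have hL : Lam g (1, rho10 n) = (R * S⁻¹, S * rho10 n * Sᴴ) := by
      simp only [Lam, Matrix.mul_one, ← hR, ← hS]
    rw [hL]
    refine ⟨?_, S *ᵥ e1 hn, ?_, ?_⟩
    · rw [Matrix.conjTranspose_mul, Matrix.mul_assoc, ← Matrix.mul_assoc Rᴴ, hRS,
        Matrix.mul_assoc, Matrix.mul_nonsing_inv _ hSu, Matrix.mul_one,
        ← Matrix.conjTranspose_mul, Matrix.mul_nonsing_inv _ hSu, Matrix.conjTranspose_one]
    · intro h
      exact e1_ne_zero hn (hSinj (by rw [h, Matrix.mulVec_zero]))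
    · rw [rho10_eq hn, Matrix.mul_smul, Matrix.smul_mul, mul_outer, outer_mul,
        Matrix.conjTranspose_conjTranspose]
  · rintro ⟨hZ, z, hz, hρ⟩
    obtain ⟨P, hP, hPz⟩ := exists_isUnit_mulVec_e1 hn hz
    obtain ⟨g, hg, h1, h2⟩ := exists_mem_Unn hZ hP
    refine ⟨g, hg, ?_⟩
    rw [Lam, Matrix.mul_one, Matrix.mul_one, h1, h2]
    refine Prod.ext ?_ ?_
    · rw [Matrix.mul_assoc, Matrix.mul_nonsing_inv _ hP, Matrix.mul_one]
    · rw [hρ, rho10_eq hn, Matrix.mul_smul, Matrix.smul_mul, mul_outer, outer_mul,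
        Matrix.conjTranspose_conjTranspose, hPz]

/-- `J_{+-}` is equivariant and `U(n,n)` is transitive on nonzero null twistors, so the adjoint
orbit of one value is the whole image. -/
theorem mem_N10_iff (hn : 0 < n) {A : Mat2 n} : A ∈ N10 n ↔ ∃ v ∈ T0 n, A = JPM v := by
  have h0 : J0 (1, rho10 n) = JPM (Sum.elim (e1 hn) (e1 hn)) := by
    rw [rho10_eq hn, J0_eq_JPM, Matrix.one_mulVec]
  have he : Sum.elim (e1 hn) (e1 hn) ∈ T0 n := by
    have := sumElim_mem_T0 (Z := 1) (by simp) (e1_ne_zero hn)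
    rwa [Matrix.one_mulVec] at this
  constructor
  · rintro ⟨g, hg, rfl⟩
    exact ⟨_, Unn_mulVec_mem_T0 hg he, by rw [JPM_Unn hg, h0]⟩
  · rintro ⟨v, hv, rfl⟩
    obtain ⟨hs, Z, hZ, hZv⟩ := exists_unitary_of_mem_T0 hv
    obtain ⟨P, hP, hPz⟩ := exists_isUnit_mulVec_e1 hn hs
    obtain ⟨g, hg, h1, h2⟩ := exists_mem_Unn hZ hP
    refine ⟨g, hg, ?_⟩
    rw [h0, ← JPM_Unn hg, Unn_mulVec_sumElim, h1, h2, hPz, ← Matrix.mulVec_mulVec, hPz, ← hZv]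

theorem mem_N10t_iff (hn : 0 < n) {A : Mat2 n} : A ∈ N10t n ↔ ∃ w ∈ T0t n, A = JPMt w := by
  change cMat n * A * (cMat n)ᴴ ∈ N10 n ↔ _
  rw [mem_N10_iff hn]
  constructor
  · rintro ⟨v, hv, h⟩
    refine ⟨(cMat n)ᴴ *ᵥ v, cMat_conjTranspose_mem_T0t_iff.2 hv, cMat_conj_injective ?_⟩
    rw [← JPM_cMat, cMat_mulVec_conjTranspose, h]
  · rintro ⟨w, hw, rfl⟩
    exact ⟨cMat n *ᵥ w, cMat_mem_T0_iff.2 hw, (JPM_cMat w).symm⟩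

theorem J0_mem_N10 (hn : 0 < n) {p : Mat n × Mat n} (hp : p ∈ O10 n) : J0 p ∈ N10 n := by
  obtain ⟨hZ, z, hz, hρ⟩ := (mem_O10_iff hn).1 hp
  obtain ⟨Z, ρ⟩ := p
  simp only at hρ hZ
  subst hρ
  exact (mem_N10_iff hn).2 ⟨_, sumElim_mem_T0 hZ hz, J0_eq_JPM Z z⟩

theorem exists_J0_eq (hn : 0 < n) {A : Mat2 n} (hA : A ∈ N10 n) : ∃ p ∈ O10 n, J0 p = A := by
  obtain ⟨v, hv, rfl⟩ := (mem_N10_iff hn).1 hA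
  obtain ⟨hs, Z, hZ, hZv⟩ := exists_unitary_of_mem_T0 hv
  exact ⟨(Z, Complex.I • outer (sndC v) (sndC v)), (mem_O10_iff hn).2 ⟨hZ, _, hs, rfl⟩, by
    rw [J0_eq_JPM, ← hZv]⟩

/-! ## The momentum map of `H(n) × H(n)` and the Cayley transform -/

theorem J0t_eq_JPMt {Y : Mat n} (hY : Y.IsHermitian) (z : Fin n → ℂ) :
    J0t (Y, outer z z) = JPMt (Sum.elim (Y *ᵥ z) z) := by
  simp only [J0t, JPMt, fstC_sumElim, sndC_sumElim, mul_outer, outer_mul, hY.eq]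

theorem sumElim_mem_T0t {Y : Mat n} (hY : Y.IsHermitian) {z : Fin n → ℂ} (hz : z ≠ 0) :
    Sum.elim (Y *ᵥ z) z ∈ T0t n := by
  refine ⟨fun h => hz (congrArg sndC h), ?_⟩
  rw [fstC_sumElim, sndC_sumElim, star_dot_mulVec, hY.eq, sub_self, mul_zero]

/-- `(1 + iY)(1 - iY) = 1 + Y²` is positive definite for hermitian `Y`, hence invertible. -/
theorem one_sub_I_smul_det_ne_zero {Y : Mat n} (hY : Y.IsHermitian) :
    IsUnit (-Complex.I • Y + 1).det := by
  refine Matrix.isUnit_det_of_left_inverse (B := (1 + Y * Y)⁻¹ * (Complex.I • Y + 1)) ?_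
  have h1 : (Complex.I • Y + 1) * (-Complex.I • Y + 1) = 1 + Y * Y := by
    rw [mul_add, add_mul, add_mul, smul_mul_smul_comm]
    simp only [one_mul, mul_one, mul_neg, Complex.I_mul_I, neg_neg]
    module
  have h2 : (1 + Y * Y).PosDef := by
    refine Matrix.PosDef.one.add_posSemidef ?_
    have := Matrix.posSemidef_conjTranspose_mul_self Y
    rwa [hY.eq] at this
  rw [Matrix.mul_assoc, h1, Matrix.nonsing_inv_mul _ ((Matrix.isUnit_iff_isUnit_det _).1 h2.isUnit)]

/-- With `K = 1 - iY` and `L = Y - i`, one has `𝒞 (Yz, z) = (Lz, Kz)/√2`. The matrix `Z = L K⁻¹`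
takes the second component to the first and is unitary because `L^+ L = K^+ K`. The factor `i/2` in
`TC` is `i` times the square of `1/√2`. -/
theorem TC_eq {Y : Mat n} (hY : Y.IsHermitian) (z : Fin n → ℂ) :
    ∃ Z : Mat n, Zᴴ * Z = 1 ∧
      TC (Y, outer z z) = (Z, Complex.I • outer (sndC (cMat n *ᵥ Sum.elim (Y *ᵥ z) z))
        (sndC (cMat n *ᵥ Sum.elim (Y *ᵥ z) z))) ∧
      Z *ᵥ sndC (cMat n *ᵥ Sum.elim (Y *ᵥ z) z) = fstC (cMat n *ᵥ Sum.elim (Y *ᵥ z) z) := by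
  have hs : sndC (cMat n *ᵥ Sum.elim (Y *ᵥ z) z) =
      ((Real.sqrt 2 : ℝ) : ℂ)⁻¹ • ((-Complex.I • Y + 1) *ᵥ z) := by
    rw [cMat, Matrix.smul_mulVec, fromBlocks_mulVec_eq]
    ext i
    simp [sndC, Matrix.add_mulVec, Matrix.neg_mulVec, Matrix.smul_mulVec]
  have hf : fstC (cMat n *ᵥ Sum.elim (Y *ᵥ z) z) =
      ((Real.sqrt 2 : ℝ) : ℂ)⁻¹ • ((Y - Complex.I • (1 : Mat n)) *ᵥ z) := by
    rw [cMat, Matrix.smul_mulVec, fromBlocks_mulVec_eq]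
    ext i
    simp [fstC, Matrix.sub_mulVec, Matrix.neg_mulVec, Matrix.smul_mulVec]
    ring
  have hu := one_sub_I_smul_det_ne_zero hY
  set K := -Complex.I • Y + 1 with hK
  set L := Y - Complex.I • (1 : Mat n) with hL
  have hLK : Lᴴ * L = Kᴴ * K := by
    rw [hK, hL]
    simp only [Matrix.conjTranspose_sub, Matrix.conjTranspose_add, Matrix.conjTranspose_smul,
      hY.eq, Matrix.conjTranspose_one, sub_mul, mul_sub, add_mul, mul_add, smul_mul_assoc,
      mul_smul_comm, one_mul, mul_one, star_neg, Complex.star_def, Complex.conj_I, neg_neg]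
    match_scalars <;>
      first | ring1 | linear_combination Complex.I_sq | linear_combination -Complex.I_sq
  refine ⟨L * K⁻¹, ?_, ?_, ?_⟩
  · rw [Matrix.conjTranspose_mul, Matrix.mul_assoc, ← Matrix.mul_assoc Lᴴ, hLK,
      Matrix.mul_assoc, Matrix.mul_nonsing_inv _ hu, Matrix.mul_one,
      ← Matrix.conjTranspose_mul, Matrix.mul_nonsing_inv _ hu, Matrix.conjTranspose_one]
  · rw [hs, TC]
    rw [Prod.mk.injEq]
    refine ⟨rfl, ?_⟩
    rw [outer_smul_smul, star_inv₀, Complex.star_def, Complex.conj_ofReal, inv_sqrt_two_mul_self,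
      ← hK, mul_outer, outer_mul, Matrix.conjTranspose_conjTranspose, smul_smul]
    congr 1
    ring
  · rw [hs, hf, Matrix.mulVec_smul, Matrix.mulVec_mulVec, Matrix.mul_assoc,
      Matrix.nonsing_inv_mul _ hu, Matrix.mul_one]

theorem TC_mem_O10 (hn : 0 < n) {p : Mat n × Mat n} (hp : p ∈ O10t n) : TC p ∈ O10 n := by
  obtain ⟨Y, X⟩ := p
  obtain ⟨hY, z, hz, hX⟩ := mem_O10t_iff.1 hp
  simp only at hX hY
  subst hX
  obtain ⟨Z, hZ, h, -⟩ := TC_eq hY z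
  have := (exists_unitary_of_mem_T0 (cMat_mem_T0_iff.2 (sumElim_mem_T0t hY hz))).1
  rw [h]
  exact (mem_O10_iff hn).2 ⟨hZ, _, this, rfl⟩

theorem J0_TC {p : Mat n × Mat n} (hp : p ∈ O10t n) :
    J0 (TC p) = cMat n * J0t p * (cMat n)ᴴ := by
  obtain ⟨Y, X⟩ := p
  obtain ⟨hY, z, hz, hX⟩ := mem_O10t_iff.1 hp
  simp only at hX hY
  subst hX
  obtain ⟨Z, hZ, h, h'⟩ := TC_eq hY z
  rw [h, J0_eq_JPM, h', sumElim_fstC_sndC, JPM_cMat, J0t_eq_JPMt hY]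

theorem J0t_mem_N10t (hn : 0 < n) {p : Mat n × Mat n} (hp : p ∈ O10t n) : J0t p ∈ N10t n := by
  change _ ∈ N10 n
  rw [← J0_TC hp]
  exact J0_mem_N10 hn (TC_mem_O10 hn hp)

/-! ## Leaves of the null twistors -/

/-- The twistor form as a sesquilinear form. -/
def formD (v w : Twistor n) : ℂ := star v ⬝ᵥ (phiD n *ᵥ w)

theorem formD_add_left (u v w : Twistor n) : formD (u + v) w = formD u w + formD v w := by
  simp [formD, add_dotProduct]

theorem formD_add_right (u v w : Twistor n) : formD u (v + w) = formD u v + formD u w := by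
  simp [formD, Matrix.mulVec_add]

theorem formD_smul_left (c : ℂ) (v w : Twistor n) : formD (c • v) w = star c * formD v w := by
  simp [formD]

theorem formD_smul_right (c : ℂ) (v w : Twistor n) : formD v (c • w) = c * formD v w := by
  simp [formD, Matrix.mulVec_smul]

theorem star_formD (v w : Twistor n) : star (formD v w) = formD w v := by
  rw [formD, formD, ← Matrix.star_dotProduct, Matrix.star_mulVec, phiD_conjTranspose,
    ← Matrix.dotProduct_mulVec]

theorem formD_phiD_right (v w : Twistor n) : formD v (phiD n *ᵥ w) = star v ⬝ᵥ w := by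
  rw [formD, Matrix.mulVec_mulVec, phiD_mul_self, Matrix.one_mulVec]

theorem formD_phiD_left (v w : Twistor n) : formD (phiD n *ᵥ v) w = star v ⬝ᵥ w := by
  rw [formD, Matrix.star_mulVec, phiD_conjTranspose, ← Matrix.dotProduct_mulVec,
    Matrix.mulVec_mulVec, phiD_mul_self, Matrix.one_mulVec]

theorem ofReal_smul {m : Type*} (t : ℝ) (v : m → ℂ) : t • v = (t : ℂ) • v := by
  ext i; simp

theorem extD_gammaPM (p u w : Twistor n) :
    extD gammaPM p u w = Complex.I * (formD u w - formD w u) := by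
  rw [extD_of_bilinear, gammaPM_eq, gammaPM_eq, mul_sub]
  · rfl
  · intro p u w t
    simp only [gammaPM_eq, ofReal_smul]
    change Complex.I * formD _ _ = Complex.I * formD _ _ + _ * (Complex.I * formD _ _)
    rw [formD_add_left, formD_smul_left, Complex.star_def, Complex.conj_ofReal]
    ring

theorem extD_gammaPM_eq_im (p u w : Twistor n) :
    extD gammaPM p u w = ((-2 * (formD u w).im : ℝ) : ℂ) := by
  rw [extD_gammaPM, ← star_formD u w, Complex.star_def, Complex.sub_conj]
  push_cast
  linear_combination (2 * (formD u w).im : ℂ) * Complex.I_sq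

theorem re_formD_of_mem_tangentVecs {p u : Twistor n} (hu : u ∈ tangentVecs (T0 n) p) :
    (formD p u).re = 0 := by
  obtain ⟨c, rfl, hd, hM, -⟩ := mem_tangentVecs_iff.1 hu
  have h1 : HasDerivAt (fun t => formD (c t) (c t)) (formD u (c 0) + formD (c 0) u) 0 :=
    hasDerivAt_dotProduct (hasDerivAt_star hd)
      (by simpa using hasDerivAt_mulVec (hasDerivAt_const 0 (phiD n)) hd)
  have h2 : HasDerivAt (fun t => formD (c t) (c t)) 0 0 :=
    (hasDerivAt_const (0 : ℝ) (0 : ℂ)).congr_of_eventuallyEq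
      (hM.mono fun t ht => (mem_T0_iff.1 ht).2)
  have h3 := h1.unique h2
  rw [← star_formD, Complex.star_def, add_comm, Complex.add_conj] at h3
  have h4 : 2 * (formD (c 0) u).re = 0 := by exact_mod_cast h3
  linarith

theorem mem_T0_iff_formD {v : Twistor n} : v ∈ T0 n ↔ v ≠ 0 ∧ formD v v = 0 := mem_T0_iff

theorem exists_pos_star_dot {m : Type*} [Fintype m] {p : m → ℂ} (hp : p ≠ 0) :
    ∃ r : ℝ, 0 < r ∧ star p ⬝ᵥ p = r := by
  have h := Complex.pos_iff.1 (Matrix.dotProduct_star_self_pos_iff.2 hp)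
  exact ⟨(star p ⬝ᵥ p).re, h.1, Complex.ext rfl (by simpa using h.2.symm)⟩

/-- The null cone is a smooth hypersurface; a curve with velocity `v` is obtained by correcting the
line `p + t v` along `z = φ p`. -/
theorem mem_tangentVecs_T0 {p v : Twistor n} (hp : p ∈ T0 n) (hv : (formD p v).re = 0) :
    v ∈ tangentVecs (T0 n) p := by
  obtain ⟨hp0, hpp⟩ := mem_T0_iff_formD.1 hp
  obtain ⟨r, hr, hrp⟩ := exists_pos_star_dot hp0
  set z := phiD n *ᵥ p with hz
  have hpz : formD p z = r := by rw [hz, formD_phiD_right, hrp]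
  have hzp : formD z p = r := by rw [hz, formD_phiD_left, hrp]
  have hzz : formD z z = 0 := by rw [hz, formD_phiD_left]; exact hpp
  set m := (formD v z).re with hm
  set q := (formD v v).re with hq
  have hvv : formD v v = q := by
    refine Complex.ext rfl ?_
    have := congrArg Complex.im (star_formD v v)
    simp only [Complex.star_def, Complex.conj_im] at this
    simp only [Complex.ofReal_im]
    linarith
  have hvz : formD v z + formD z v = 2 * m := by
    rw [← star_formD v z, Complex.star_def, Complex.add_conj]; push_cast; rfl
  have hpv : formD p v + formD v p = 0 := by
    rw [← star_formD p v, Complex.star_def, Complex.add_conj, hv]; simp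
  -- Since `z` is null, the form on `p + t v + s z` is affine in `s`, namely `t² q + 2 s (r + t m)`.
  -- Its zero is `s = t² h(t)`, smooth near 0 and of second order, so the velocity stays `v`.
  set h : ℝ → ℝ := fun t => -q / (2 * (r + t * m)) with hh
  set c : ℝ → Twistor n := fun t => p + t • v + (t ^ 2 * h t) • z with hc
  have hne : ∀ᶠ t in 𝓝 (0 : ℝ), r + t * m ≠ 0 := by
    have : ContinuousAt (fun t : ℝ => r + t * m) 0 := by fun_prop
    exact this.eventually_ne (by simpa using hr.ne')
  have hsmooth : ∀ t, r + t * m ≠ 0 → ContDiffAt ℝ ∞ h t := fun t ht => by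
    refine contDiffAt_const.div ?_ (mul_ne_zero two_ne_zero ht)
    fun_prop
  have hcs : ∀ t, r + t * m ≠ 0 → ContDiffAt ℝ ∞ c t := fun t ht => by
    refine ((contDiff_line p v).contDiffAt).add ?_
    exact ((contDiffAt_id.pow 2).mul (hsmooth t ht)).smul contDiffAt_const
  have h0 : c 0 = p := by simp [hc]
  have hd : HasDerivAt c v 0 := by
    have h1 : HasDerivAt (fun t : ℝ => t ^ 2 * h t) 0 0 := by
      have h2 : HasDerivAt (fun t : ℝ => t ^ 2) 0 0 := by simpa using hasDerivAt_pow 2 (0 : ℝ)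
      simpa using h2.fun_mul
        ((hsmooth 0 (by simpa using hr.ne')).differentiableAt (by simp)).hasDerivAt
    have h3 := (hasDerivAt_line p v 0).fun_add (h1.smul_const z)
    rwa [zero_smul, add_zero] at h3
  refine mem_tangentVecs_iff.2 ⟨c, h0, hd, ?_, hne.mono hcs⟩
  have hc0 : ∀ᶠ t in 𝓝 (0 : ℝ), c t ≠ 0 := hd.continuousAt.eventually_ne (by rwa [h0])
  filter_upwards [hne, hc0] with t ht ht0
  refine mem_T0_iff_formD.2 ⟨ht0, ?_⟩
  have hst : ((t ^ 2 * h t : ℝ) : ℂ) * (2 * (r + t * m)) = -(t ^ 2 * q) := by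
    have : t ^ 2 * h t * (2 * (r + t * m)) = -(t ^ 2 * q) := by
      rw [hh]; field_simp
    exact_mod_cast this
  simp only [hc, ofReal_smul, formD_add_left, formD_add_right, formD_smul_left, formD_smul_right,
    Complex.star_def, Complex.conj_ofReal, hpp, hpz, hzp, hzz, hvv]
  linear_combination (t : ℂ) * hpv + (t * ((t ^ 2 * h t : ℝ) : ℂ)) * hvz + hst

/-- Degeneracy says that the real functional `Im ⟨u, ·⟩` vanishes on the kernel of `Re ⟨p, ·⟩`, so
the two are proportional. Nondegeneracy of the form turns this into `u ∈ ℝ i p`. -/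
theorem exists_eq_smul_of_mem_degenerateVecs {p u : Twistor n} (hp : p ∈ T0 n)
    (hu : u ∈ degenerateVecs gammaPM (T0 n) p) : ∃ a : ℝ, u = (a * Complex.I) • p := by
  obtain ⟨r, hr, hrp⟩ := exists_pos_star_dot hp.1
  have h1 : ∀ v, (formD p v).re = 0 → (formD u v).im = 0 := fun v hv => by
    have := hu.2 v (mem_tangentVecs_T0 hp hv)
    rw [extD_gammaPM_eq_im, Complex.ofReal_eq_zero] at this
    linarith
  set a := (star u ⬝ᵥ p).im / r with ha
  have h2 : ∀ x, (star u ⬝ᵥ x).im = a * (star p ⬝ᵥ x).re := fun x => by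
    -- Inserting `φ` replaces the indefinite form by the Euclidean product; the multiple of `φ p`
    -- corrects the vector so that it becomes tangent.
    have := h1 (phiD n *ᵥ x + ((-(star p ⬝ᵥ x).re / r : ℝ) : ℂ) • (phiD n *ᵥ p)) (by
      rw [formD_add_right, formD_smul_right, formD_phiD_right, formD_phiD_right, hrp,
        ← Complex.ofReal_mul, Complex.add_re, Complex.ofReal_re]
      field_simp; ring)
    rw [formD_add_right, formD_smul_right, formD_phiD_right, formD_phiD_right, Complex.add_im,
      Complex.im_ofReal_mul] at this
    rw [ha]; field_simp; field_simp at this; linarith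
  refine ⟨-a, ?_⟩
  have h3 : u + (a * Complex.I) • p = 0 := by
    rw [← dotProduct_star_self_eq_zero]
    set d := u + (a * Complex.I) • p with hd
    obtain ⟨s, hs⟩ : ∃ s : ℝ, star d ⬝ᵥ d = s := by
      by_cases h0 : d = 0
      · exact ⟨0, by simp [h0]⟩
      · obtain ⟨s, -, h⟩ := exists_pos_star_dot h0
        exact ⟨s, h⟩
    -- Testing on `i d` gives `|d|²` as the imaginary part on the left, while `h2` makes the two
    -- terms on the right cancel.
    have h4 : star d ⬝ᵥ (Complex.I • d) =
        star u ⬝ᵥ (Complex.I • d) - (a * Complex.I) * (star p ⬝ᵥ (Complex.I • d)) := by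
      conv_lhs => rw [hd, star_add, add_dotProduct, ← hd]
      rw [star_smul, smul_dotProduct, smul_eq_mul, star_mul', Complex.star_def,
        Complex.conj_ofReal, Complex.conj_I]
      ring
    have h5 := congrArg Complex.im h4
    rw [Complex.sub_im, h2, mul_assoc, Complex.im_ofReal_mul, Complex.I_mul_im, sub_self,
      dotProduct_smul, smul_eq_mul, Complex.I_mul_im, hs, Complex.ofReal_re] at h5
    rw [hs, h5, Complex.ofReal_zero]
  rw [eq_neg_of_add_eq_zero_left h3, ← neg_smul]
  push_cast; ring_nf

theorem outer2_eq_of_cls_eq {p q : Twistor n} {hp : p ∈ T0 n} {hq : q ∈ T0 n}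
    (h : cls gammaPM (T0 n) p hp = cls gammaPM (T0 n) q hq) : outer2 p p = outer2 q q := by
  refine apply_eq_of_cls_eq (J := fun v => outer2 v v) ?_ h
  intro c u t hd hM hu
  obtain ⟨a, rfl⟩ := exists_eq_smul_of_mem_degenerateVecs (hM t) hu
  have := hasDerivAt_vecMulVec hd (hasDerivAt_star hd)
  have h0 : vecMulVec ((a * Complex.I) • c t) (star (c t)) +
      vecMulVec (c t) (star ((a * Complex.I) • c t)) = 0 := by
    rw [star_smul, Matrix.smul_vecMulVec, Matrix.vecMulVec_smul]
    ext i j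
    simp
  rwa [h0] at this

/-- The two points differ by a phase `e^{ia}`, and `e^{ita} p` joins them. Its velocity is a real
multiple of `i` times the point, so pairing it with a tangent vector gives a multiple of `Re ⟨p,
w⟩`, which is zero on the null cone. -/
theorem cls_eq_of_outer2_eq {p q : Twistor n} (hp : p ∈ T0 n) (hq : q ∈ T0 n)
    (h : outer2 p p = outer2 q q) : cls gammaPM (T0 n) p hp = cls gammaPM (T0 n) q hq := by
  obtain ⟨k, hk, rfl⟩ := eq_smul_of_outer_eq h.symm
  have hk1 : ‖k‖ = 1 := by
    rw [Complex.star_def, Complex.mul_conj'] at hk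
    have : ‖k‖ ^ 2 = 1 := by exact_mod_cast hk
    exact (pow_eq_one_iff_of_nonneg (norm_nonneg k) two_ne_zero).1 this
  obtain ⟨a, ha⟩ := (Complex.norm_eq_one_iff k).1 hk1
  refine cls_eq_of_leafStep hp hq ?_
  have hcd : ContDiff ℝ ∞ fun t : ℝ => Complex.exp (t * a * Complex.I) :=
    ((contDiff_ofReal.mul contDiff_const).mul contDiff_const).cexp
  have hd : ∀ t : ℝ, HasDerivAt (fun t : ℝ => Complex.exp (t * a * Complex.I))
      (Complex.exp (t * a * Complex.I) * (a * Complex.I)) t := fun t => by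
    have : HasDerivAt (fun t : ℝ => (t : ℂ) * a * Complex.I) (a * Complex.I) t := by
      simpa using ((Complex.ofRealCLM.hasDerivAt (x := t)).mul_const (a : ℂ)).mul_const Complex.I
    exact this.cexp
  have hcc : ContDiff ℝ ∞ fun t : ℝ => Complex.exp (t * a * Complex.I) • p :=
    hcd.smul contDiff_const
  have hmem : ∀ t : ℝ, Complex.exp (t * a * Complex.I) • p ∈ T0 n := fun t => by
    rw [mem_T0_iff_formD] at hp ⊢
    refine ⟨smul_ne_zero (Complex.exp_ne_zero _) hp.1, ?_⟩
    rw [formD_smul_left, formD_smul_right, hp.2, mul_zero, mul_zero]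
  refine ⟨_, hcc, by simp, by simp [ha], fun t => ⟨hmem t, deriv_mem_tangentVecs hcc hmem t, ?_⟩⟩
  intro w hw
  have hw := re_formD_of_mem_tangentVecs hw
  rw [extD_gammaPM_eq_im, ((hd t).smul_const p).deriv, mul_comm (Complex.exp _), mul_smul,
    formD_smul_left]
  generalize formD (Complex.exp (t * a * Complex.I) • p) w = x at hw ⊢
  simp [hw]

/-! ## Transport of leaves by linear isomorphisms -/

/-- The inverse `L'` is needed to pull test vectors of `M'` back to tangent vectors of `M`. -/
theorem LeafStep.map {V W : Type*} [NormedAddCommGroup V] [NormedSpace ℝ V]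
    [NormedAddCommGroup W] [NormedSpace ℝ W] {θ : V → V → ℂ} {M : Set V} {θ' : W → W → ℂ}
    {M' : Set W} (L : V →L[ℝ] W) (L' : W →L[ℝ] V) (hL : ∀ p ∈ M, L p ∈ M')
    (hL' : ∀ q ∈ M', L' q ∈ M) (h1 : ∀ q, L (L' q) = q) (h2 : ∀ p, L' (L p) = p)
    (hext : ∀ p u w, extD θ' (L p) (L u) (L w) = extD θ p u w) {p q : M}
    (h : LeafStep θ M p q) : LeafStep θ' M' ⟨L p, hL p p.2⟩ ⟨L q, hL q q.2⟩ := by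
  obtain ⟨c, hc, hc0, hc1, h⟩ := h
  refine ⟨fun t => L (c t), L.contDiff.comp hc, congrArg L hc0, congrArg L hc1, fun t =>
    ⟨hL _ (h t).1, ?_⟩⟩
  have hd : deriv (fun t => L (c t)) t = L (deriv c t) :=
    (L.hasFDerivAt.comp_hasDerivAt t (hc.differentiable (by simp) t).hasDerivAt).deriv
  rw [hd]
  refine ⟨?_, fun w hw => ?_⟩
  · have := fderiv_mem_tangentVecs (M' := M') isOpen_univ L.contDiff.contDiffOn
      (fun q _ => hL q) (mem_univ _) (h t).2.1
    rwa [L.fderiv] at this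
  · have := fderiv_mem_tangentVecs (M' := M) isOpen_univ L'.contDiff.contDiffOn
      (fun q _ => hL' q) (mem_univ _) hw
    rw [L'.fderiv, h2] at this
    rw [← h1 w, hext]
    exact (h t).2.2 _ this

theorem cls_map_eq {V W : Type*} [NormedAddCommGroup V] [NormedSpace ℝ V]
    [NormedAddCommGroup W] [NormedSpace ℝ W] {θ : V → V → ℂ} {M : Set V} {θ' : W → W → ℂ}
    {M' : Set W} (L : V →L[ℝ] W) (L' : W →L[ℝ] V) (hL : ∀ p ∈ M, L p ∈ M')
    (hL' : ∀ q ∈ M', L' q ∈ M) (h1 : ∀ q, L (L' q) = q) (h2 : ∀ p, L' (L p) = p)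
    (hext : ∀ p u w, extD θ' (L p) (L u) (L w) = extD θ p u w) {p q : V} {hp : p ∈ M} {hq : q ∈ M}
    (h : cls θ M p hp = cls θ M q hq) :
    cls θ' M' (L p) (hL p hp) = cls θ' M' (L q) (hL q hq) := by
  have key : ∀ x y : M, leafSetoid θ M x y →
      cls θ' M' (L x) (hL x x.2) = cls θ' M' (L y) (hL y y.2) := by
    intro x y hxy
    induction hxy with
    | rel x y h => exact cls_eq_of_leafStep _ _ (h.map L L' hL hL' h1 h2 hext)
    | refl => rfl
    | symm _ _ _ ih => exact ih.symm
    | trans _ _ _ _ _ ih1 ih2 => exact ih1.trans ih2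
  exact key _ _ (Quotient.exact h)

/-- Multiplication by a matrix as a real linear map. -/
noncomputable def mulVecCLM (A : Mat2 n) : Twistor n →L[ℝ] Twistor n :=
  LinearMap.toContinuousLinearMap ((Matrix.mulVecLin A).restrictScalars ℝ)

theorem gammaPMt_add_smul (p u w : Twistor n) (t : ℝ) :
    gammaPMt (p + t • u) w = gammaPMt p w + t * gammaPMt u w := by
  simp only [gammaPMt_eq, ofReal_smul, star_add, star_smul, add_dotProduct, smul_dotProduct,
    Complex.star_def, Complex.conj_ofReal, smul_eq_mul]
  ring

theorem extD_gammaPMt (p u w : Twistor n) :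
    extD gammaPMt p u w = gammaPMt u w - gammaPMt w u :=
  extD_of_bilinear gammaPMt_add_smul p u w

theorem extD_gammaPM_cMat (p u w : Twistor n) :
    extD gammaPM (cMat n *ᵥ p) (cMat n *ᵥ u) (cMat n *ᵥ w) = extD gammaPMt p u w := by
  rw [extD_gammaPM, extD_gammaPMt, ← gammaPM_cMat, ← gammaPM_cMat, gammaPM_eq, gammaPM_eq, mul_sub]
  rfl

theorem extD_gammaPMt_cMat (p u w : Twistor n) :
    extD gammaPMt ((cMat n)ᴴ *ᵥ p) ((cMat n)ᴴ *ᵥ u) ((cMat n)ᴴ *ᵥ w) = extD gammaPM p u w := by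
  rw [← extD_gammaPM_cMat, cMat_mulVec_conjTranspose, cMat_mulVec_conjTranspose,
    cMat_mulVec_conjTranspose]

theorem cls_cMat_eq {p q : Twistor n} {hp : p ∈ T0t n} {hq : q ∈ T0t n}
    (h : cls gammaPMt (T0t n) p hp = cls gammaPMt (T0t n) q hq) :
    cls gammaPM (T0 n) (cMat n *ᵥ p) (cMat_mem_T0_iff.2 hp) =
      cls gammaPM (T0 n) (cMat n *ᵥ q) (cMat_mem_T0_iff.2 hq) :=
  cls_map_eq (mulVecCLM (cMat n)) (mulVecCLM (cMat n)ᴴ) (fun _ => cMat_mem_T0_iff.2)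
    (fun _ => cMat_conjTranspose_mem_T0t_iff.2) cMat_mulVec_conjTranspose
    cMat_conjTranspose_mulVec extD_gammaPM_cMat h

theorem cls_cMat_conjTranspose_eq {p q : Twistor n} {hp : p ∈ T0 n} {hq : q ∈ T0 n}
    (h : cls gammaPM (T0 n) p hp = cls gammaPM (T0 n) q hq) :
    cls gammaPMt (T0t n) ((cMat n)ᴴ *ᵥ p) (cMat_conjTranspose_mem_T0t_iff.2 hp) =
      cls gammaPMt (T0t n) ((cMat n)ᴴ *ᵥ q) (cMat_conjTranspose_mem_T0t_iff.2 hq) :=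
  cls_map_eq (mulVecCLM (cMat n)ᴴ) (mulVecCLM (cMat n))
    (fun _ => cMat_conjTranspose_mem_T0t_iff.2) (fun _ => cMat_mem_T0_iff.2)
    cMat_conjTranspose_mulVec cMat_mulVec_conjTranspose extD_gammaPMt_cMat h

theorem cls_eq_iff_JPM {p q : Twistor n} {hp : p ∈ T0 n} {hq : q ∈ T0 n} :
    cls gammaPM (T0 n) p hp = cls gammaPM (T0 n) q hq ↔ JPM p = JPM q :=
  ⟨fun h => by rw [JPM_eq, JPM_eq, outer2_eq_of_cls_eq h],
    fun h => cls_eq_of_outer2_eq hp hq (outer2_eq_of_JPM_eq h)⟩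

theorem cls_eq_iff_JPMt {p q : Twistor n} {hp : p ∈ T0t n} {hq : q ∈ T0t n} :
    cls gammaPMt (T0t n) p hp = cls gammaPMt (T0t n) q hq ↔ JPMt p = JPMt q := by
  constructor
  · intro h
    have := cls_eq_iff_JPM.1 (cls_cMat_eq h)
    rw [JPM_cMat, JPM_cMat] at this
    exact cMat_conj_injective this
  · intro h
    have h1 : cls gammaPM (T0 n) _ (cMat_mem_T0_iff.2 hp) =
        cls gammaPM (T0 n) _ (cMat_mem_T0_iff.2 hq) :=
      cls_eq_iff_JPM.2 (by rw [JPM_cMat, JPM_cMat, h])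
    have h2 := cls_cMat_conjTranspose_eq h1
    simpa only [cMat_conjTranspose_mulVec] using h2

/-! ## Leaves of `H(n) × H(n)` -/

/-- Derivatives of curves of multiples of projections of rank one have vanishing compression to
the annihilator. -/
theorem trace_mul_eq_zero_of_hasDerivAt {X : ℝ → Mat n} {X' a : Mat n} {t : ℝ}
    (hX : HasDerivAt X X' t) (hsq : ∀ᶠ s in 𝓝 t, X s * X s = (X s).trace • X s)
    (h1 : a * X t = 0) (h2 : X t * a = 0) (h0 : (X t).trace ≠ 0) : (a * X').trace = 0 := by
  have hs : HasDerivAt (fun s => (X s).trace • X s)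
      (X'.trace • X t + (X t).trace • X') t := by
    have h3 := hasDerivAt_trace hX
    rw [hasDerivAt_matrix] at hX ⊢
    exact fun i j => h3.mul (hX i j)
  -- Differentiate `X² = (tr X) X`. After multiplication by `a` and taking traces, every term
  -- containing `aX` or `Xa` drops out, leaving `tr X · tr (a X') = 0`.
  have h3 := (hasDerivAt_mul hX hX).unique (hs.congr_of_eventuallyEq hsq)
  have h4 := congrArg (fun M => (a * M).trace) h3
  simp only [Matrix.mul_add, ← Matrix.mul_assoc, h1, Matrix.mul_smul, Matrix.zero_mul,
    Matrix.trace_smul, smul_zero, add_zero, zero_add] at h4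
  rw [Matrix.trace_mul_comm, ← Matrix.mul_assoc, h2, Matrix.zero_mul, Matrix.trace_zero] at h4
  exact (smul_eq_zero.1 h4.symm).resolve_left h0

theorem smul_outer_mul_self (k : ℂ) (z : Fin n → ℂ) :
    (k • outer z z) * (k • outer z z) = (k • outer z z).trace • (k • outer z z) := by
  rw [smul_mul_smul_comm, mul_outer, outer_mulVec, outer_smul_left, Matrix.trace_smul, trace_outer,
    smul_smul, smul_smul, smul_eq_mul]
  congr 1
  ring

theorem hasDerivAt_isHermitian {Y : ℝ → Mat n} {Y' : Mat n} {t : ℝ} (hY : HasDerivAt Y Y' t)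
    (h : ∀ᶠ s in 𝓝 t, (Y s).IsHermitian) : Y'.IsHermitian :=
  (hasDerivAt_conjTranspose hY).unique
    (hY.congr_of_eventuallyEq (h.mono fun _ hs => hs.eq))

theorem extD_gamma0t (p u w : Mat n × Mat n) :
    extD gamma0t p u w = (w.2 * u.1).trace - (u.2 * w.1).trace := by
  rw [extD_of_bilinear]
  · simp only [gamma0t]; ring
  · intro p u w t
    simp [gamma0t, Matrix.add_mul]
    ring

/-- Necessary conditions suffice here: they show that fibre directions are degenerate, while the
explicit vectors of `mk_mem_tangentVecs_O10t` serve as tests for the converse. -/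
theorem tangentVecs_O10t {p u : Mat n × Mat n} (hu : u ∈ tangentVecs (O10t n) p) :
    u.1.IsHermitian ∧ u.2.IsHermitian ∧
      ∀ a : Mat n, a * p.2 = 0 → p.2 * a = 0 → (a * u.2).trace = 0 := by
  obtain ⟨c, rfl, hd, hM, -⟩ := mem_tangentVecs_iff.1 hu
  refine ⟨hasDerivAt_isHermitian (hasDerivAt_fst hd) (hM.mono fun t ht => ht.1),
    hasDerivAt_isHermitian (hasDerivAt_snd hd) (hM.mono fun t ht => ht.2.1.1), fun a h1 h2 => ?_⟩
  refine trace_mul_eq_zero_of_hasDerivAt (hasDerivAt_snd hd) ?_ h1 h2 ?_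
  · filter_upwards [hM] with t ht
    obtain ⟨-, z, -, hz⟩ := mem_O10t_iff.1 ht
    simpa [hz] using smul_outer_mul_self 1 z
  · obtain ⟨-, z, hz0, hz⟩ := mem_O10t_iff.1 hM.self_of_nhds
    rw [hz, trace_outer]
    exact star_dot_self_ne_zero hz0

theorem mk_mem_tangentVecs_O10t {Y b : Mat n} {z : Fin n → ℂ} (d : Fin n → ℂ)
    (hY : Y.IsHermitian) (hb : b.IsHermitian) (hz : z ≠ 0) :
    (b, outer d z + outer z d) ∈ tangentVecs (O10t n) (Y, outer z z) := by
  have hz' : ContDiff ℝ ∞ fun t : ℝ => z + t • d := contDiff_line z d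
  have hdz := hasDerivAt_line z d 0
  have := mem_tangentVecs_of_contDiff (M := O10t n)
    (c := fun t : ℝ => (Y + t • b, outer (z + t • d) (z + t • d)))
    ((contDiff_line Y b).prodMk (contDiff_vecMulVec hz'
      (contDiff_pi.2 fun i => contDiff_star.comp (contDiff_pi.1 hz' i)))) ?_
    ((hasDerivAt_line Y b 0).prodMk (hasDerivAt_vecMulVec hdz (hasDerivAt_star hdz)))
  · simpa [outer] using this
  · have h0 : ∀ᶠ t in 𝓝 (0 : ℝ), z + t • d ≠ 0 :=
      hdz.continuousAt.eventually_ne (by simpa using hz)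
    filter_upwards [h0] with t ht
    refine mem_O10t_iff.2 ⟨hY.add ?_, _, ht, rfl⟩
    rw [Matrix.IsHermitian, Matrix.conjTranspose_smul, hb.eq]; simp

theorem isHermitian_trace_mul_self_eq_zero {b : Mat n} (hb : b.IsHermitian)
    (h : (b * b).trace = 0) : b = 0 :=
  Matrix.trace_conjTranspose_mul_self_eq_zero_iff.1 (by rwa [hb.eq])

/-- Testing against `(u.2, 0)` gives `tr (u.2²) = 0`; testing against the variation of `z` by `u.1
z` gives `2 |u.1 z|² = 0`. -/
theorem degenerateVecs_O10t {p u : Mat n × Mat n} (hp : p ∈ O10t n)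
    (hu : u ∈ degenerateVecs gamma0t (O10t n) p) : u.2 = 0 ∧ u.1 * p.2 = 0 ∧ p.2 * u.1 = 0 := by
  obtain ⟨Y, X⟩ := p
  obtain ⟨hY, z, hz, hX⟩ := mem_O10t_iff.1 hp
  simp only at hX hY
  subst hX
  obtain ⟨hu1, hu2, -⟩ := tangentVecs_O10t hu.1
  have h1 := hu.2 _ (mk_mem_tangentVecs_O10t 0 hY hu2 hz)
  rw [extD_gamma0t] at h1
  have hb : u.2 = 0 := isHermitian_trace_mul_self_eq_zero hu2 (by simpa [outer] using h1)
  have h2 := hu.2 _ (mk_mem_tangentVecs_O10t (u.1 *ᵥ z) hY Matrix.isHermitian_zero hz)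
  rw [extD_gamma0t, hb, Matrix.zero_mul, Matrix.trace_zero, sub_zero, Matrix.add_mul, outer_mul,
    outer_mul, hu1.eq, Matrix.trace_add, trace_outer, trace_outer] at h2
  have h4 : star (u.1 *ᵥ (u.1 *ᵥ z)) ⬝ᵥ z = star (u.1 *ᵥ z) ⬝ᵥ (u.1 *ᵥ z) := by
    rw [star_dot_mulVec, hu1.eq]
  rw [h4, ← two_mul] at h2
  have h3 : u.1 *ᵥ z = 0 :=
    dotProduct_star_self_eq_zero.1 ((mul_eq_zero.1 h2).resolve_left two_ne_zero)
  refine ⟨hb, ?_, ?_⟩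
  · rw [mul_outer, h3]; simp [outer]
  · rw [outer_mul, hu1.eq, h3]; simp [outer]

theorem J0t_eq_of_cls_eq {p q : Mat n × Mat n} {hp : p ∈ O10t n} {hq : q ∈ O10t n}
    (h : cls gamma0t (O10t n) p hp = cls gamma0t (O10t n) q hq) : J0t p = J0t q := by
  refine apply_eq_of_cls_eq ?_ h
  intro c u t hd hM hu
  obtain ⟨h1, h2, h3⟩ := degenerateVecs_O10t (hM t) hu
  have hY := hasDerivAt_fst hd
  have hX := hasDerivAt_snd hd
  have := hasDerivAt_fromBlocks (hasDerivAt_mul hY hX)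
    (hasDerivAt_mul (hasDerivAt_mul hY hX) hY).neg hX (hasDerivAt_mul hX hY).neg
  refine this.congr_deriv ?_
  simp [h1, h2, h3, Matrix.mul_assoc, Matrix.fromBlocks_zero]

/-- Equal values force equal `X` and a difference `a` of the `Y`'s with `aX = Xa = 0`. The segment
`(Y + t a, X)` is then in a leaf, since `tr (a X')` vanishes for every tangent `X'`. -/
theorem cls_eq_of_J0t_eq {p q : Mat n × Mat n} (hp : p ∈ O10t n) (hq : q ∈ O10t n)
    (h : J0t p = J0t q) : cls gamma0t (O10t n) p hp = cls gamma0t (O10t n) q hq := by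
  obtain ⟨h1, -, hX, h2⟩ := Matrix.fromBlocks_inj.1 h
  have hY1 : (q.1 - p.1) * p.2 = 0 := by
    rw [Matrix.sub_mul, h1, hX, sub_self]
  have hY2 : p.2 * (q.1 - p.1) = 0 := by
    rw [Matrix.mul_sub, neg_inj.1 h2, hX, sub_self]
  have hc : ContDiff ℝ ∞ fun t : ℝ => (p.1 + t • (q.1 - p.1), p.2) :=
    (contDiff_line _ _).prodMk contDiff_const
  have hM : ∀ t : ℝ, (p.1 + t • (q.1 - p.1), p.2) ∈ O10t n := fun t => by
    refine ⟨?_, hp.2⟩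
    refine hp.1.add ?_
    rw [Matrix.IsHermitian, Matrix.conjTranspose_smul, Matrix.conjTranspose_sub, hp.1.eq, hq.1.eq]
    simp
  refine cls_eq_of_leafStep hp hq ⟨_, hc, by simp, by simp [hX], fun t =>
    ⟨hM t, deriv_mem_tangentVecs hc hM t, fun w hw => ?_⟩⟩
  rw [((hasDerivAt_line p.1 (q.1 - p.1) t).prodMk (hasDerivAt_const t p.2)).deriv, extD_gamma0t,
    Matrix.trace_mul_comm, (tangentVecs_O10t hw).2.2 _ hY1 hY2]
  simp

theorem cls_eq_iff_J0t {p q : Mat n × Mat n} {hp : p ∈ O10t n} {hq : q ∈ O10t n} :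
    cls gamma0t (O10t n) p hp = cls gamma0t (O10t n) q hq ↔ J0t p = J0t q :=
  ⟨J0t_eq_of_cls_eq, cls_eq_of_J0t_eq hp hq⟩

/-! ## The Cayley curve of unitary matrices -/

theorem skew_det_isUnit {K : Mat n} (hK : Kᴴ = -K) (t : ℝ) : IsUnit (1 - t • K).det := by
  have h : (-(Complex.I * t) • K).IsHermitian := by
    rw [Matrix.IsHermitian, Matrix.conjTranspose_smul, hK]
    simp
  have := one_sub_I_smul_det_ne_zero h
  rwa [smul_smul, show -Complex.I * (-(Complex.I * t)) = (-t : ℂ) by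
    linear_combination (t : ℂ) * Complex.I_sq, neg_smul, neg_add_eq_sub,
    show ((t : ℂ) • K) = t • K by ext; simp] at this

/-- The Cayley curve `(1 - tK)⁻¹ (1 + tK)`. -/
noncomputable def cayleyCurve (K : Mat n) (t : ℝ) : Mat n := (1 - t • K)⁻¹ * (1 + t • K)

theorem contDiff_cayleyCurve {K : Mat n} (hK : Kᴴ = -K) : ContDiff ℝ ∞ (cayleyCurve K) := by
  refine contDiff_mul ?_ (contDiff_line _ _)
  refine contDiff_iff_contDiffAt.2 fun t => contDiffAt_inv ?_ (skew_det_isUnit hK t).ne_zero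
  simpa [sub_eq_add_neg] using (contDiff_line (1 : Mat n) (-K)).contDiffAt (x := t)

theorem cayleyCurve_zero (K : Mat n) : cayleyCurve K 0 = 1 := by simp [cayleyCurve]

theorem mul_cayleyCurve {K : Mat n} (hK : Kᴴ = -K) (t : ℝ) :
    (1 - t • K) * cayleyCurve K t = 1 + t • K := by
  rw [cayleyCurve, ← Matrix.mul_assoc, Matrix.mul_nonsing_inv _ (skew_det_isUnit hK t),
    Matrix.one_mul]

theorem cayleyCurve_unitary {K : Mat n} (hK : Kᴴ = -K) (t : ℝ) :
    (cayleyCurve K t)ᴴ * cayleyCurve K t = 1 := by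
  have hu := skew_det_isUnit hK t
  have h1 : (1 - t • K)ᴴ = 1 + t • K := by
    rw [Matrix.conjTranspose_sub, Matrix.conjTranspose_smul, hK]; simp
  have h2 : (1 + t • K)ᴴ = 1 - t • K := by rw [← h1, Matrix.conjTranspose_conjTranspose]
  have hu' : IsUnit (1 + t • K).det := by
    rw [← h1, Matrix.det_conjTranspose]; exact hu.star
  have hcomm : (1 - t • K) * (1 + t • K) = (1 + t • K) * (1 - t • K) := by
    simp only [sub_mul, mul_add, add_mul, mul_sub, one_mul, mul_one]; abel
  rw [cayleyCurve, Matrix.conjTranspose_mul, h2, Matrix.conjTranspose_nonsing_inv, h1,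
    Matrix.mul_assoc, ← Matrix.mul_assoc _ (1 - t • K)⁻¹, ← Matrix.mul_inv_rev, hcomm,
    Matrix.mul_inv_rev, Matrix.mul_assoc, Matrix.nonsing_inv_mul _ hu', Matrix.mul_one,
    Matrix.mul_nonsing_inv _ hu]

/-- Differentiating `(1 - tK) c(t) = 1 + tK` at 0 gives `c'(0) - K = K`, without a formula for the
derivative of an inverse. -/
theorem hasDerivAt_cayleyCurve {K : Mat n} (hK : Kᴴ = -K) :
    HasDerivAt (cayleyCurve K) ((2 : ℂ) • K) 0 := by
  have hd := ((contDiff_cayleyCurve hK).differentiable (by simp) 0).hasDerivAt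
  have h1 : HasDerivAt (fun t : ℝ => 1 - t • K) (-K) 0 := by
    have h := hasDerivAt_line (1 : Mat n) (-K) 0
    simp only [smul_neg, ← sub_eq_add_neg] at h
    exact h
  have h2 := hasDerivAt_mul h1 hd
  simp only [mul_cayleyCurve hK] at h2
  have h3 := h2.unique (hasDerivAt_line (1 : Mat n) K 0)
  rw [cayleyCurve_zero, Matrix.mul_one, zero_smul, sub_zero, Matrix.one_mul,
    neg_add_eq_iff_eq_add, ← two_smul ℂ K] at h3
  rwa [h3] at hd

theorem cayleyCurve_mulVec {K : Mat n} (hK : Kᴴ = -K) {z : Fin n → ℂ} (hz : K *ᵥ z = 0) (t : ℝ) :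
    cayleyCurve K t *ᵥ z = z := by
  have h1 : (1 + t • K) *ᵥ z = z := by
    rw [Matrix.add_mulVec, Matrix.smul_mulVec, hz]; simp
  have h2 : (1 - t • K) *ᵥ z = z := by
    rw [Matrix.sub_mulVec, Matrix.smul_mulVec, hz]; simp
  rw [cayleyCurve, ← Matrix.mulVec_mulVec, h1]
  conv_lhs => rw [← h2]
  rw [Matrix.mulVec_mulVec, Matrix.nonsing_inv_mul _ (skew_det_isUnit hK t), Matrix.one_mulVec]

/-- A unitary matrix without eigenvalue `-1` lies on a Cayley curve. -/
theorem exists_cayleyCurve_eq {V : Mat n} (hV : Vᴴ * V = 1) (h : (V + 1).det ≠ 0)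
    {z : Fin n → ℂ} (hz : V *ᵥ z = z) :
    ∃ K : Mat n, Kᴴ = -K ∧ K *ᵥ z = 0 ∧ cayleyCurve K 1 = V := by
  have hu : IsUnit (V + 1).det := IsUnit.mk0 _ h
  have hl : (V + 1) * (V + 1)⁻¹ = 1 := Matrix.mul_nonsing_inv _ hu
  have hr : (V + 1)⁻¹ * (V + 1) = 1 := Matrix.nonsing_inv_mul _ hu
  -- The generator is the inverse Cayley transform `K = (V - 1)(V + 1)⁻¹ = 1 - 2R`. Unitarity of `V`
  -- becomes `R^+ + R = 1`, which is skewness of `K`; `Vz = z` gives `Rz = z/2`, hence `Kz = 0`.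
  set R := (V + 1)⁻¹ with hR
  have hRV : V * R = 1 - R := by rw [eq_sub_iff_add_eq, ← hl, Matrix.add_mul, Matrix.one_mul]
  have hVR : R * V = 1 - R := by rw [eq_sub_iff_add_eq, ← hr, Matrix.mul_add, Matrix.mul_one]
  have hK : (V - 1) * R = 1 - R - R := by rw [Matrix.sub_mul, hRV, Matrix.one_mul]
  have hRz : R *ᵥ z = (1 / 2 : ℂ) • z := by
    have h2 : (V + 1) *ᵥ ((1 / 2 : ℂ) • z) = z := by
      rw [Matrix.mulVec_smul, Matrix.add_mulVec, hz, Matrix.one_mulVec]; module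
    conv_lhs => rw [← h2]
    rw [Matrix.mulVec_mulVec, hr, Matrix.one_mulVec]
  have hRR : Rᴴ + R = 1 := by
    have hl' : Rᴴ * (Vᴴ + 1) = 1 := by
      have := congrArg Matrix.conjTranspose hl
      simpa [Matrix.conjTranspose_mul] using this
    have h3 : Rᴴ * ((Vᴴ + 1) * (V + 1)) * R = Rᴴ + R := by
      have : (Vᴴ + 1) * (V + 1) = (V + 1) + (Vᴴ + 1) := by
        rw [mul_add, add_mul, hV, one_mul, mul_one]; abel
      rw [this, Matrix.mul_add, hl', Matrix.add_mul, Matrix.mul_assoc, hl, Matrix.mul_one,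
        Matrix.one_mul]
    rw [← h3, ← Matrix.mul_assoc, hl', Matrix.one_mul, hl]
  have hskew : (1 - R - R)ᴴ = -(1 - R - R) := by
    rw [Matrix.conjTranspose_sub, Matrix.conjTranspose_sub, Matrix.conjTranspose_one,
      eq_sub_of_add_eq hRR]
    abel
  refine ⟨1 - R - R, hskew, ?_, ?_⟩
  · rw [Matrix.sub_mulVec, Matrix.sub_mulVec, hRz, Matrix.one_mulVec]; module
  · have h4 := mul_cayleyCurve hskew 1
    rw [one_smul] at h4
    have h5 : (1 - (1 - R - R)) * V = 1 + (1 - R - R) := by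
      rw [show (1 : Mat n) - (1 - R - R) = R + R by abel, Matrix.add_mul, hVR]; abel
    have h6 := skew_det_isUnit hskew 1
    rw [one_smul] at h6
    have h7 := congrArg (fun M => (1 - (1 - R - R))⁻¹ * M) (h4.trans h5.symm)
    simpa only [← Matrix.mul_assoc, Matrix.nonsing_inv_mul _ h6, Matrix.one_mul] using h7

/-! ## Leaves of `T^*U(n)` -/

theorem extD_gamma0 (p u w : Mat n × Mat n) :
    extD gamma0 p u w =
      (u.2 * p.1ᴴ * w.1 + p.2 * u.1ᴴ * w.1 - w.2 * p.1ᴴ * u.1 - p.2 * w.1ᴴ * u.1).trace := by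
  have key : ∀ u w : Mat n × Mat n, HasDerivAt (fun t : ℝ => gamma0 (p + t • u) w)
      (u.2 * p.1ᴴ * w.1 + p.2 * u.1ᴴ * w.1).trace 0 := fun u w => by
    have h1 := hasDerivAt_line p.1 u.1 0
    have h2 := hasDerivAt_line p.2 u.2 0
    have h3 := hasDerivAt_trace (hasDerivAt_mul (hasDerivAt_mul h2 (hasDerivAt_conjTranspose h1))
      (hasDerivAt_const 0 w.1))
    refine h3.congr_deriv ?_
    simp [Matrix.add_mul]
  rw [extD_eq_of_hasDerivAt (key u w) (key w u), ← Matrix.trace_sub]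
  congr 1
  abel

theorem tangentVecs_O10 (hn : 0 < n) {p u : Mat n × Mat n} (hu : u ∈ tangentVecs (O10 n) p) :
    u.1ᴴ * p.1 = -(p.1ᴴ * u.1) ∧ u.2ᴴ = -u.2 ∧
      ∀ a : Mat n, a * p.2 = 0 → p.2 * a = 0 → (a * u.2).trace = 0 := by
  obtain ⟨c, rfl, hd, hM, -⟩ := mem_tangentVecs_iff.1 hu
  have hZ := hasDerivAt_fst hd
  have hρ := hasDerivAt_snd hd
  refine ⟨?_, ?_, fun a h1 h2 => ?_⟩
  · have h1 := (hasDerivAt_mul (hasDerivAt_conjTranspose hZ) hZ).unique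
      ((hasDerivAt_const (0 : ℝ) (1 : Mat n)).congr_of_eventuallyEq
        (hM.mono fun t ht => ((mem_O10_iff hn).1 ht).1))
    exact eq_neg_of_add_eq_zero_left h1
  · refine (hasDerivAt_conjTranspose hρ).unique
      (hρ.neg.congr_of_eventuallyEq (hM.mono fun t ht => ?_))
    obtain ⟨-, z, -, hz⟩ := (mem_O10_iff hn).1 ht
    simp [hz, Matrix.conjTranspose_smul, outer_conjTranspose]
  · refine trace_mul_eq_zero_of_hasDerivAt hρ ?_ h1 h2 ?_
    · filter_upwards [hM] with t ht
      obtain ⟨-, z, -, hz⟩ := (mem_O10_iff hn).1 ht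
      rw [hz]
      exact smul_outer_mul_self _ z
    · obtain ⟨-, z, hz0, hz⟩ := (mem_O10_iff hn).1 hM.self_of_nhds
      rw [hz, Matrix.trace_smul, trace_outer]
      exact smul_ne_zero Complex.I_ne_zero (star_dot_self_ne_zero hz0)

theorem mk_mem_tangentVecs_O10 (hn : 0 < n) {Z K : Mat n} {z : Fin n → ℂ} (d : Fin n → ℂ)
    (hZ : Zᴴ * Z = 1) (hK : Kᴴ = -K) (hz : z ≠ 0) :
    (Z * ((2 : ℂ) • K), Complex.I • (outer d z + outer z d)) ∈
      tangentVecs (O10 n) (Z, Complex.I • outer z z) := by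
  have hz' : ContDiff ℝ ∞ fun t : ℝ => z + t • d := contDiff_line z d
  have hdz := hasDerivAt_line z d 0
  have hout := contDiff_vecMulVec hz' (contDiff_pi.2 fun i => contDiff_star.comp
    (contDiff_pi.1 hz' i))
  have hZd := hasDerivAt_mul (hasDerivAt_const 0 Z) (hasDerivAt_cayleyCurve hK)
  have hρd : HasDerivAt (fun t : ℝ => Complex.I • outer (z + t • d) (z + t • d))
      (Complex.I • (outer d (z + (0 : ℝ) • d) + outer (z + (0 : ℝ) • d) d)) 0 := by
    have := hasDerivAt_vecMulVec hdz (hasDerivAt_star hdz)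
    rw [hasDerivAt_matrix] at this ⊢
    exact fun i j => (this i j).const_mul Complex.I
  have hρc : ContDiff ℝ ∞ fun t : ℝ => Complex.I • outer (z + t • d) (z + t • d) := by
    rw [contDiff_matrix] at hout ⊢
    exact fun i j => contDiff_const.mul (hout i j)
  have := mem_tangentVecs_of_contDiff (M := O10 n)
    ((contDiff_mul contDiff_const (contDiff_cayleyCurve hK)).prodMk hρc) ?_ (hZd.prodMk hρd)
  · simpa [cayleyCurve_zero] using this
  · have h0 : ∀ᶠ t in 𝓝 (0 : ℝ), z + t • d ≠ 0 :=
      hdz.continuousAt.eventually_ne (by simpa using hz)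
    filter_upwards [h0] with t ht
    refine (mem_O10_iff hn).2 ⟨?_, _, ht, rfl⟩
    change (Z * cayleyCurve K t)ᴴ * (Z * cayleyCurve K t) = 1
    rw [Matrix.conjTranspose_mul, Matrix.mul_assoc, ← Matrix.mul_assoc Zᴴ, hZ, Matrix.one_mul,
      cayleyCurve_unitary hK]

theorem skew_trace_mul_self_eq_zero {b : Mat n} (hb : bᴴ = -b) (h : (b * b).trace = 0) : b = 0 :=
  Matrix.trace_conjTranspose_mul_self_eq_zero_iff.1 (by rw [hb, Matrix.neg_mul, Matrix.trace_neg, h,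
    neg_zero])

/-- Left translation writes the velocity as `(Zα, β)` with `α`, `β` skew, and the form becomes `tr
((β + [α, ρ]) γ) - tr (α δ)`. Free choice of `γ` kills the bracketed skew matrix; a choice of `δ`
then gives `αz = 0`, so `[α, ρ] = 0` and `β = 0`. -/
theorem degenerateVecs_O10 (hn : 0 < n) {p u : Mat n × Mat n} (hp : p ∈ O10 n)
    (hu : u ∈ degenerateVecs gamma0 (O10 n) p) : u.2 = 0 ∧ u.1 * p.2 = 0 := by
  obtain ⟨Z, ρ⟩ := p
  obtain ⟨hZ, z, hz, hρ⟩ := (mem_O10_iff hn).1 hp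
  simp only at hZ hρ
  subst hρ
  obtain ⟨hu1, hu2, -⟩ := tangentVecs_O10 hn hu.1
  obtain ⟨U, β⟩ := u
  simp only at hu1 hu2 ⊢
  have hZ' : Z * Zᴴ = 1 := mul_eq_one_comm.1 hZ
  obtain ⟨α, rfl⟩ : ∃ α, U = Z * α := ⟨Zᴴ * U, by rw [← Matrix.mul_assoc, hZ', Matrix.one_mul]⟩
  have hα : αᴴ = -α := by
    rwa [Matrix.conjTranspose_mul, Matrix.mul_assoc, hZ, Matrix.mul_one, ← Matrix.mul_assoc, hZ,
      Matrix.one_mul] at hu1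
  set ρ : Mat n := Complex.I • outer z z with hρ
  have hρs : ρᴴ = -ρ := by simp [hρ, Matrix.conjTranspose_smul, outer_conjTranspose]
  have hext : ∀ γ δ : Mat n, γᴴ = -γ → extD gamma0 (Z, ρ) (Z * α, β) (Z * γ, δ) =
      (β * γ + (α * ρ - ρ * α) * γ).trace - (α * δ).trace := fun γ δ hγ => by
    rw [extD_gamma0]
    simp only [Matrix.conjTranspose_mul, hα, hγ]
    have e1 : β * Zᴴ * (Z * γ) = β * γ := by
      rw [Matrix.mul_assoc, ← Matrix.mul_assoc Zᴴ, hZ, Matrix.one_mul]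
    have e2 : ρ * (-α * Zᴴ) * (Z * γ) = -(ρ * α * γ) := by
      rw [Matrix.mul_assoc, Matrix.mul_assoc, ← Matrix.mul_assoc Zᴴ, hZ, Matrix.one_mul,
        Matrix.neg_mul, Matrix.mul_neg, Matrix.mul_assoc]
    have e3 : δ * Zᴴ * (Z * α) = δ * α := by
      rw [Matrix.mul_assoc, ← Matrix.mul_assoc Zᴴ, hZ, Matrix.one_mul]
    have e4 : ρ * (-γ * Zᴴ) * (Z * α) = -(ρ * γ * α) := by
      rw [Matrix.mul_assoc, Matrix.mul_assoc, ← Matrix.mul_assoc Zᴴ, hZ, Matrix.one_mul,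
        Matrix.neg_mul, Matrix.mul_neg, Matrix.mul_assoc]
    rw [e1, e2, e3, e4]
    simp only [Matrix.trace_add, Matrix.trace_sub, Matrix.trace_neg, Matrix.sub_mul]
    rw [Matrix.trace_mul_comm δ, Matrix.trace_mul_cycle ρ γ α]
    ring
  have hΓ : β + (α * ρ - ρ * α) = 0 := by
    set Γ := β + (α * ρ - ρ * α) with hΓ
    have hΓs : Γᴴ = -Γ := by
      rw [hΓ, Matrix.conjTranspose_add, Matrix.conjTranspose_sub, Matrix.conjTranspose_mul,
        Matrix.conjTranspose_mul, hα, hρs, hu2]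
      simp only [neg_mul_neg]
      abel
    refine skew_trace_mul_self_eq_zero hΓs ?_
    have h1 := hu.2 _ (mk_mem_tangentVecs_O10 hn 0 hZ hΓs hz)
    rw [hext _ _ (by rw [Matrix.conjTranspose_smul, hΓs]; simp), ← Matrix.add_mul, ← hΓ,
      Matrix.mul_smul, Matrix.trace_smul] at h1
    simpa [outer] using h1
  have hz0 : α *ᵥ z = 0 := by
    -- The factor `i` in the variation of `z` is needed because `α` is skew: with it the two terms
    -- add up to a multiple of `|αz|²` instead of cancelling.
    have h1 := hu.2 _ (mk_mem_tangentVecs_O10 hn (Complex.I • (α *ᵥ z)) hZ (K := 0) (by simp) hz)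
    rw [hext _ _ (by simp), smul_zero, Matrix.mul_zero, Matrix.mul_zero, add_zero,
      Matrix.trace_zero, zero_sub, neg_eq_zero, Matrix.mul_smul, Matrix.trace_smul, Matrix.mul_add,
      mul_outer, mul_outer, Matrix.trace_add, trace_outer, trace_outer, Matrix.mulVec_smul,
      star_smul, smul_dotProduct, dotProduct_smul, star_dot_mulVec, hα, Matrix.neg_mulVec, star_neg,
      neg_dotProduct] at h1
    refine dotProduct_star_self_eq_zero.1 ?_
    have h2 := (smul_eq_zero.1 h1).resolve_left Complex.I_ne_zero
    simp only [Complex.star_def, Complex.conj_I, smul_eq_mul] at h2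
    have h3 : -2 * Complex.I * (star (α *ᵥ z) ⬝ᵥ (α *ᵥ z)) = 0 := by linear_combination h2
    exact (mul_eq_zero.1 h3).resolve_left (mul_ne_zero (by norm_num) Complex.I_ne_zero)
  have hαρ : α * ρ = 0 := by
    rw [hρ, Matrix.mul_smul, mul_outer, hz0]; simp [outer]
  have hρα : ρ * α = 0 := by
    rw [hρ, Matrix.smul_mul, outer_mul, hα, Matrix.neg_mulVec, hz0]; simp [outer]
  refine ⟨by simpa [hαρ, hρα] using hΓ, by rw [Matrix.mul_assoc, hαρ, Matrix.mul_zero]⟩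

theorem J0_eq_of_cls_eq (hn : 0 < n) {p q : Mat n × Mat n} {hp : p ∈ O10 n} {hq : q ∈ O10 n}
    (h : cls gamma0 (O10 n) p hp = cls gamma0 (O10 n) q hq) : J0 p = J0 q := by
  refine apply_eq_of_cls_eq ?_ h
  intro c u t hd hM hu
  obtain ⟨h1, h2⟩ := degenerateVecs_O10 hn (hM t) hu
  obtain ⟨-, z, -, hz⟩ := (mem_O10_iff hn).1 (hM t)
  have h3 : (c t).2 * u.1ᴴ = 0 := by
    have := congrArg Matrix.conjTranspose h2
    rw [Matrix.conjTranspose_mul, hz, Matrix.conjTranspose_smul, outer_conjTranspose] at this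
    rw [hz]
    simpa using this
  have hZ := hasDerivAt_fst hd
  have hρ := hasDerivAt_snd hd
  have hZρ := hasDerivAt_mul hZ hρ
  have := hasDerivAt_fromBlocks (hasDerivAt_mul hZρ (hasDerivAt_conjTranspose hZ)).neg hZρ
    (hasDerivAt_conjTranspose hZρ) hρ
  refine this.congr_deriv ?_
  simp [h1, h2, h3, Matrix.mul_assoc, Matrix.fromBlocks_zero]

/-- Smooth curves of unitary matrices with constant value on `z` run inside a leaf. -/
theorem cls_eq_of_unitary_curve (hn : 0 < n) {Z : ℝ → Mat n} {z : Fin n → ℂ} (hz : z ≠ 0)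
    (hc : ContDiff ℝ ∞ Z) (hZ : ∀ t, (Z t)ᴴ * Z t = 1) (hZz : ∀ t, Z t *ᵥ z = Z 0 *ᵥ z)
    (h0 : (Z 0, Complex.I • outer z z) ∈ O10 n) (h1 : (Z 1, Complex.I • outer z z) ∈ O10 n) :
    cls gamma0 (O10 n) _ h0 = cls gamma0 (O10 n) _ h1 := by
  have hcc : ContDiff ℝ ∞ fun t => (Z t, Complex.I • outer z z) := hc.prodMk contDiff_const
  have hM : ∀ t, (Z t, Complex.I • outer z z) ∈ O10 n := fun t =>
    (mem_O10_iff hn).2 ⟨hZ t, z, hz, rfl⟩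
  refine cls_eq_of_leafStep h0 h1 ⟨_, hcc, rfl, rfl, fun t =>
    ⟨hM t, deriv_mem_tangentVecs hcc hM t, fun w hw => ?_⟩⟩
  obtain ⟨U, hd⟩ : ∃ U, HasDerivAt Z U t :=
    ⟨_, (hc.differentiable (by simp) t).hasDerivAt⟩
  have hu := tangentVecs_O10 hn (deriv_mem_tangentVecs hcc hM t)
  rw [(hd.prodMk (hasDerivAt_const t _)).deriv] at hu ⊢
  obtain ⟨hu1, -, -⟩ := hu
  obtain ⟨-, -, hw3⟩ := tangentVecs_O10 hn hw
  simp only at hu1 hw3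
  have hUz : U *ᵥ z = 0 := by
    have h2 := hasDerivAt_mulVec hd (hasDerivAt_const t z)
    simp only [hZz, Matrix.mulVec_zero, add_zero] at h2
    exact h2.unique (hasDerivAt_const t _)
  have hUρ : U * (Complex.I • outer z z) = 0 := by
    rw [Matrix.mul_smul, mul_outer, hUz]; simp [outer]
  have hρU : Complex.I • outer z z * Uᴴ = 0 := by
    rw [Matrix.smul_mul, outer_mul, Matrix.conjTranspose_conjTranspose, hUz]; simp [outer]
  have hρZU : Complex.I • outer z z * ((Z t)ᴴ * U) = 0 := by
    rw [← neg_eq_zero, ← Matrix.mul_neg, ← hu1, ← Matrix.mul_assoc, hρU, Matrix.zero_mul]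
  -- The velocity `(U, 0)` satisfies `Uz = 0`, so `Z^+ U` annihilates `ρ` from both sides and its
  -- trace against any tangent `ρ'` vanishes.
  have h4 : (((Z t)ᴴ * U) * w.2).trace = 0 :=
    hw3 _ (by rw [Matrix.mul_assoc, hUρ, Matrix.mul_zero]) hρZU
  rw [extD_gamma0]
  simp only [Matrix.zero_mul, hρU, zero_add, zero_sub, Matrix.trace_sub, Matrix.trace_neg]
  rw [Matrix.mul_assoc w.2, Matrix.trace_mul_comm w.2, h4, Matrix.trace_mul_comm _ U,
    ← Matrix.mul_assoc, hUρ]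
  simp

/-! ### Avoiding the eigenvalue `-1`, and connectedness of the fibres of `J_0` -/

theorem infinite_unit_circle : {c : ℂ | c * star c = 1}.Infinite := by
  refine Set.infinite_of_injective_forall_mem
    (f := fun k : ℕ => Complex.exp ((1 / ((k : ℝ) + 1) : ℝ) * Complex.I)) ?_ ?_
  · intro a b hab
    have hmem : ∀ k : ℕ, (1 / ((k : ℝ) + 1) : ℝ) ∈ Set.Ioc (-Real.pi) Real.pi := fun k => by
      have h1 : (0 : ℝ) < 1 / ((k : ℝ) + 1) := by positivity
      have h2 : 1 / ((k : ℝ) + 1) ≤ 1 := by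
        rw [div_le_one (by positivity)]; linarith [(Nat.cast_nonneg k : (0 : ℝ) ≤ k)]
      exact ⟨by linarith [Real.pi_pos], by linarith [Real.pi_gt_three]⟩
    have h := congrArg Complex.arg hab
    simp only at h
    rw [Complex.arg_exp_mul_I, Complex.arg_exp_mul_I, toIocMod_eq_self _ |>.2,
      toIocMod_eq_self _ |>.2] at h
    · simpa using h
    · rw [show -Real.pi + 2 * Real.pi = Real.pi by ring]; exact hmem b
    · rw [show -Real.pi + 2 * Real.pi = Real.pi by ring]; exact hmem a
  · intro k
    change _ * _ = _
    rw [Complex.star_def, Complex.mul_conj', Complex.norm_exp_ofReal_mul_I]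
    simp

/-- The identity on `z` and multiplication by `c` on the orthogonal complement of `z`. -/
noncomputable def phaseMat (z : Fin n → ℂ) (c : ℂ) : Mat n :=
  c • 1 + ((1 - c) * (star z ⬝ᵥ z)⁻¹) • outer z z

theorem phaseMat_mulVec {z : Fin n → ℂ} (hz : z ≠ 0) (c : ℂ) : phaseMat z c *ᵥ z = z := by
  rw [phaseMat, Matrix.add_mulVec, Matrix.smul_mulVec, Matrix.smul_mulVec, outer_mulVec,
    Matrix.one_mulVec, smul_smul, mul_assoc, inv_mul_cancel₀ (star_dot_self_ne_zero hz)]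
  module

theorem phaseMat_one (z : Fin n → ℂ) : phaseMat z 1 = 1 := by simp [phaseMat]

theorem phaseMat_unitary {z : Fin n → ℂ} (hz : z ≠ 0) {c : ℂ} (hc : c * star c = 1) :
    (phaseMat z c)ᴴ * phaseMat z c = 1 := by
  have h0 := star_dot_self_ne_zero hz
  have hs : star (star z ⬝ᵥ z) = star z ⬝ᵥ z := star_dot_comm z z
  have hoo : outer z z * outer z z = (star z ⬝ᵥ z) • outer z z := by
    rw [mul_outer, outer_mulVec, outer_smul_left]
  rw [phaseMat, Matrix.conjTranspose_add, Matrix.conjTranspose_smul, Matrix.conjTranspose_smul,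
    outer_conjTranspose, Matrix.conjTranspose_one, add_mul, mul_add, mul_add, smul_mul_smul_comm,
    smul_mul_smul_comm, smul_mul_smul_comm, smul_mul_smul_comm, hoo, one_mul, one_mul, mul_one, star_mul',
    star_inv₀, hs, mul_comm (star c) c, hc,
    one_smul, smul_smul, add_assoc, ← add_smul, ← add_smul, add_eq_left]
  convert zero_smul ℂ (outer z z)
  rw [star_sub, star_one]
  field_simp
  linear_combination -hc

/-- The determinant is `det (cA + B)`, a polynomial in `c`. It is nonzero at `c = 0`, where `B` is
the identity plus a projection, so it cannot vanish on the infinite unit circle. -/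
theorem exists_phase {W : Mat n} {z : Fin n → ℂ} (hz : z ≠ 0) (hW : W *ᵥ z = z) :
    ∃ c : ℂ, c * star c = 1 ∧ (W * phaseMat z c + 1).det ≠ 0 := by
  set r := star z ⬝ᵥ z with hr
  have hr0 : r ≠ 0 := star_dot_self_ne_zero hz
  set B : Mat n := r⁻¹ • outer z z + 1 with hB
  set A : Mat n := W - r⁻¹ • outer z z with hA
  have hAB : ∀ c : ℂ, W * phaseMat z c + 1 = c • A + B := fun c => by
    rw [phaseMat, Matrix.mul_add, Matrix.mul_smul, Matrix.mul_smul, mul_outer, hW, Matrix.mul_one,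
      hA, hB]
    module
  set P : Polynomial ℂ := 
    (Matrix.of fun i j => Polynomial.X * Polynomial.C (A i j) + Polynomial.C (B i j)).det with hP
  have hPe : ∀ c, P.eval c = (c • A + B).det := fun c => by
    rw [hP, ← Polynomial.coe_evalRingHom, RingHom.map_det]
    congr 1
    ext i j
    rw [RingHom.mapMatrix_apply, Matrix.map_apply, Matrix.of_apply, Polynomial.coe_evalRingHom,
      Polynomial.eval_add, Polynomial.eval_mul, Polynomial.eval_X, Polynomial.eval_C,
      Polynomial.eval_C]
    rfl
  have hP0 : P ≠ 0 := by
    intro h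
    have h1 := hPe 0
    rw [h, Polynomial.eval_zero, zero_smul, zero_add] at h1
    have h2 : (1 - (1 / 2 * r⁻¹) • outer z z) * B = 1 := by
      rw [hB, sub_mul, one_mul, mul_add, mul_one, smul_mul_smul_comm, mul_outer, outer_mulVec,
        outer_smul_left, ← hr, smul_smul,
        show 1 / 2 * r⁻¹ * r⁻¹ * r = 1 / 2 * r⁻¹ by field_simp]
      module
    exact (Matrix.isUnit_det_of_left_inverse h2).ne_zero h1.symm
  by_contra! hcon
  refine hP0 (Polynomial.eq_zero_of_infinite_isRoot P (infinite_unit_circle.mono fun c hc => ?_))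
  change P.eval c = 0
  rw [hPe, ← hAB, hcon c hc]

/-- Equal values mean equal `ρ` and `Zz = Z'z`, so `W = Z^+ Z'` fixes `z`. A Cayley curve leads from
`Z` to `Z'` times a phase on the complement of `z`, and rotating that phase leads back to `Z'`; both
curves keep the value at `z`. -/
theorem cls_eq_of_J0_eq (hn : 0 < n) {p q : Mat n × Mat n} (hp : p ∈ O10 n) (hq : q ∈ O10 n)
    (h : J0 p = J0 q) : cls gamma0 (O10 n) p hp = cls gamma0 (O10 n) q hq := by
  obtain ⟨Z, ρ⟩ := p
  obtain ⟨Z', ρ'⟩ := q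
  obtain ⟨hZ, z, hz, hρ⟩ := (mem_O10_iff hn).1 hp
  obtain ⟨hZ', -⟩ := (mem_O10_iff hn).1 hq
  obtain ⟨-, h1, -, h2⟩ := Matrix.fromBlocks_inj.1 h
  simp only at hZ hZ' hρ h1 h2
  subst h2 hρ
  have hzz : Z *ᵥ z = Z' *ᵥ z := by
    have h3 := congrArg (fun M => M *ᵥ z) h1
    simp only [← Matrix.mulVec_mulVec, Matrix.smul_mulVec, outer_mulVec, Matrix.mulVec_smul,
      smul_smul] at h3
    exact smul_right_injective _ (mul_ne_zero Complex.I_ne_zero (star_dot_self_ne_zero hz)) h3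
  set W := Zᴴ * Z' with hW
  have hZZ : Z * Zᴴ = 1 := mul_eq_one_comm.1 hZ
  have hZW : Z * W = Z' := by rw [hW, ← Matrix.mul_assoc, hZZ, Matrix.one_mul]
  have hWz : W *ᵥ z = z := by
    rw [hW, ← Matrix.mulVec_mulVec, ← hzz, Matrix.mulVec_mulVec, hZ, Matrix.one_mulVec]
  obtain ⟨c, hc, hdet⟩ := exists_phase hz hWz
  have hprod : ∀ {A B : Mat n}, Aᴴ * A = 1 → Bᴴ * B = 1 → (A * B)ᴴ * (A * B) = 1 :=
    fun {A B} hA hB => by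
      rw [Matrix.conjTranspose_mul, Matrix.mul_assoc, ← Matrix.mul_assoc Aᴴ, hA, Matrix.one_mul, hB]
  have hWu : Wᴴ * W = 1 := hprod (by rw [Matrix.conjTranspose_conjTranspose, hZZ]) hZ'
  obtain ⟨K, hK, hKz, hKV⟩ := exists_cayleyCurve_eq
    (hprod hWu (phaseMat_unitary hz hc)) hdet
    (z := z) (by rw [← Matrix.mulVec_mulVec, phaseMat_mulVec hz, hWz])
  have hmid : (Z' * phaseMat z c, Complex.I • outer z z) ∈ O10 n :=
    (mem_O10_iff hn).2 ⟨hprod hZ' (phaseMat_unitary hz hc), z, hz, rfl⟩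
  have step1 : cls gamma0 (O10 n) _ hp = cls gamma0 (O10 n) _ hmid := by
    have e0 : Z * cayleyCurve K 0 = Z := by rw [cayleyCurve_zero, Matrix.mul_one]
    have e1 : Z * cayleyCurve K 1 = Z' * phaseMat z c := by
      rw [hKV, ← Matrix.mul_assoc, hZW]
    have := cls_eq_of_unitary_curve hn (Z := fun t => Z * cayleyCurve K t) hz
      (contDiff_mul contDiff_const (contDiff_cayleyCurve hK))
      (fun t => hprod hZ (cayleyCurve_unitary hK t))
      (fun t => by
        rw [← Matrix.mulVec_mulVec, ← Matrix.mulVec_mulVec, cayleyCurve_mulVec hK hKz,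
          cayleyCurve_mulVec hK hKz]) (by simpa only [e0] using hp) (by simpa only [e1] using hmid)
    simpa only [e0, e1] using this
  have step2 : cls gamma0 (O10 n) _ hq = cls gamma0 (O10 n) _ hmid := by
    obtain ⟨a, rfl⟩ := (Complex.norm_eq_one_iff c).1 (by
      rw [Complex.star_def, Complex.mul_conj'] at hc
      have : ‖c‖ ^ 2 = 1 := by exact_mod_cast hc
      exact (pow_eq_one_iff_of_nonneg (norm_nonneg c) two_ne_zero).1 this)
    have e0 : Z' * phaseMat z (Complex.exp ((0 : ℝ) * a * Complex.I)) = Z' := by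
      simp [phaseMat_one]
    have e1 : Z' * phaseMat z (Complex.exp ((1 : ℝ) * a * Complex.I)) =
        Z' * phaseMat z (Complex.exp (a * Complex.I)) := by simp
    have hexp : ContDiff ℝ ∞ fun t : ℝ => Complex.exp (t * a * Complex.I) :=
      ((contDiff_ofReal.mul contDiff_const).mul contDiff_const).cexp
    have hph : ContDiff ℝ ∞ fun t : ℝ => phaseMat z (Complex.exp (t * a * Complex.I)) := by
      refine contDiff_matrix.2 fun i j => ?_
      exact (hexp.mul contDiff_const).add
        (((contDiff_const.sub hexp).mul contDiff_const).mul contDiff_const)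
    have := cls_eq_of_unitary_curve hn
      (Z := fun t => Z' * phaseMat z (Complex.exp (t * a * Complex.I))) hz
      (contDiff_mul contDiff_const hph)
      (fun t => hprod hZ' (phaseMat_unitary hz (by
        rw [Complex.star_def, Complex.mul_conj', ← Complex.ofReal_mul,
          Complex.norm_exp_ofReal_mul_I]
        simp)))
      (fun t => by
        rw [← Matrix.mulVec_mulVec, ← Matrix.mulVec_mulVec, phaseMat_mulVec hz,
          phaseMat_mulVec hz]) (by simpa only [e0] using hq) (by simpa only [e1] using hmid)
    simpa only [e0, e1] using this
  rw [step1, step2]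

theorem cls_eq_iff_J0 (hn : 0 < n) {p q : Mat n × Mat n} {hp : p ∈ O10 n} {hq : q ∈ O10 n} :
    cls gamma0 (O10 n) p hp = cls gamma0 (O10 n) q hq ↔ J0 p = J0 q :=
  ⟨J0_eq_of_cls_eq hn, cls_eq_of_J0_eq hn hp hq⟩

/-! ## The induced maps of reduced spaces -/

section Lift

variable {V W : Type*} [NormedAddCommGroup V] [NormedSpace ℝ V]
  {θ : V → V → ℂ} {M : Set V} {S : Set W}

/-- The map of the reduced space induced by a map that is constant on leaves. -/
def reducedLift (J : V → W) (hJ : ∀ p ∈ M, J p ∈ S)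
    (h : ∀ p q (hp : p ∈ M) (hq : q ∈ M), cls θ M p hp = cls θ M q hq → J p = J q) :
    Reduced θ M → S :=
  Quotient.lift (fun p : M => (⟨J p, hJ p p.2⟩ : S)) fun p q hpq =>
    Subtype.ext (h p q p.2 q.2 (Quotient.sound hpq))

/-- The bijection of the reduced space induced by a map that separates leaves. -/
noncomputable def reducedEquiv (J : V → W) (hJ : ∀ p ∈ M, J p ∈ S)
    (h : ∀ p q (hp : p ∈ M) (hq : q ∈ M), cls θ M p hp = cls θ M q hq ↔ J p = J q)
    (hS : ∀ s ∈ S, ∃ p ∈ M, J p = s) : Reduced θ M ≃ S :=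
  Equiv.ofBijective (reducedLift J hJ fun p q hp hq => (h p q hp hq).1) <| by
    constructor
    · intro x y hxy
      obtain ⟨p, hp, rfl⟩ := exists_cls x
      obtain ⟨q, hq, rfl⟩ := exists_cls y
      exact (h p q hp hq).2 (congrArg Subtype.val hxy)
    · rintro ⟨s, hs⟩
      obtain ⟨p, hp, rfl⟩ := hS s hs
      exact ⟨cls θ M p hp, rfl⟩

end Lift

/-- `T^*_𝒞/∼`. -/
noncomputable def reducedTC (hn : 0 < n) : RedO10t n → RedO10 n :=
  Quotient.lift (fun p : O10t n => cls gamma0 (O10 n) (TC p) (TC_mem_O10 hn p.2))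
    fun p q hpq => (cls_eq_iff_J0 hn).2 <| by
      rw [J0_TC p.2, J0_TC q.2,
        J0t_eq_of_cls_eq (p := p.1) (q := q.1) (hp := p.2) (hq := q.2) (Quotient.sound hpq)]

/-- `𝒞/∼`. -/
noncomputable def reducedC (n : ℕ) : RedT0t n ≃ RedT0 n where
  toFun := Quotient.lift (fun w : T0t n =>
    cls gammaPM (T0 n) (cMat n *ᵥ w) (cMat_mem_T0_iff.2 w.2)) fun p q hpq =>
      cls_cMat_eq (hp := p.2) (hq := q.2) (Quotient.sound hpq)
  invFun := Quotient.lift (fun v : T0 n =>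
    cls gammaPMt (T0t n) ((cMat n)ᴴ *ᵥ v) (cMat_conjTranspose_mem_T0t_iff.2 v.2)) fun p q hpq =>
      cls_cMat_conjTranspose_eq (hp := p.2) (hq := q.2) (Quotient.sound hpq)
  left_inv := cls_induction fun p hp => by
    change cls gammaPMt (T0t n) ((cMat n)ᴴ *ᵥ (cMat n *ᵥ p)) _ = cls _ _ p hp
    simp only [cMat_conjTranspose_mulVec]
  right_inv := cls_induction fun p hp => by
    change cls gammaPM (T0 n) (cMat n *ᵥ ((cMat n)ᴴ *ᵥ p)) _ = cls _ _ p hp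
    simp only [cMat_mulVec_conjTranspose]

/-- The maps of reduced spaces induced by the momentum maps and the Cayley transforms. -/
noncomputable def reducedMaps (hn : 0 < n) : ReducedMaps n where
  j0t := reducedLift J0t (fun _ hp => J0t_mem_N10t hn hp) fun _ _ _ _ => cls_eq_iff_J0t.1
  jPMt := reducedEquiv JPMt (fun _ hw => (mem_N10t_iff hn).2 ⟨_, hw, rfl⟩)
    (fun _ _ _ _ => cls_eq_iff_JPMt) fun _ hs => by
      obtain ⟨w, hw, rfl⟩ := (mem_N10t_iff hn).1 hs
      exact ⟨w, hw, rfl⟩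
  j0 := reducedEquiv J0 (fun _ hp => J0_mem_N10 hn hp) (fun _ _ _ _ => cls_eq_iff_J0 hn)
    fun _ hs => exists_J0_eq hn hs
  jPM := reducedEquiv JPM (fun _ hw => (mem_N10_iff hn).2 ⟨_, hw, rfl⟩)
    (fun _ _ _ _ => cls_eq_iff_JPM) fun _ hs => by
      obtain ⟨w, hw, rfl⟩ := (mem_N10_iff hn).1 hs
      exact ⟨w, hw, rfl⟩
  tC := reducedTC hn
  c := reducedC n
  j0t_cls _ _ := rfl
  jPMt_cls _ _ := rfl
  j0_cls _ _ := rfl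
  jPM_cls _ _ := rfl
  tC_cls _ hp := ⟨TC_mem_O10 hn hp, rfl⟩
  c_cls _ hw := ⟨cMat_mem_T0_iff.2 hw, rfl⟩

namespace ReducedMaps

variable (D : ReducedMaps n)

/-- The leaf-level definition becomes a matrix equation; later statements about `kReg` are checked
through it. -/
theorem kReg_eq_iff {p : Mat n × Mat n} {hp : p ∈ O10t n} {w : Twistor n} {hw : w ∈ T0t n} :
    D.kReg (cls _ _ p hp) = cls _ _ w hw ↔ J0t p = JPMt w := by
  rw [kReg, Function.comp_apply, Equiv.symm_apply_eq, Subtype.ext_iff, D.j0t_cls, D.jPMt_cls]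

theorem cReg_eq_iff {p : Mat n × Mat n} {hp : p ∈ O10t n} {v : Twistor n} {hv : v ∈ T0 n} :
    D.cReg (cls _ _ p hp) = cls _ _ v hv ↔ J0 (TC p) = JPM v := by
  obtain ⟨h, h'⟩ := D.tC_cls p hp
  rw [cReg, Function.comp_apply, Function.comp_apply, h', Equiv.symm_apply_eq, Subtype.ext_iff,
    D.j0_cls, D.jPM_cls]

theorem c_apply {w : Twistor n} (hw : w ∈ T0t n) :
    D.c (cls _ _ w hw) = cls _ _ (cMat n *ᵥ w) (cMat_mem_T0_iff.2 hw) :=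
  (D.c_cls w hw).choose_spec

theorem c_symm_apply {v : Twistor n} (hv : v ∈ T0 n) :
    D.c.symm (cls _ _ v hv) =
      cls _ _ ((cMat n)ᴴ *ᵥ v) (cMat_conjTranspose_mem_T0t_iff.2 hv) := by
  rw [Equiv.symm_apply_eq, c_apply]
  simp only [cMat_mulVec_conjTranspose]

theorem kReg_cls_outer {Y : Mat n} (hY : Y.IsHermitian) {z : Fin n → ℂ} (hz : z ≠ 0)
    (h : (Y, outer z z) ∈ O10t n) :
    D.kReg (cls _ _ (Y, outer z z) h) =
      cls _ _ (Sum.elim (Y *ᵥ z) z) (sumElim_mem_T0t hY hz) :=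
  D.kReg_eq_iff.2 (J0t_eq_JPMt hY z)

theorem exists_kReg_eq {p : Mat n × Mat n} (hp : p ∈ O10t n) :
    ∃ (w : Twistor n) (hw : w ∈ T0t n), sndC w ≠ 0 ∧ D.kReg (cls _ _ p hp) = cls _ _ w hw := by
  obtain ⟨Y, X⟩ := p
  obtain ⟨hY, z, hz, hX⟩ := mem_O10t_iff.1 hp
  simp only at hX hY
  subst hX
  exact ⟨_, sumElim_mem_T0t hY hz, hz, D.kReg_cls_outer hY hz hp⟩

theorem cReg_eq : D.cReg = D.c ∘ D.kReg := by
  funext q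
  obtain ⟨p, hp, rfl⟩ := exists_cls q
  obtain ⟨w, hw, -, h⟩ := D.exists_kReg_eq hp
  rw [Function.comp_apply, h, c_apply, D.cReg_eq_iff, J0_TC hp, JPM_cMat, D.kReg_eq_iff.1 h]

theorem kReg_injective : Function.Injective D.kReg := by
  intro x y h
  obtain ⟨p, hp, rfl⟩ := exists_cls x
  obtain ⟨q, hq, rfl⟩ := exists_cls y
  obtain ⟨w, hw, -, h1⟩ := D.exists_kReg_eq hp
  rw [h1] at h
  exact cls_eq_iff_J0t.2 ((D.kReg_eq_iff.1 h1).trans (D.kReg_eq_iff.1 h.symm).symm)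

theorem cReg_injective : Function.Injective D.cReg := by
  rw [cReg_eq]
  exact D.c.injective.comp D.kReg_injective

theorem isHamiltonianMap_c :
    IsHamiltonianMap gammaPMt (T0t n) IPP gammaPM (T0 n) IPP D.c := by
  constructor
  · refine fun p _ => ⟨univ, isOpen_univ, mem_univ p, mulVecCLM (cMat n),
      (mulVecCLM (cMat n)).contDiff.contDiffOn, fun q _ hq => ⟨_, D.c_apply hq⟩, ?_⟩
    intro q _ _ u _ w _
    rw [ContinuousLinearMap.fderiv]
    exact extD_gammaPM_cMat q u w
  · intro p hp q hq h
    rw [D.c_apply, cls_eq_iff_JPM] at h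
    rw [← IPP_cMat p, IPP_eq_of_outer2_eq (outer2_eq_of_JPM_eq h)]

theorem isHamiltonianMap_c_symm :
    IsHamiltonianMap gammaPM (T0 n) IPP gammaPMt (T0t n) IPP D.c.symm := by
  constructor
  · refine fun p _ => ⟨univ, isOpen_univ, mem_univ p, mulVecCLM (cMat n)ᴴ,
      (mulVecCLM (cMat n)ᴴ).contDiff.contDiffOn, fun q _ hq => ⟨_, D.c_symm_apply hq⟩, ?_⟩
    intro q _ _ u _ w _
    rw [ContinuousLinearMap.fderiv]
    exact extD_gammaPMt_cMat q u w
  · intro p hp q hq h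
    rw [Equiv.symm_apply_eq] at h
    exact (D.isHamiltonianMap_c.2 q hq p hp h.symm).symm

end ReducedMaps

/-! ## The local lift of the regularization -/

theorem hasDerivAt_fstC {w : ℝ → Twistor n} {w' : Twistor n} {t : ℝ} (h : HasDerivAt w w' t) :
    HasDerivAt (fun s => fstC (w s)) (fstC w') t :=
  hasDerivAt_pi.2 fun i => hasDerivAt_pi.1 h (Sum.inl i)

theorem hasDerivAt_sndC {w : ℝ → Twistor n} {w' : Twistor n} {t : ℝ} (h : HasDerivAt w w' t) :
    HasDerivAt (fun s => sndC (w s)) (sndC w') t :=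
  hasDerivAt_pi.2 fun i => hasDerivAt_pi.1 h (Sum.inr i)

/-- The derivative of a curve of the form `υ = Y ζ`. -/
theorem fstC_deriv_eq {w : ℝ → Twistor n} {w' : Twistor n} {Y : ℝ → Mat n} {a : Mat n}
    (hw : HasDerivAt w w' 0) (hY : HasDerivAt Y a 0)
    (h : ∀ᶠ t in 𝓝 (0 : ℝ), fstC (w t) = Y t *ᵥ sndC (w t)) :
    fstC w' = a *ᵥ sndC (w 0) + Y 0 *ᵥ sndC w' :=
  ((hasDerivAt_fstC hw).congr_of_eventuallyEq (h.mono fun _ ht => ht.symm)).unique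
    (hasDerivAt_mulVec hY (hasDerivAt_sndC hw)) |>.symm ▸ rfl

theorem hasDerivAt_outer_sndC {w : ℝ → Twistor n} {w' : Twistor n} (hw : HasDerivAt w w' 0) :
    HasDerivAt (fun t => outer (sndC (w t)) (sndC (w t)))
      (outer (sndC w') (sndC (w 0)) + outer (sndC (w 0)) (sndC w')) 0 :=
  hasDerivAt_vecMulVec (hasDerivAt_sndC hw) (hasDerivAt_star (hasDerivAt_sndC hw))

/-- The symplectic form in the coordinates `(Y, ζ)`, `υ = Y ζ`. -/
theorem gammaPMt_sub_eq_trace {Y a a' : Mat n} {z : Fin n → ℂ} {w w' : Twistor n}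
    (hY : Y.IsHermitian) (ha : a.IsHermitian) (ha' : a'.IsHermitian)
    (hw : fstC w = a *ᵥ z + Y *ᵥ sndC w) (hw' : fstC w' = a' *ᵥ z + Y *ᵥ sndC w') :
    gammaPMt w w' - gammaPMt w' w =
      ((outer (sndC w') z + outer z (sndC w')) * a).trace -
        ((outer (sndC w) z + outer z (sndC w)) * a').trace := by
  simp only [gammaPMt, hw, hw', Matrix.add_mul, outer_mul, ha.eq, ha'.eq, Matrix.trace_add,
    trace_outer, star_add, add_dotProduct, dotProduct_add, star_dot_mulVec, hY.eq]
  ring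

/-- The local lift `(Y, X) ↦ (Y ζ, ζ)`, `ζ = (z^+ X z)^{-1/2} X z`. -/
noncomputable def kLift (z : Fin n → ℂ) (p : Mat n × Mat n) : Twistor n :=
  let ζ := ((((Real.sqrt (star z ⬝ᵥ (p.2 *ᵥ z)).re)⁻¹ : ℝ)) : ℂ) • (p.2 *ᵥ z)
  Sum.elim (p.1 *ᵥ ζ) ζ

theorem contDiffOn_kLift (z : Fin n → ℂ) :
    ContDiffOn ℝ ∞ (kLift z) {p | 0 < (star z ⬝ᵥ (p.2 *ᵥ z)).re} := by
  intro p hp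
  have hp : 0 < (star z ⬝ᵥ (p.2 *ᵥ z)).re := hp
  refine ContDiffAt.contDiffWithinAt ?_
  have hX : ∀ i j, ContDiff ℝ ∞ fun p : Mat n × Mat n => p.2 i j :=
    contDiff_matrix.1 contDiff_snd
  have hY : ∀ i j, ContDiff ℝ ∞ fun p : Mat n × Mat n => p.1 i j :=
    contDiff_matrix.1 contDiff_fst
  have hXz : ∀ i, ContDiff ℝ ∞ fun p : Mat n × Mat n => (p.2 *ᵥ z) i := fun i => by
    simp only [Matrix.mulVec, dotProduct]
    exact ContDiff.sum fun j _ => (hX i j).mul contDiff_const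
  have hzXz : ContDiff ℝ ∞ fun p : Mat n × Mat n => (star z ⬝ᵥ (p.2 *ᵥ z)).re := by
    refine contDiff_re.comp ?_
    simp only [dotProduct]
    exact ContDiff.sum fun j _ => contDiff_const.mul (hXz j)
  have hζ : ∀ i, ContDiffAt ℝ ∞ (fun p : Mat n × Mat n =>
      ((((Real.sqrt (star z ⬝ᵥ (p.2 *ᵥ z)).re)⁻¹ : ℝ) : ℂ) • (p.2 *ᵥ z)) i) p := fun i => by
    refine ContDiffAt.mul ?_ (hXz i).contDiffAt
    exact contDiff_ofReal.contDiffAt.comp p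
      ((hzXz.contDiffAt.sqrt hp.ne').inv (Real.sqrt_pos.2 hp).ne')
  refine contDiffAt_pi.2 ?_
  rintro (i | i)
  · change ContDiffAt ℝ ∞ (fun p : Mat n × Mat n => (p.1 *ᵥ _) i) p
    simp only [Matrix.mulVec, dotProduct]
    exact ContDiffAt.sum fun j _ => (hY i j).contDiffAt.mul (hζ j)
  · exact hζ i

/-- If `X = y y^+` and `a = y^+ z`, the lift is `ζ = (a/|a|) y`: the phase of `y` is normalised so
that `z^+ ζ > 0`, which depends smoothly on `X`. -/
theorem outer_sndC_kLift {z : Fin n → ℂ} {p : Mat n × Mat n}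
    (hp : p ∈ O10t n) (h : 0 < (star z ⬝ᵥ (p.2 *ᵥ z)).re) :
    sndC (kLift z p) ≠ 0 ∧ outer (sndC (kLift z p)) (sndC (kLift z p)) = p.2 := by
  obtain ⟨-, y, hy, hX⟩ := mem_O10t_iff.1 hp
  set a := star y ⬝ᵥ z with ha
  have h1 : p.2 *ᵥ z = a • y := by rw [hX, outer_mulVec]
  have h2 : (star z ⬝ᵥ (p.2 *ᵥ z)).re = ‖a‖ ^ 2 := by
    rw [h1, dotProduct_smul, ← star_dot_comm, ← ha, smul_eq_mul, Complex.star_def,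
      Complex.mul_conj']
    norm_cast
  have h3 : sndC (kLift z p) = (((‖a‖⁻¹ : ℝ) : ℂ) * a) • y := by
    rw [kLift, sndC_sumElim, h2, Real.sqrt_sq (norm_nonneg a), h1, smul_smul]
  have h4 : ‖a‖ ≠ 0 := by
    intro h0
    rw [h2, h0] at h
    norm_num at h
  have h5 : (((‖a‖⁻¹ : ℝ) : ℂ) * a) * star (((‖a‖⁻¹ : ℝ) : ℂ) * a) = 1 := by
    rw [Complex.star_def, Complex.mul_conj', norm_mul, Complex.norm_real, norm_inv, norm_norm,
      inv_mul_cancel₀ h4]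
    norm_num
  have h6 : outer (sndC (kLift z p)) (sndC (kLift z p)) = p.2 := by
    rw [h3, outer_smul_smul, h5, one_smul, hX]
  refine ⟨fun h0 => hy ?_, h6⟩
  rw [h0, hX] at h6
  exact outer_eq_zero.1 (by rw [← h6]; simp [outer])

namespace ReducedMaps

variable (D : ReducedMaps n)

theorem isSymplecticMap_kReg :
    IsSymplecticMap gamma0t (O10t n) gammaPMt (T0t n) D.kReg := by
  intro p hp
  obtain ⟨-, z, hz, hX⟩ := mem_O10t_iff.1 hp
  set U : Set (Mat n × Mat n) := {p | 0 < (star z ⬝ᵥ (p.2 *ᵥ z)).re} with hU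
  have hUo : IsOpen U := by
    refine isOpen_lt continuous_const (Complex.continuous_re.comp ?_)
    exact continuous_const.dotProduct (continuous_snd.matrix_mulVec continuous_const)
  have hpU : p ∈ U := by
    change 0 < (star z ⬝ᵥ (p.2 *ᵥ z)).re
    rw [hX, outer_mulVec, dotProduct_smul]
    have h := star_dot_self_pos hz
    exact (Complex.pos_iff.1 (mul_pos h h)).1
  have hsm := contDiffOn_kLift z
  refine ⟨U, hUo, hpU, kLift z, hsm, ?_, ?_⟩
  · intro q hqU hq
    obtain ⟨h1, h2⟩ := outer_sndC_kLift hq hqU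
    have h3 : kLift z q = Sum.elim (q.1 *ᵥ sndC (kLift z q)) (sndC (kLift z q)) := rfl
    refine ⟨by rw [h3]; exact sumElim_mem_T0t hq.1 h1, ?_⟩
    rw [D.kReg_eq_iff, h3, ← J0t_eq_JPMt hq.1, h2]
  · intro q hqU hq u hu w hw
    have hdf := ((hsm.contDiffAt (hUo.mem_nhds hqU)).differentiableAt (by simp)).hasFDerivAt
    -- The derivative of the lift is never computed. Differentiating `υ = Yζ` and `ζ ζ^+ = X` along
    -- a curve gives all that the symplectic identity needs.
    have key : ∀ u ∈ tangentVecs (O10t n) q,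
        fstC (fderiv ℝ (kLift z) q u) = u.1 *ᵥ sndC (kLift z q) +
          q.1 *ᵥ sndC (fderiv ℝ (kLift z) q u) ∧
        outer (sndC (fderiv ℝ (kLift z) q u)) (sndC (kLift z q)) +
          outer (sndC (kLift z q)) (sndC (fderiv ℝ (kLift z) q u)) = u.2 := by
      intro u hu
      obtain ⟨c, rfl, hd, hcM, -⟩ := mem_tangentVecs_iff.1 hu
      have hw := hdf.comp_hasDerivAt (0 : ℝ) hd
      have hcU : ∀ᶠ t in 𝓝 (0 : ℝ), c t ∈ U := hd.continuousAt (hUo.mem_nhds hqU)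
      refine ⟨fstC_deriv_eq hw (hasDerivAt_fst hd) (.of_forall fun t => rfl), ?_⟩
      refine (hasDerivAt_outer_sndC hw).unique ((hasDerivAt_snd hd).congr_of_eventuallyEq ?_)
      filter_upwards [hcM, hcU] with t h1 h2 using (outer_sndC_kLift h1 h2).2
    obtain ⟨hu1, hu2⟩ := key u hu
    obtain ⟨hw1, hw2⟩ := key w hw
    have h := gammaPMt_sub_eq_trace hq.1 (tangentVecs_O10t hu).1 (tangentVecs_O10t hw).1 hu1 hw1
    rw [hu2, hw2] at h
    rw [extD_gammaPMt, extD_gamma0t, ← h]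
    rfl

/-- Both Hamiltonians are the trace of the lower left block minus the trace of the upper right block
of the momentum matrix. -/
theorem I0t_eq_of_J0t_eq {p : Mat n × Mat n} {w : Twistor n} (h : J0t p = JPMt w) :
    IPP w = I0t p := by
  obtain ⟨-, h1, h2, -⟩ := Matrix.fromBlocks_inj.1 h
  rw [IPP, I0t, Matrix.mul_add, Matrix.mul_one, Matrix.trace_add, ← Matrix.mul_assoc,
    Matrix.trace_mul_comm, ← Matrix.mul_assoc, neg_inj.1 h1, h2, trace_outer, trace_outer, add_comm]

theorem isHamiltonianMap_kReg :
    IsHamiltonianMap gamma0t (O10t n) I0t gammaPMt (T0t n) IPP D.kReg :=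
  ⟨D.isSymplecticMap_kReg, fun _ _ _ _ h => I0t_eq_of_J0t_eq (D.kReg_eq_iff.1 h)⟩

theorem isHamiltonianMap_cReg :
    IsHamiltonianMap gamma0t (O10t n) I0t gammaPM (T0 n) IPP D.cReg := by
  rw [cReg_eq]
  exact D.isHamiltonianMap_c.comp D.isHamiltonianMap_kReg

end ReducedMaps

/-! ## The generalized Kustaanheimo–Stiefel transformation -/

theorem form_eq_of_mem_T0t {w : Twistor n} (hw : w ∈ T0t n) :
    star (sndC w) ⬝ᵥ fstC w = star (fstC w) ⬝ᵥ sndC w :=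
  sub_eq_zero.1 ((mul_eq_zero.1 hw.2).resolve_left Complex.I_ne_zero)

theorem ksSection_isHermitian (w : Twistor n) : (ksSection w).1.IsHermitian := by
  rw [ksSection, Matrix.IsHermitian]
  simp only [Matrix.conjTranspose_smul, Matrix.conjTranspose_sub, Matrix.conjTranspose_add,
    outer_conjTranspose, Matrix.conjTranspose_one, star_inv₀, star_dot_comm, star_mul', star_add]
  rw [add_comm (outer (fstC w) (sndC w)), add_comm (star (sndC w) ⬝ᵥ fstC w)]
  norm_num

/-- On the null cone `ζ^+ υ = υ^+ ζ`, so the scalar term cancels `ζ (υ^+ ζ)` exactly and only `υ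
(ζ^+ ζ)` remains. -/
theorem ksSection_mulVec {w : Twistor n} (hw : w ∈ T0t n) (hz : sndC w ≠ 0) :
    (ksSection w).1 *ᵥ sndC w = fstC w := by
  have h := form_eq_of_mem_T0t hw
  rw [ksSection]
  simp only [Matrix.smul_mulVec, Matrix.sub_mulVec, Matrix.add_mulVec, outer_mulVec,
    Matrix.one_mulVec, h]
  rw [show (1 / 2 : ℂ) * (star (fstC w) ⬝ᵥ sndC w + star (fstC w) ⬝ᵥ sndC w) =
    star (fstC w) ⬝ᵥ sndC w by ring, add_sub_cancel_left, smul_smul,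
    inv_mul_cancel₀ (star_dot_self_ne_zero hz), one_smul]

theorem ksSection_mem_O10t {w : Twistor n} (hz : sndC w ≠ 0) :
    ksSection w ∈ O10t n :=
  mem_O10t_iff.2 ⟨ksSection_isHermitian w, _, hz, rfl⟩

namespace ReducedMaps

variable (D : ReducedMaps n)

theorem kReg_ksSection {w : Twistor n} (hw : w ∈ T0t n) (hz : sndC w ≠ 0) :
    D.kReg (cls _ _ (ksSection w) (ksSection_mem_O10t hz)) = cls _ _ w hw := by
  rw [D.kReg_eq_iff]
  have h1 : ksSection w = ((ksSection w).1, outer (sndC w) (sndC w)) := rfl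
  rw [h1, J0t_eq_JPMt (ksSection_isHermitian w), ksSection_mulVec hw hz, sumElim_fstC_sndC]

theorem range_kReg : Set.range D.kReg = dotRedT0t n := by
  ext q
  constructor
  · rintro ⟨x, rfl⟩
    obtain ⟨p, hp, rfl⟩ := exists_cls x
    obtain ⟨w, hw, hz, h⟩ := D.exists_kReg_eq hp
    exact ⟨w, hw, hz, h⟩
  · rintro ⟨w, hw, hz, rfl⟩
    exact ⟨_, D.kReg_ksSection hw hz⟩

end ReducedMaps

/-! ## The classical Kustaanheimo–Stiefel transformation -/

theorem pauli_isHermitian (k : Fin 3) : (pauli k).IsHermitian := by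
  fin_cases k <;> ext i j <;> fin_cases i <;> fin_cases j <;> simp [pauli]

theorem pauliVec_eq (y : E3) :
    pauliVec y = !![(y 2 : ℂ), y 0 + y 1 * Complex.I; y 0 - y 1 * Complex.I, -y 2] := by
  ext i j
  fin_cases i <;> fin_cases j <;>
    simp [pauliVec, Fin.sum_univ_three, pauli, Matrix.add_apply, sub_eq_add_neg]

theorem pauliVec_isHermitian (y : E3) : (pauliVec y).IsHermitian := by
  rw [Matrix.IsHermitian, pauliVec, Matrix.conjTranspose_sum]
  refine Finset.sum_congr rfl fun k _ => ?_
  rw [Matrix.conjTranspose_smul, (pauli_isHermitian k).eq, Complex.star_def, Complex.conj_ofReal]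

theorem norm_sq_E3 (y : E3) :
    ((‖y‖ : ℝ) : ℂ) ^ 2 = (y 0 : ℂ) ^ 2 + (y 1 : ℂ) ^ 2 + (y 2 : ℂ) ^ 2 := by
  have := EuclideanSpace.real_norm_sq_eq y
  rw [Fin.sum_univ_three] at this
  exact_mod_cast this

theorem pauliVec_mul_self (y : E3) :
    pauliVec y * pauliVec y = ((‖y‖ : ℝ) : ℂ) ^ 2 • (1 : Mat 2) := by
  rw [norm_sq_E3, pauliVec_eq]
  ext i j
  fin_cases i <;> fin_cases j <;> simp [Matrix.mul_apply, Fin.sum_univ_two] <;>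
    first | ring1 | linear_combination -(y 1 : ℂ) ^ 2 * Complex.I_sq

/-- This recovers the coordinate `y_k` from `υ = (y · σ) ζ` in `ksMap_sumElim`. -/
theorem pauliVec_anticommutator (y : E3) (k : Fin 3) :
    pauliVec y * pauli k + pauli k * pauliVec y = (2 * (y k : ℂ)) • (1 : Mat 2) := by
  rw [pauliVec_eq]
  ext i j
  fin_cases k <;> fin_cases i <;> fin_cases j <;>
    simp [pauli] <;>
    first | ring1 | linear_combination -2 * (y 1 : ℂ) * Complex.I_sq

theorem pauliPair_snd_eq (yx : E3 × E3) : (pauliPair yx).2 =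
    !![(((‖yx.2‖ : ℝ) : ℂ) + yx.2 2) / 2, (yx.2 0 + yx.2 1 * Complex.I) / 2;
      (yx.2 0 - yx.2 1 * Complex.I) / 2, (((‖yx.2‖ : ℝ) : ℂ) - yx.2 2) / 2] := by
  rw [pauliPair]
  simp only [pauliVec_eq]
  ext i j
  fin_cases i <;> fin_cases j <;> simp <;> ring

theorem trace_pauli_mul (yx : E3 × E3) (k : Fin 3) :
    (pauli k * (pauliPair yx).2).trace = yx.2 k := by
  rw [pauliPair_snd_eq]
  fin_cases k <;> simp [pauli, Matrix.trace_fin_two] <;>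
    first | ring1 | linear_combination -(yx.2 1 : ℂ) * Complex.I_sq

theorem trace_pauliPair_snd (yx : E3 × E3) : (pauliPair yx).2.trace = (‖yx.2‖ : ℝ) := by
  rw [pauliPair_snd_eq, Matrix.trace_fin_two]
  simp
  ring

theorem dotProduct_pauli (k : Fin 3) (a b : Fin 2 → ℂ) :
    star a ⬝ᵥ (pauli k *ᵥ b) = (pauli k * outer b a).trace := by
  rw [mul_outer, trace_outer]

theorem ksMap_fst_apply (w : Twistor 2) (k : Fin 3) :
    (((ksMap w).1 k : ℝ) : ℂ) = (star (sndC w) ⬝ᵥ sndC w)⁻¹ * (1 / 2 : ℂ) *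
      (star (fstC w) ⬝ᵥ (pauli k *ᵥ sndC w) + star (sndC w) ⬝ᵥ (pauli k *ᵥ fstC w)) := by
  change ((Complex.re _ : ℝ) : ℂ) = _
  rw [← Complex.conj_eq_iff_re, ← Complex.star_def]
  have h : ∀ a b : Fin 2 → ℂ, star (star a ⬝ᵥ (pauli k *ᵥ b)) = star b ⬝ᵥ (pauli k *ᵥ a) :=
    fun a b => by rw [star_dot_comm, star_dot_mulVec, (pauli_isHermitian k).eq]
  rw [star_mul', star_mul', star_add, h, h, star_inv₀, star_dot_comm, add_comm]
  norm_num

theorem ksMap_snd_apply (w : Twistor 2) (k : Fin 3) :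
    (((ksMap w).2 k : ℝ) : ℂ) = star (sndC w) ⬝ᵥ (pauli k *ᵥ sndC w) := by
  change ((Complex.re _ : ℝ) : ℂ) = _
  rw [← Complex.conj_eq_iff_re, ← Complex.star_def, star_dot_comm, star_dot_mulVec,
    (pauli_isHermitian k).eq]

theorem ksMap_smul {c : ℂ} (hc : c * star c = 1) (w : Twistor 2) : ksMap (c • w) = ksMap w := by
  have h : ∀ (a b : Fin 2 → ℂ) (A : Mat 2),
      star (c • a) ⬝ᵥ (A *ᵥ (c • b)) = star a ⬝ᵥ (A *ᵥ b) := fun a b A => by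
    rw [Matrix.mulVec_smul, dotProduct_smul, star_smul, smul_dotProduct, smul_smul, hc, one_smul]
  have h' : ∀ a b : Fin 2 → ℂ, star (c • a) ⬝ᵥ (c • b) = star a ⬝ᵥ b := fun a b => by
    simpa using h a b 1
  have hf : fstC (c • w) = c • fstC w := rfl
  have hs : sndC (c • w) = c • sndC w := rfl
  simp only [ksMap, hf, hs, h, h']

/-- The Fierz identity `∑ (ζ^+ σ_k ζ)² = (ζ^+ ζ)²`, followed by extraction of nonnegative square
roots. -/
theorem norm_ksMap_snd (w : Twistor 2) :
    ((‖(ksMap w).2‖ : ℝ) : ℂ) = star (sndC w) ⬝ᵥ sndC w := by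
  obtain ⟨r, hr, hrw⟩ : ∃ r : ℝ, 0 ≤ r ∧ star (sndC w) ⬝ᵥ sndC w = r := by
    by_cases h : sndC w = 0
    · exact ⟨0, le_rfl, by simp [h]⟩
    · obtain ⟨r, hr, h⟩ := exists_pos_star_dot h
      exact ⟨r, hr.le, h⟩
  have h := norm_sq_E3 (ksMap w).2
  rw [ksMap_snd_apply, ksMap_snd_apply, ksMap_snd_apply] at h
  have h2 : ((‖(ksMap w).2‖ : ℝ) : ℂ) ^ 2 = (r : ℂ) ^ 2 := by
    rw [h, ← hrw]
    simp [pauli, dotProduct, Matrix.mulVec, Fin.sum_univ_two]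
    generalize sndC w 0 = a
    generalize sndC w 1 = b
    linear_combination ((starRingEnd ℂ a * b - starRingEnd ℂ b * a) ^ 2) * Complex.I_sq
  have h3 : ‖(ksMap w).2‖ ^ 2 = r ^ 2 := by exact_mod_cast h2
  rw [hrw, (pow_left_inj₀ (norm_nonneg _) hr two_ne_zero).1 h3]

/-- For `n = 2` the coefficient `1/2` makes the bracket in `𝒮` traceless, so it is a combination of
Pauli matrices alone; `ζ ζ^+` has trace `‖x‖`. The coefficients are compared entry by entry. -/
theorem ksSection_eq_pauliPair (w : Twistor 2) : ksSection w = pauliPair (ksMap w) := by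
  refine Prod.ext ?_ ?_
  · rw [ksSection, pauliPair, pauliVec_eq, ksMap_fst_apply, ksMap_fst_apply, ksMap_fst_apply]
    ext i j
    fin_cases i <;> fin_cases j <;>
      simp [pauli, outer, dotProduct, Matrix.mulVec, Fin.sum_univ_two, Matrix.vecMulVec_apply] <;>
      generalize sndC w 0 = a <;> generalize sndC w 1 = b <;> generalize fstC w 0 = c <;>
      generalize fstC w 1 = d <;> ring_nf <;> simp only [Complex.I_sq] <;> ring
  · rw [ksSection, pauliPair_snd_eq, ksMap_snd_apply, ksMap_snd_apply, ksMap_snd_apply,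
      norm_ksMap_snd]
    ext i j
    fin_cases i <;> fin_cases j <;>
      simp [pauli, outer, dotProduct, Matrix.mulVec, Fin.sum_univ_two, Matrix.vecMulVec_apply] <;>
      generalize sndC w 0 = a <;> generalize sndC w 1 = b <;> ring_nf <;>
      simp only [Complex.I_sq] <;> ring

theorem fstC_eq_pauliVec_mulVec {w : Twistor 2} (hw : w ∈ T0t 2) (hz : sndC w ≠ 0) :
    fstC w = pauliVec (ksMap w).1 *ᵥ sndC w := by
  rw [← ksSection_mulVec hw hz, ksSection_eq_pauliPair]
  rfl

/-- From `υ = (y · σ) ζ` and `(y · σ)² = ‖y‖²` one gets `υ^+ υ = ‖y‖² ζ^+ ζ`, and `ζ^+ ζ = ‖x‖`. -/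
theorem IPP_eq_keplerH {w : Twistor 2} (hw : w ∈ T0t 2) (hz : sndC w ≠ 0) :
    IPP w = (keplerH (ksMap w) : ℂ) := by
  have h : star (fstC w) ⬝ᵥ fstC w =
      ((‖(ksMap w).1‖ : ℝ) : ℂ) ^ 2 * (star (sndC w) ⬝ᵥ sndC w) := by
    rw [fstC_eq_pauliVec_mulVec hw hz, star_dot_mulVec, (pauliVec_isHermitian _).eq,
      Matrix.mulVec_mulVec, pauliVec_mul_self, Matrix.smul_mulVec, Matrix.one_mulVec, star_smul,
      smul_dotProduct, star_pow, Complex.star_def, Complex.conj_ofReal, smul_eq_mul]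
  rw [IPP, h, keplerH]
  push_cast
  rw [norm_ksMap_snd]
  ring

/-- The matrix is hermitian with zero determinant and trace `‖x‖`. Its first column divided by the
square root of the upper left entry `p = (‖x‖ + x₃)/2` is the required vector, unless that entry
vanishes. -/
theorem exists_pauliPair_snd_eq {yx : E3 × E3} (h : yx.2 ≠ 0) :
    ∃ z : Fin 2 → ℂ, z ≠ 0 ∧ (pauliPair yx).2 = outer z z := by
  obtain ⟨y, x⟩ := yx
  have h : x ≠ 0 := h
  have hr : 0 < ‖x‖ := norm_pos_iff.2 h
  have hn := EuclideanSpace.real_norm_sq_eq x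
  rw [Fin.sum_univ_three] at hn
  have hx2 : -x 2 ≤ ‖x‖ := by
    have h1 := abs_le_of_sq_le_sq (a := x 2) (b := ‖x‖)
      (by nlinarith [sq_nonneg (x 0), sq_nonneg (x 1)]) hr.le
    linarith [(abs_le.1 h1).1]
  rcases (show 0 ≤ ‖x‖ + x 2 by linarith).eq_or_lt with h0 | h0
  -- On the negative third axis only the lower right entry survives, and the second basis vector is
  -- scaled instead.
  · have h2 : x 2 = -‖x‖ := by linarith
    have h3 : x 0 = 0 ∧ x 1 = 0 := by
      rw [h2] at hn
      constructor <;> nlinarith [sq_nonneg (x 0), sq_nonneg (x 1)]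
    have hs : ((Real.sqrt ‖x‖ : ℝ) : ℂ) * (Real.sqrt ‖x‖ : ℝ) = (‖x‖ : ℝ) := by
      rw [← Complex.ofReal_mul, Real.mul_self_sqrt hr.le]
    refine ⟨![0, (Real.sqrt ‖x‖ : ℝ)], fun hz => ?_, ?_⟩
    · have := congrFun hz 1
      simp at this
      exact h this
    · rw [pauliPair_snd_eq]
      simp only [h2, h3.1, h3.2]
      ext i j
      fin_cases i <;> fin_cases j <;> simp [outer, Matrix.vecMulVec_apply]
      rw [hs]
  · set p := (‖x‖ + x 2) / 2 with hp
    have hp0 : 0 < p := by positivity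
    have hsp : ((Real.sqrt p : ℝ) : ℂ) ≠ 0 := by simpa using (Real.sqrt_pos.2 hp0).ne'
    have hss : ((Real.sqrt p : ℝ) : ℂ) * (Real.sqrt p : ℝ) = (‖x‖ + x 2) / 2 := by
      rw [← Complex.ofReal_mul, Real.mul_self_sqrt hp0.le, hp]; push_cast; rfl
    have hn' := norm_sq_E3 x
    refine ⟨![(Real.sqrt p : ℝ), (x 0 - x 1 * Complex.I) / 2 / (Real.sqrt p : ℝ)],
      fun hz => hsp (by simpa using congrFun hz 0), ?_⟩
    have hstar : (starRingEnd ℂ) ((Real.sqrt p : ℝ) : ℂ) = (Real.sqrt p : ℝ) :=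
      Complex.conj_ofReal _
    have hp0' : (‖x‖ : ℂ) + x 2 ≠ 0 := by
      have : ‖x‖ + x 2 ≠ 0 := h0.ne'
      exact_mod_cast this
    rw [pauliPair_snd_eq]
    simp only
    generalize ((Real.sqrt p : ℝ) : ℂ) = s at *
    ext i j
    fin_cases i <;> fin_cases j <;> simp [outer, Matrix.vecMulVec_apply, hstar]
    · exact hss.symm
    · field_simp
    · field_simp
    · rw [div_mul_div_comm, hss, eq_div_iff (div_ne_zero hp0' two_ne_zero)]
      linear_combination (1 / 4 : ℂ) * hn' + (1 / 4 : ℂ) * (x 1 : ℂ) ^ 2 * Complex.I_sq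

theorem pauliPair_mem_O10t {yx : E3 × E3} (h : yx.2 ≠ 0) : pauliPair yx ∈ O10t 2 :=
  mem_O10t_iff.2 ⟨pauliVec_isHermitian _, exists_pauliPair_snd_eq h⟩

theorem I0t_pauliPair (yx : E3 × E3) : I0t (pauliPair yx) = (keplerH yx : ℂ) := by
  have h1 : (pauliPair yx).1 * (pauliPair yx).1 = ((‖yx.1‖ : ℝ) : ℂ) ^ 2 • (1 : Mat 2) :=
    pauliVec_mul_self _
  rw [I0t, h1, Matrix.mul_add, Matrix.mul_smul, Matrix.mul_one, Matrix.trace_add,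
    Matrix.trace_smul, trace_pauliPair_snd, keplerH]
  push_cast
  rw [smul_eq_mul]
  ring

/-- The transformation recovers the Pauli coordinates of `(Y, X)` from the regularization. -/
theorem ksMap_sumElim {yx : E3 × E3} {z : Fin 2 → ℂ} (hz : z ≠ 0)
    (h : (pauliPair yx).2 = outer z z) :
    ksMap (Sum.elim (pauliVec yx.1 *ᵥ z) z) = yx := by
  refine Prod.ext ?_ ?_
  · ext k
    have h1 := ksMap_fst_apply (Sum.elim (pauliVec yx.1 *ᵥ z) z) k
    have h2 : star (pauliVec yx.1 *ᵥ z) ⬝ᵥ (pauli k *ᵥ z) + star z ⬝ᵥ (pauli k *ᵥ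
        (pauliVec yx.1 *ᵥ z)) = 2 * (yx.1 k : ℂ) * (star z ⬝ᵥ z) := by
      have h3 : star (pauliVec yx.1 *ᵥ z) ⬝ᵥ (pauli k *ᵥ z) =
          star z ⬝ᵥ ((pauliVec yx.1 * pauli k) *ᵥ z) := by
        rw [← Matrix.mulVec_mulVec, star_dot_mulVec (pauliVec yx.1),
          (pauliVec_isHermitian yx.1).eq]
      rw [h3, Matrix.mulVec_mulVec, ← dotProduct_add, ← Matrix.add_mulVec,
        pauliVec_anticommutator, Matrix.smul_mulVec, Matrix.one_mulVec, dotProduct_smul,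
        smul_eq_mul]
    rw [fstC_sumElim, sndC_sumElim, h2] at h1
    have hzz := star_dot_self_ne_zero hz
    have h4 : ((ksMap (Sum.elim (pauliVec yx.1 *ᵥ z) z)).1 k : ℂ) = (yx.1 k : ℂ) := by
      rw [h1]; field_simp
    exact_mod_cast h4
  · ext k
    have h1 := ksMap_snd_apply (Sum.elim (pauliVec yx.1 *ᵥ z) z) k
    rw [sndC_sumElim, dotProduct_pauli, ← h, trace_pauli_mul] at h1
    exact_mod_cast h1

/-! ### Smoothness and symplecticity of the classical transformation -/

theorem contDiffOn_ksMap : ContDiffOn ℝ ∞ ksMap {w | sndC w ≠ 0} := by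
  intro w hw
  refine ContDiffAt.contDiffWithinAt ?_
  have hf : ∀ i, ContDiff ℝ ∞ fun w : Twistor 2 => fstC w i := fun i => contDiff_apply _ _ _
  have hs : ∀ i, ContDiff ℝ ∞ fun w : Twistor 2 => sndC w i := fun i => contDiff_apply _ _ _
  have hdot : ∀ (f g : Twistor 2 → Fin 2 → ℂ), (∀ i, ContDiff ℝ ∞ fun w => f w i) →
      (∀ i, ContDiff ℝ ∞ fun w => g w i) → ContDiff ℝ ∞ fun w => star (f w) ⬝ᵥ g w :=
    fun f g hf hg => ContDiff.sum fun i _ => (contDiff_star.comp (hf i)).mul (hg i)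
  have hmul : ∀ (A : Mat 2) (f : Twistor 2 → Fin 2 → ℂ), (∀ i, ContDiff ℝ ∞ fun w => f w i) →
      ∀ i, ContDiff ℝ ∞ fun w => (A *ᵥ f w) i :=
    fun A f hf i => by
      simp only [Matrix.mulVec, dotProduct]
      exact ContDiff.sum fun j _ => contDiff_const.mul (hf j)
  refine ContDiffAt.prodMk ?_ ?_
  · refine (PiLp.contDiff_toLp.contDiffAt).comp w (contDiffAt_pi.2 fun k => ?_)
    refine contDiff_re.contDiffAt.comp w (ContDiffAt.mul (ContDiffAt.mul ?_ contDiffAt_const) ?_)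
    · exact (hdot _ _ hs hs).contDiffAt.inv (star_dot_self_ne_zero hw)
    · exact ((hdot _ _ hf (hmul _ _ hs)).add (hdot _ _ hs (hmul _ _ hf))).contDiffAt
  · refine (PiLp.contDiff_toLp.contDiffAt).comp w (contDiffAt_pi.2 fun k => ?_)
    exact contDiff_re.contDiffAt.comp w (hdot _ _ hs (hmul _ _ hs)).contDiffAt

theorem isOpen_sndC_ne_zero : IsOpen {w : Twistor 2 | sndC w ≠ 0} := by
  refine isOpen_ne_fun ?_ continuous_const
  exact continuous_pi fun i => continuous_apply _

theorem extD_gammaCan (p u w : E3 × E3) :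
    extD gammaCan p u w =
      ∑ k, (u.1 k : ℂ) * (w.2 k : ℂ) - ∑ k, (w.1 k : ℂ) * (u.2 k : ℂ) := by
  rw [extD_of_bilinear]
  · simp [gammaCan]
  · intro p u w t
    simp only [gammaCan, Prod.fst_add, Prod.smul_fst, PiLp.add_apply, PiLp.smul_apply, smul_eq_mul,
      add_mul, Finset.sum_add_distrib, mul_assoc, ← Finset.mul_sum]
    push_cast
    rfl

theorem trace_mul_pauliVec (b : Mat 2) (y : E3) :
    (b * pauliVec y).trace = ∑ k, (y k : ℂ) * (pauli k * b).trace := by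
  rw [pauliVec, Finset.mul_sum, Matrix.trace_sum]
  refine Finset.sum_congr rfl fun k _ => ?_
  rw [Matrix.mul_smul, Matrix.trace_smul, Matrix.trace_mul_comm, smul_eq_mul]

theorem hasDerivAt_E3_apply {y : ℝ → E3} {y' : E3} {t : ℝ} (h : HasDerivAt y y' t) (k : Fin 3) :
    HasDerivAt (fun s => y s k) (y' k) t :=
  (EuclideanSpace.proj (𝕜 := ℝ) k).hasFDerivAt.comp_hasDerivAt t h

theorem hasDerivAt_pauliVec {y : ℝ → E3} {y' : E3} {t : ℝ} (h : HasDerivAt y y' t) :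
    HasDerivAt (fun s => pauliVec (y s)) (pauliVec y') t := by
  rw [hasDerivAt_matrix]
  intro i j
  simp only [pauliVec, Matrix.sum_apply, Matrix.smul_apply, smul_eq_mul]
  exact HasDerivAt.fun_sum fun k _ => (hasDerivAt_E3_apply h k).ofReal_comp.mul_const _

theorem hasDerivAt_ksMap_curve {c : ℝ → Twistor 2} {a : Twistor 2} {v : E3 × E3}
    (hd : HasDerivAt c a 0) (hcM : ∀ᶠ t in 𝓝 (0 : ℝ), c t ∈ T0t 2) (hz : sndC (c 0) ≠ 0)
    (hks : HasDerivAt (fun t => ksMap (c t)) v 0) :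
    fstC a = pauliVec v.1 *ᵥ sndC (c 0) + pauliVec (ksMap (c 0)).1 *ᵥ sndC a ∧
      ∀ k, ((v.2 k : ℝ) : ℂ) =
        (pauli k * (outer (sndC a) (sndC (c 0)) + outer (sndC (c 0)) (sndC a))).trace := by
  have hcU : ∀ᶠ t in 𝓝 (0 : ℝ), sndC (c t) ≠ 0 :=
    hd.continuousAt (isOpen_sndC_ne_zero.mem_nhds hz)
  have hy : HasDerivAt (fun t => (ksMap (c t)).1) v.1 0 := hasDerivAt_fst hks
  have hx : HasDerivAt (fun t => (ksMap (c t)).2) v.2 0 := hasDerivAt_snd hks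
  obtain ⟨Y, hYdef⟩ : ∃ Y : ℝ → Mat 2, Y = fun t => pauliVec (ksMap (c t)).1 := ⟨_, rfl⟩
  have hev : ∀ᶠ t in 𝓝 (0 : ℝ), fstC (c t) = Y t *ᵥ sndC (c t) := by
    rw [hYdef]
    filter_upwards [hcM, hcU] with t h1 h2 using fstC_eq_pauliVec_mulVec h1 h2
  have hYd : HasDerivAt Y (pauliVec v.1) 0 := by
    rw [hYdef]
    exact hasDerivAt_pauliVec hy
  have hY0 : Y 0 = pauliVec (ksMap (c 0)).1 := congrFun hYdef 0
  refine ⟨?_, fun k => ?_⟩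
  · rw [← hY0]
    exact fstC_deriv_eq hd hYd hev
  · have h1 := (hasDerivAt_E3_apply hx k).ofReal_comp
    have h2 := hasDerivAt_trace (hasDerivAt_mul (hasDerivAt_const (0 : ℝ) (pauli k))
      (hasDerivAt_outer_sndC hd))
    simp only [ksMap_snd_apply, dotProduct_pauli] at h1
    rw [Matrix.zero_mul, zero_add] at h2
    exact h1.unique h2

/-- As for `kReg`, the relations `υ = (y · σ) ζ` and `x_k = tr (σ_k ζ ζ^+)` are differentiated along
curves in the null cone; `gammaPMt_sub_eq_trace` with `Y = y · σ` is then expanded in the Pauli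
basis. -/
theorem extD_gammaCan_ksMap {w : Twistor 2} (hz : sndC w ≠ 0) {a b : Twistor 2}
    (ha : a ∈ tangentVecs (T0t 2) w) (hb : b ∈ tangentVecs (T0t 2) w) :
    extD gammaCan (ksMap w) (fderiv ℝ ksMap w a) (fderiv ℝ ksMap w b) = extD gammaPMt w a b := by
  have hdf := ((contDiffOn_ksMap.contDiffAt (isOpen_sndC_ne_zero.mem_nhds hz)).differentiableAt
    (by simp)).hasFDerivAt
  have key : ∀ a ∈ tangentVecs (T0t 2) w,
      fstC a = pauliVec (fderiv ℝ ksMap w a).1 *ᵥ sndC w + pauliVec (ksMap w).1 *ᵥ sndC a ∧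
      ∀ k, (((fderiv ℝ ksMap w a).2 k : ℝ) : ℂ) =
        (pauli k * (outer (sndC a) (sndC w) + outer (sndC w) (sndC a))).trace := by
    intro a ha
    obtain ⟨c, rfl, hd, hcM, -⟩ := mem_tangentVecs_iff.1 ha
    have hks := hdf.comp_hasDerivAt (0 : ℝ) hd
    exact hasDerivAt_ksMap_curve hd hcM hz hks
  obtain ⟨ha1, ha2⟩ := key a ha
  obtain ⟨hb1, hb2⟩ := key b hb
  generalize fderiv ℝ ksMap w a = u at *
  generalize fderiv ℝ ksMap w b = v at *
  have h := gammaPMt_sub_eq_trace (pauliVec_isHermitian (ksMap w).1) (pauliVec_isHermitian u.1)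
    (pauliVec_isHermitian v.1) ha1 hb1
  rw [trace_mul_pauliVec, trace_mul_pauliVec] at h
  simp only [← ha2, ← hb2] at h
  rw [extD_gammaPMt, extD_gammaCan, ← h]

/-- The Kustaanheimo–Stiefel transformation on the reduced space. -/
noncomputable def reducedKS : RedT0t 2 → E3 × E3 :=
  -- The lift covers all classes, including those with `ζ = 0`: there the inverse of zero is zero
  -- and the value is `(0, 0)`.
  Quotient.lift (fun w : T0t 2 => ksMap w) fun p q hpq => by
    have hcls : cls gammaPMt (T0t 2) p.1 p.2 = cls gammaPMt (T0t 2) q.1 q.2 := Quotient.sound hpq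
    have h := cls_eq_iff_JPMt.1 hcls
    obtain ⟨c, hc, hcw⟩ := eq_smul_of_outer_eq (outer2_eq_of_JPMt_eq h)
    change ksMap p = ksMap q
    rw [hcw, ksMap_smul hc]

theorem reducedKS_cls {w : Twistor 2} (hw : w ∈ T0t 2) : reducedKS (cls _ _ w hw) = ksMap w := rfl

theorem reducedKS_kReg (D : ReducedMaps 2) {yx : E3 × E3} (h : yx.2 ≠ 0) :
    reducedKS (D.kReg (cls _ _ (pauliPair yx) (pauliPair_mem_O10t h))) = yx := by
  obtain ⟨z, hz, hX⟩ := exists_pauliPair_snd_eq h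
  have h1 : D.kReg (cls _ _ (pauliPair yx) (pauliPair_mem_O10t h)) =
      cls _ _ _ (sumElim_mem_T0t (pauliVec_isHermitian yx.1) hz) := by
    rw [D.kReg_eq_iff, ← J0t_eq_JPMt (pauliVec_isHermitian yx.1), ← hX]
    rfl
  rw [h1, reducedKS_cls, ksMap_sumElim hz hX]

/-- Injectivity: `(y, x)` determines `𝒮(υ, ζ)`, from which `kReg` returns the class. Surjectivity:
the class `kReg [pauliPair (y, x)]` is a preimage. -/
theorem bijOn_reducedKS (D : ReducedMaps 2) :
    Set.BijOn reducedKS (dotRedT0t 2) {yx | yx.2 ≠ 0} := by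
  refine ⟨?_, ?_, ?_⟩
  · rintro _ ⟨w, hw, hz, rfl⟩
    change (ksMap w).2 ≠ 0
    intro h
    have h1 := norm_ksMap_snd w
    rw [h, norm_zero, Complex.ofReal_zero] at h1
    exact star_dot_self_ne_zero hz h1.symm
  · rintro _ ⟨w, hw, hz, rfl⟩ _ ⟨w', hw', hz', rfl⟩ h
    rw [reducedKS_cls, reducedKS_cls] at h
    have h1 : ksSection w = ksSection w' := by
      rw [ksSection_eq_pauliPair, ksSection_eq_pauliPair, h]
    rw [← D.kReg_ksSection hw hz, ← D.kReg_ksSection hw' hz']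
    congr 1
    simp only [h1]
  · intro yx h
    refine ⟨_, ?_, reducedKS_kReg D h⟩
    rw [← D.range_kReg]
    exact Set.mem_range_self _

end KSCayley

/-! ### Assembly of the theorem -/

theorem mainTheorem3 :
    ∃ D : (n : ℕ) → 0 < n → KSCayley.ReducedMaps n,
      (∀ (n : ℕ) (hn : 0 < n),
        -- the Cayley regularization is the KS regularization followed by `𝒞/∼`
        (D n hn).cReg = (D n hn).c ∘ (D n hn).kReg ∧
        -- `𝒞/∼` is an isomorphism of the regularized Hamiltonian systems
        KSCayley.IsHamiltonianMap KSCayley.gammaPMt (KSCayley.T0t n) KSCayley.IPP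
          KSCayley.gammaPM (KSCayley.T0 n) KSCayley.IPP (D n hn).c ∧
        KSCayley.IsHamiltonianMap KSCayley.gammaPM (KSCayley.T0 n) KSCayley.IPP
          KSCayley.gammaPMt (KSCayley.T0t n) KSCayley.IPP (D n hn).c.symm ∧
        -- both maps are regularizations: injective morphisms of Hamiltonian systems
        Function.Injective (D n hn).kReg ∧
        KSCayley.IsHamiltonianMap KSCayley.gamma0t (KSCayley.O10t n) KSCayley.I0t
          KSCayley.gammaPMt (KSCayley.T0t n) KSCayley.IPP (D n hn).kReg ∧
        Function.Injective (D n hn).cReg ∧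
        KSCayley.IsHamiltonianMap KSCayley.gamma0t (KSCayley.O10t n) KSCayley.I0t
          KSCayley.gammaPM (KSCayley.T0 n) KSCayley.IPP (D n hn).cReg ∧
        -- `K_reg [(Y, ζ ζ^+)] = [(Y ζ, ζ)]`, with image the classes with `ζ ≠ 0`
        (∀ (Y : KSCayley.Mat n) (ζ : Fin n → ℂ), Y.IsHermitian → ζ ≠ 0 →
          ∃ (h : (Y, KSCayley.outer ζ ζ) ∈ KSCayley.O10t n)
            (h' : Sum.elim (Matrix.mulVec Y ζ) ζ ∈ KSCayley.T0t n),
            (D n hn).kReg (KSCayley.cls _ _ (Y, KSCayley.outer ζ ζ) h) =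
              KSCayley.cls _ _ (Sum.elim (Matrix.mulVec Y ζ) ζ) h') ∧
        Set.range (D n hn).kReg = KSCayley.dotRedT0t n ∧
        -- the generalized KS transformation `𝒮` inverts `K_reg`
        (∀ (w : KSCayley.Twistor n) (hw : w ∈ KSCayley.T0t n), KSCayley.sndC w ≠ 0 →
          ∃ h : KSCayley.ksSection w ∈ KSCayley.O10t n,
            (D n hn).kReg (KSCayley.cls _ _ (KSCayley.ksSection w) h) =
              KSCayley.cls _ _ w hw)) ∧
      -- the case `n = 2`: the classical KS transformation
      (∃ κ : KSCayley.RedT0t 2 → KSCayley.E3 × KSCayley.E3,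
        (∀ (w : KSCayley.Twistor 2) (hw : w ∈ KSCayley.T0t 2), KSCayley.sndC w ≠ 0 →
          κ (KSCayley.cls _ _ w hw) = KSCayley.ksMap w) ∧
        Set.BijOn κ (KSCayley.dotRedT0t 2) {yx | yx.2 ≠ 0} ∧
        -- it is smooth and symplectic, and the Hamiltonian becomes the Kepler Hamiltonian
        ContDiffOn ℝ ∞ KSCayley.ksMap {w | KSCayley.sndC w ≠ 0} ∧
        (∀ w ∈ KSCayley.T0t 2, KSCayley.sndC w ≠ 0 →
          (∀ a ∈ KSCayley.tangentVecs (KSCayley.T0t 2) w,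
            ∀ b ∈ KSCayley.tangentVecs (KSCayley.T0t 2) w,
            KSCayley.extD KSCayley.gammaCan (KSCayley.ksMap w)
              (fderiv ℝ KSCayley.ksMap w a) (fderiv ℝ KSCayley.ksMap w b) =
                KSCayley.extD KSCayley.gammaPMt w a b) ∧
          KSCayley.IPP w = (KSCayley.keplerH (KSCayley.ksMap w) : ℂ) ∧
          -- in Pauli coordinates `𝒮` is the KS transformation
          KSCayley.ksSection w = KSCayley.pauliPair (KSCayley.ksMap w)) ∧
        -- `K_reg` is its inverse in Pauli coordinates
        (∀ yx : KSCayley.E3 × KSCayley.E3, yx.2 ≠ 0 →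
          ∃ h : KSCayley.pauliPair yx ∈ KSCayley.O10t 2,
            κ ((D 2 two_pos).kReg (KSCayley.cls _ _ (KSCayley.pauliPair yx) h)) = yx ∧
            KSCayley.I0t (KSCayley.pauliPair yx) = (KSCayley.keplerH yx : ℂ))) := by
  exact ⟨fun _ hn => KSCayley.reducedMaps hn, fun n hn =>
    ⟨KSCayley.ReducedMaps.cReg_eq _, KSCayley.ReducedMaps.isHamiltonianMap_c _,
      KSCayley.ReducedMaps.isHamiltonianMap_c_symm _, KSCayley.ReducedMaps.kReg_injective _,
      KSCayley.ReducedMaps.isHamiltonianMap_kReg _, KSCayley.ReducedMaps.cReg_injective _,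
      KSCayley.ReducedMaps.isHamiltonianMap_cReg _,
      fun Y ζ hY hζ => ⟨KSCayley.mem_O10t_iff.2 ⟨hY, ζ, hζ, rfl⟩,
        KSCayley.sumElim_mem_T0t hY hζ, KSCayley.ReducedMaps.kReg_cls_outer _ hY hζ _⟩,
      KSCayley.ReducedMaps.range_kReg _,
      fun w hw hz => ⟨KSCayley.ksSection_mem_O10t hz,
        KSCayley.ReducedMaps.kReg_ksSection _ hw hz⟩⟩,
    KSCayley.reducedKS, fun w hw _ => KSCayley.reducedKS_cls hw,
    KSCayley.bijOn_reducedKS (KSCayley.reducedMaps two_pos), KSCayley.contDiffOn_ksMap,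
    fun w hw hz => ⟨fun a ha b hb => KSCayley.extD_gammaCan_ksMap hz ha hb,
      KSCayley.IPP_eq_keplerH hw hz, KSCayley.ksSection_eq_pauliPair w⟩,
    fun yx h => ⟨KSCayley.pauliPair_mem_O10t h, KSCayley.reducedKS_kReg _ h,
      KSCayley.I0t_pauliPair yx⟩⟩
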